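/- Let $g\ge 0$ and $m,n\ge 1$ be integers, and put $r=2g-2+m+n$. Let $\alpha=(\alpha_1,\dots,\alpha_m)$ and $\beta=(\beta_1,\dots,\beta_n)$ be tuples of positive integers with $\sum_i\alpha_i=\sum_j\beta_j=d$. The double Hurwitz number $H^g_{\alpha,\beta}$ counts, with weight the reciprocal of the number of automorphisms, the connected genus $g$ branched covers of $\mathbb{CP}^1$ with branching $\alpha$ over $0$ and $\beta$ over $\infty$ (the points over $0$ and $\infty$ being labelled) and $r$ further fixed simple branch points. In terms of monodromy, $$H^g_{\alpha,\beta}=\frac{|\mathrm{Aut}\,\alpha|\,|\mathrm{Aut}\,\beta|}{d!}\cdot\#\{(\sigma,\tau_1,\dots,\tau_r,\gamma)\},$$ where $\sigma,\gamma\in\mathfrak S_d$ have cycle types $\beta$ and $\alpha$ respectively, $\tau_1,\dots,\tau_r\in\mathfrak S_d$ are transpositions, $\tau_r\cdots\tau_1\sigma=\gamma$, and the group generated by $\sigma,\tau_1,\dots,\tau_r$ acts transitively on $\{1,\dots,d\}$. Here $\mathrm{Aut}\,\alpha$ is the group of permutations of $\{1,\dots,m\}$ that fix the tuple $\alpha$,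 and likewise for $\beta$. **Theorem 2.1 (Piecewise polynomiality).** Fix $g,m,n$ with $(g,m,n)\neq(0,1,1)$, and let $P^g_{m,n}(\alpha_1,\dots,\alpha_m,\beta_1,\dots,\beta_n)=H^g_{\alpha,\beta}$, a function on the set of $(m+n)$-tuples of positive integers with $\sum_i\alpha_i=\sum_j\beta_j$. 1. $P^g_{m,n}$ is piecewise polynomial of degree up to $4g-3+m+n$: its domain is covered by finitely many closed rational polyhedral cones, and on the points of the domain in each of these cones $P^g_{m,n}$ agrees with a polynomial with rational coefficients in $\alpha_1,\dots,\alpha_m,\beta_1,\dots,\beta_n$ of total degree at most $4g-3+m+n$. 2. The leading term of degree $4g-3+m+n$ is nonzero: for every fixed $(\alpha,\beta)$ in the domain, $P^g_{m,n}(t\alpha_1,\dots,t\alpha_m,t\beta_1,\dots,t\beta_n)$, as a function of the positive integer $t$, is a polynomial in $t$ of degree exactly $4g-3+m+n$. In the excluded case $(g,m,n)=(0,1,1)$, where $r=0$, one has $H^0_{(d),(d)}=1/d$ for all $d\ge 1$. -/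

import Mathlib

/-- The order of `Aut a`, the group of permutations of the index set fixing the tuple `a`. -/
noncomputable def autCard {k : ℕ} (a : Fin k → ℕ) : ℕ :=
  Nat.card {e : Equiv.Perm (Fin k) // ∀ i, a (e i) = a i}

/-- `σ` lies in the conjugacy class of `𝔖_d` indexed by `a`: the multiset of the lengths of all
cycles of `σ`, fixed points included as cycles of length `1`, is the multiset of entries of `a`. -/
def InClass {d k : ℕ} (a : Fin k → ℕ) (σ : Equiv.Perm (Fin d)) : Prop :=
  σ.partition.parts = (Finset.univ : Finset (Fin k)).val.map a

/-- The transitive ordered factorizations `(σ, (τ₁, …, τ_r), γ)` in `𝔖_d`, with `σ` of class `β`,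
`γ` of class `α`, each `τ_i` a transposition, `τ_r ⋯ τ₁ σ = γ`, and `⟨σ, τ₁, …, τ_r⟩` transitive.
These are the monodromy data of connected degree `d` branched covers of the sphere with branching
`α` and `β` over two points, `r` further simple branch points, and sheets labelled `1, …, d`. -/
def transitiveFactorizations (d r : ℕ) {m n : ℕ} (α : Fin m → ℕ) (β : Fin n → ℕ) :
    Set (Equiv.Perm (Fin d) × (Fin r → Equiv.Perm (Fin d)) × Equiv.Perm (Fin d)) :=
  {x | InClass β x.1 ∧ InClass α x.2.2 ∧ (∀ i, (x.2.1 i).IsSwap) ∧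
    (List.ofFn x.2.1).reverse.prod * x.1 = x.2.2 ∧
    MulAction.IsPretransitive (Subgroup.closure (insert x.1 (Set.range x.2.1))) (Fin d)}

/-- The double Hurwitz number `H^g_{α,β}` (points over `0` and `∞` labelled), for
`α = (α₁, …, α_m)` and `β = (β₁, …, β_n)` with `m, n ≥ 1`. Here `d = ∑ α_i`, and the number of
simple branch points is `r = 2g - 2 + m + n`. -/
noncomputable def doubleHurwitz (g : ℕ) {m n : ℕ} (α : Fin m → ℕ) (β : Fin n → ℕ) : ℚ :=
  (autCard α : ℚ) * (autCard β : ℚ) / ((∑ i, α i).factorial : ℚ) *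
    ((transitiveFactorizations (∑ i, α i) (2 * g + m + n - 2) α β).ncard : ℚ)

/-- The `(m+n)`-tuples of positive integers in which the first `m` entries and the last `n`
entries have the same sum. -/
def hurwitzDomain (m n : ℕ) : Set (Fin m ⊕ Fin n → ℕ) :=
  {x | (∀ i, 0 < x i) ∧ ∑ i, x (Sum.inl i) = ∑ j, x (Sum.inr j)}

/-- The double Hurwitz number as a function `P^g_{m,n}` of the parts of `α` and `β`. -/
noncomputable def hurwitzFunction (g m n : ℕ) (x : Fin m ⊕ Fin n → ℕ) : ℚ :=
  doubleHurwitz g (fun i => x (Sum.inl i)) (fun j => x (Sum.inr j))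

/-- The lattice points of the closed rational polyhedral cone cut out by the finitely many
homogeneous linear inequalities `∑ i, a i * x i ≥ 0`, `a ∈ A`. -/
def coneLatticePoints {ι : Type*} [Fintype ι] (A : Finset (ι → ℤ)) : Set (ι → ℕ) :=
  {x | ∀ a ∈ A, 0 ≤ ∑ i, a i * (x i : ℤ)}

/-- `f` is piecewise polynomial of degree at most `D` on the set `S` of lattice points: `S` is
covered by finitely many closed rational polyhedral cones, and on the points of `S` in each of
them `f` agrees with a polynomial of total degree at most `D`. -/
def IsPiecewisePolynomialOn {ι : Type*} [Fintype ι] (S : Set (ι → ℕ)) (f : (ι → ℕ) → ℚ)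
    (D : ℕ) : Prop :=
  ∃ (k : ℕ) (A : Fin k → Finset (ι → ℤ)) (p : Fin k → MvPolynomial ι ℚ),
    S ⊆ ⋃ c, coneLatticePoints (A c) ∧
    ∀ c, (p c).totalDegree ≤ D ∧
      ∀ x ∈ S ∩ coneLatticePoints (A c), f x = MvPolynomial.eval (fun i => (x i : ℚ)) (p c)

/-!
# Piecewise polynomiality of double Hurwitz numbers

A permutation `σ` of class `β` is multiplied by transpositions one at a time, and its cycles are
carried along as labelled strands. There are `a * b` transpositions that join two given cycles of
lengths `a` and `b`, and `a` ordered pairs of sheets whose swap cuts a given cycle of length `a`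
into a first and a second part of given lengths. Hence the monodromy count satisfies a cut and join
recursion, whose solution is called `completions`, and `H = completions / ∏ β`
(`doubleHurwitz_eq_completions`). Block names of strands record connectedness.

Unrolled, the recursion is a rational combination of sums over directed graphs: the edges carry
positive integer flows, conserved at each vertex, with prescribed flows `β` on the ingoing and `α`
on the outgoing edges, and each configuration is weighted by the product of the flows on those edges
that run into a vertex where strands are cut or joined (`FlowSystem.completions_mem_countSpan`).
Each such sum is a sum of a polynomial over the lattice points of a polytope cut out by the
incidence matrix of a graph. As this matrix is totally unimodular, variables can be eliminated one
after the other over the integers; every summation over an interval raises the degree by one. The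
result is a polynomial on each chamber of a finite arrangement of hyperplanes
(`exists_polynomial_sumOver_constrained`). To obtain the same polynomial on the closed chamber, the
inequalities are perturbed by a small generic vector that breaks ties between bounds; this does not
change the sum, since the weights vanish where a flow is zero. The degree is the number of weighted
edges plus the dimension of the space of flows, `4 * g - 3 + m + n` by the Euler characteristic,
after the factor `∏ β` of the ingoing edges has been cancelled.

The degree is exact because all terms of the recursion are nonnegative, and scaling by `t` already
gives order `t ^ (4 * g - 3 + m + n)`, after division by `∏ β`, to the following terms: join all
strands to one, cut and rejoin it `g` times, then cut off the ends one at a time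
(`le_completions`).
-/


/-! ### Unimodular families of integer linear forms -/

/-- A set `R` of integer linear forms is unimodular in the variables `K` if every square minor of
the coefficient matrix with columns in `K` is `0`, `1` or `-1`. -/
def Unimodular {I : Type*} (R : Set (I → ℤ)) (K : Set I) : Prop :=
  ∀ (n : ℕ) (f : Fin n → I → ℤ) (g : Fin n → I), (∀ i, f i ∈ R) → (∀ j, g j ∈ K) →
    |(Matrix.of fun i j => f i (g j)).det| ≤ 1

/-- The form `w` after elimination of the variable `k` by means of the form `w₀`, when `w₀` has
coefficient `±1` at `k`. -/
def pivotForm {I : Type*} (w₀ : I → ℤ) (k : I) (w : I → ℤ) : I → ℤ :=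
  fun i => w i - w k * w₀ k * w₀ i

namespace Unimodular

variable {I : Type*} {R S : Set (I → ℤ)} {K M : Set I}

theorem mono (h : Unimodular R K) (hS : S ⊆ R) (hM : M ⊆ K) : Unimodular S M :=
  fun n f g hf hg => h n f g (fun i => hS (hf i)) (fun j => hM (hg j))

theorem abs_coeff_le (h : Unimodular R K) {w : I → ℤ} (hw : w ∈ R) {k : I} (hk : k ∈ K) :
    |w k| ≤ 1 := by
  simpa using h 1 (fun _ => w) (fun _ => k) (fun _ => hw) (fun _ => hk)

theorem coeff_mul_self (h : Unimodular R K) {w : I → ℤ} (hw : w ∈ R) {k : I} (hk : k ∈ K)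
    (h0 : w k ≠ 0) : w k * w k = 1 := by
  have h1 := abs_le.1 (h.abs_coeff_le hw hk)
  have : w k = 1 ∨ w k = -1 := by omega
  rcases this with h | h <;> simp [h]

/-- Unimodularity survives a pivot: a minor of the new system is, up to sign, the minor of the old
one with the pivot row and column added. -/
theorem pivot (h : Unimodular R K) {w₀ : I → ℤ} (hw : w₀ ∈ R) {k : I} (hk : k ∈ K)
    (h0 : w₀ k ≠ 0) : Unimodular (pivotForm w₀ k '' R) K := by
  intro n f g hf hg
  choose f' hf' hff using hf
  have hsq := h.coeff_mul_self hw hk h0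
  let A : Matrix (Fin (n + 1)) (Fin (n + 1)) ℤ :=
    Matrix.of fun i j => (Fin.cons w₀ f' : Fin (n + 1) → I → ℤ) i ((Fin.cons k g : Fin (n + 1) → I) j)
  let B : Matrix (Fin (n + 1)) (Fin (n + 1)) ℤ :=
    Matrix.of fun i j => (Fin.cons w₀ f : Fin (n + 1) → I → ℤ) i ((Fin.cons k g : Fin (n + 1) → I) j)
  have hA : |A.det| ≤ 1 := by
    apply h
    · intro i
      refine Fin.cases ?_ (fun i => ?_) i
      · simpa using hw
      · simpa using hf' i
    · intro i
      refine Fin.cases ?_ (fun i => ?_) i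
      · simpa using hk
      · simpa using hg i
  have hAB : A.det = B.det := by
    refine Matrix.det_eq_of_forall_row_eq_smul_add_const
      (Fin.cons 0 fun i => f' i k * w₀ k) 0 (by simp) ?_
    intro i j
    refine Fin.cases ?_ (fun i => ?_) i
    · simp [A, B]
    · simp only [A, B, Matrix.of_apply, Fin.cons_succ, Fin.cons_zero, ← hff i, pivotForm]
      ring
  have hB : B.det = w₀ k * (Matrix.of fun i j => f i (g j)).det := by
    rw [Matrix.det_succ_column_zero, Fin.sum_univ_succ, Finset.sum_eq_zero]
    · simp [B]
      left
      congr 1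
    · intro i _
      have : B i.succ 0 = 0 := by
        simp only [B, Matrix.of_apply, Fin.cons_succ, Fin.cons_zero, ← hff i, pivotForm]
        linear_combination (-f' i k) * hsq
      rw [this]
      ring
  rw [hAB, hB, abs_mul] at hA
  have h1 : |w₀ k| = 1 := by
    have := h.abs_coeff_le hw hk
    have := abs_pos.2 h0
    omega
  simpa [h1] using hA

end Unimodular

/-- The form of net flow into the vertex `j` of a directed graph whose edges are the variables;
edges may lack a head or a tail. -/
def incidenceForm {I : Type*} [DecidableEq I] (head tail : I → Option I) (j : I) : I → ℤ :=
  fun k => (if head k = some j then 1 else 0) - (if tail k = some j then 1 else 0)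

theorem isTotallyUnimodular_incidence {I : Type*} [DecidableEq I] (head tail : I → Option I) :
    (Matrix.of (incidenceForm head tail)).IsTotallyUnimodular := by
  intro n
  induction n with
  | zero => intro f g _ _; exact ⟨1, by simp⟩
  | succ n ih =>
    intro f g hf hg
    set A := (Matrix.of (incidenceForm head tail)).submatrix f g with hA
    by_cases hall : ∀ c, ∑ i, A i c = 0
    · refine ⟨0, ?_⟩
      have : A.det = 0 := by
        rw [← Matrix.exists_vecMul_eq_zero_iff]
        refine ⟨1, by simp, ?_⟩
        ext c
        simpa [Matrix.vecMul, dotProduct] using hall c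
      simp [this]
    · push Not at hall
      obtain ⟨c, hc⟩ := hall
      -- a column whose entries do not cancel has at most one nonzero entry
      have huniq : ∃ i₀, ∀ i, i ≠ i₀ → A i c = 0 := by
        have hval : ∀ i, A i c = (if head (g c) = some (f i) then 1 else 0)
            - (if tail (g c) = some (f i) then 1 else 0) := fun i => rfl
        by_cases h1 : ∃ i, head (g c) = some (f i)
        · obtain ⟨i₁, h1⟩ := h1
          have e1 : ∀ i, (head (g c) = some (f i) ↔ i = i₁) := by
            intro i
            rw [h1, Option.some_inj]
            exact ⟨fun h => (hf h).symm, fun h => by rw [h]⟩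
          by_cases h2 : ∃ i, tail (g c) = some (f i)
          · obtain ⟨i₂, h2⟩ := h2
            exfalso
            apply hc
            have e2 : ∀ i, (tail (g c) = some (f i) ↔ i = i₂) := by
              intro i
              rw [h2, Option.some_inj]
              exact ⟨fun h => (hf h).symm, fun h => by rw [h]⟩
            simp [hval, e1, e2, Finset.sum_sub_distrib]
          · push Not at h2
            refine ⟨i₁, fun i hi => ?_⟩
            simp [hval, e1, hi, h2]
        · push Not at h1
          by_cases h2 : ∃ i, tail (g c) = some (f i)
          · obtain ⟨i₂, h2⟩ := h2
            refine ⟨i₂, fun i hi => ?_⟩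
            have : tail (g c) ≠ some (f i) := by
              rw [h2, Ne, Option.some_inj]
              exact fun h => hi (hf h).symm
            simp [hval, h1, this]
          · push Not at h2
            exact ⟨0, fun i _ => by simp [hval, h1, h2]⟩
      obtain ⟨i₀, hi₀⟩ := huniq
      rw [Matrix.det_succ_column A c, Finset.sum_eq_single i₀]
      · obtain ⟨s, hs⟩ := ih (f ∘ i₀.succAbove) (g ∘ c.succAbove)
          (hf.comp Fin.succAbove_right_injective) (hg.comp Fin.succAbove_right_injective)
        have h3 : (A.submatrix i₀.succAbove c.succAbove).det = s := by
          rw [hs, hA, Matrix.submatrix_submatrix]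
        have h4 : ∃ t : SignType, (t : ℤ) = A i₀ c := by
          have : A i₀ c = (if head (g c) = some (f i₀) then 1 else 0)
            - (if tail (g c) = some (f i₀) then 1 else 0) := rfl
          rw [this]
          split_ifs
          · exact ⟨0, by simp⟩
          · exact ⟨1, by simp⟩
          · exact ⟨-1, by simp⟩
          · exact ⟨0, by simp⟩
        obtain ⟨t, ht⟩ := h4
        rw [h3, ← ht]
        rcases neg_one_pow_eq_or ℤ ((i₀ : ℕ) + c) with h | h <;> rw [h]
        · exact ⟨t * s, by simp⟩
        · exact ⟨-(t * s), by simp⟩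
      · intro i _ hi
        rw [hi₀ i hi]
        ring
      · simp

/-- The incidence forms of a directed graph, together with the coordinate forms, are unimodular. -/
theorem unimodular_incidence {I : Type*} [DecidableEq I] (head tail : I → Option I) :
    Unimodular (Set.range (incidenceForm head tail) ∪ Set.range fun k : I => Pi.single k (1 : ℤ))
      Set.univ := by
  have h := (Matrix.fromRows_one_isTotallyUnimodular_iff _).2
    (isTotallyUnimodular_incidence head tail)
  rw [Matrix.isTotallyUnimodular_iff] at h
  intro n f g hf _
  have : ∀ i, ∃ r : I ⊕ I, f i = Matrix.fromRows (Matrix.of (incidenceForm head tail)) 1 r := by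
    intro i
    rcases hf i with ⟨j, hj⟩ | ⟨k, hk⟩
    · exact ⟨Sum.inl j, by rw [← hj]; rfl⟩
    · refine ⟨Sum.inr k, ?_⟩
      rw [← hk]
      ext x
      simp [Matrix.one_apply, Pi.single_apply, eq_comm]
  choose r hr using this
  obtain ⟨s, hs⟩ := h n r g
  have e : (Matrix.of fun i j => f i (g j))
      = (Matrix.fromRows (Matrix.of (incidenceForm head tail)) 1).submatrix r g := by
    ext i j
    simp [hr i]
  rw [e, ← hs]
  cases s <;> simp

/-! ### Finite sums over integer slices -/

/-- The integer vectors that agree with `z` outside the set `K` of variables. -/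
def slice {I : Type*} (K : Finset I) (z : I → ℤ) : Set (I → ℤ) :=
  {x | ∀ i, i ∉ K → x i = z i}

/-- The sum of `F` over all integer values of the variables in `K`, the other variables being kept
at their values in `z`. It is meaningful when `F` has finite support on each slice. -/
noncomputable def sumOver {I : Type*} (K : Finset I) (F : (I → ℤ) → ℚ) (z : I → ℤ) : ℚ :=
  ∑ᶠ x ∈ slice K z, F x

/-- `F` has finite support on every slice in the variables `K`. -/
def FiniteOnSlices {I : Type*} (K : Finset I) (F : (I → ℤ) → ℚ) : Prop :=
  ∀ z, (slice K z ∩ Function.support F).Finite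

section Slices

variable {I : Type*} {K : Finset I} {F G : (I → ℤ) → ℚ} {z : I → ℤ}

theorem sumOver_empty : sumOver ∅ F z = F z := by
  have : slice ∅ z = {z} := by
    ext x
    simp [slice, funext_iff]
  rw [sumOver, this, finsum_mem_singleton]

theorem sumOver_congr (h : ∀ x ∈ slice K z, F x = G x) : sumOver K F z = sumOver K G z :=
  finsum_mem_congr rfl h

theorem sumOver_zero (h : ∀ x ∈ slice K z, F x = 0) : sumOver K F z = 0 := by
  rw [sumOver_congr (G := fun _ => 0) h, sumOver, finsum_mem_zero]

theorem sumOver_sum {ι : Type*} (s : Finset ι) (f : ι → (I → ℤ) → ℚ)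
    (h : ∀ i ∈ s, FiniteOnSlices K (f i)) :
    sumOver K (fun x => ∑ i ∈ s, f i x) z = ∑ i ∈ s, sumOver K (f i) z := by
  classical
  induction s using Finset.induction_on with
  | empty => simp [sumOver]
  | insert a s ha ih =>
    simp only [Finset.sum_insert ha]
    rw [← ih fun i hi => h i (Finset.mem_insert_of_mem hi)]
    refine finsum_mem_add_distrib' (h a (Finset.mem_insert_self _ _) z) ?_
    refine Set.Finite.subset (s.finite_toSet.biUnion
      fun i hi => h i (Finset.mem_insert_of_mem hi) z) ?_
    rintro x ⟨hx, hx'⟩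
    obtain ⟨i, hi, hne⟩ := Finset.exists_ne_zero_of_sum_ne_zero hx'
    exact Set.mem_biUnion (Finset.mem_coe.2 hi) ⟨hx, hne⟩

theorem sumOver_const_mul (c : ℚ) :
    sumOver K (fun x => c * F x) z = c * sumOver K F z := by
  simp only [sumOver, finsum_mem_def]
  rw [← smul_eq_mul, smul_finsum]
  refine finsum_congr fun x => ?_
  by_cases hx : x ∈ slice K z <;> simp [hx]

theorem FiniteOnSlices.mono (h : FiniteOnSlices K F) {M : Finset I} (hM : M ⊆ K)
    (hFG : ∀ x, G x ≠ 0 → F x ≠ 0) : FiniteOnSlices M G := fun z =>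
  (h z).subset fun x hx => ⟨fun i hi => hx.1 i fun h => hi (hM h), hFG x hx.2⟩

variable [DecidableEq I]

/-- The slice in one more variable `k` is the product of the smaller slice with the range of `k`. -/
theorem bijOn_update_slice {k : I} (hk : k ∉ K) (z : I → ℤ) :
    Set.BijOn (fun p : (I → ℤ) × ℤ => Function.update p.1 k p.2) (slice K z ×ˢ Set.univ)
      (slice (insert k K) z) := by
  refine ⟨?_, ?_, ?_⟩
  · rintro ⟨x, t⟩ ⟨hx, -⟩ i hi
    simp only [Finset.mem_insert, not_or] at hi
    simpa [hi.1] using hx i hi.2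
  · rintro ⟨x, t⟩ ⟨hx, -⟩ ⟨y, s⟩ ⟨hy, -⟩ h
    have h' := fun i => congrFun h i
    simp only at h'
    have hts : t = s := by simpa using h' k
    refine Prod.ext (funext fun i => ?_) hts
    by_cases hi : i = k
    · subst hi
      exact (hx i hk).trans (hy i hk).symm
    · simpa [hi] using h' i
  · intro x hx
    refine ⟨(Function.update x k (z k), x k), ⟨fun i hi => ?_, trivial⟩, by simp⟩
    by_cases hik : i = k
    · subst hik; simp
    · simpa [hik] using hx i (by simp [hi, hik])

theorem sumOver_insert_prod {k : I} (hk : k ∉ K) :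
    sumOver (insert k K) F z =
      ∑ᶠ p : (I → ℤ) × ℤ, (slice K z).indicator (fun x => F (Function.update x k p.2)) p.1 := by
  rw [sumOver, ← finsum_mem_eq_of_bijOn _ (bijOn_update_slice hk z) fun _ _ => rfl,
    finsum_mem_def]
  refine finsum_congr fun p => ?_
  by_cases hp : p.1 ∈ slice K z <;> simp [Set.indicator, hp]

theorem hasFiniteSupport_insert {k : I} (hk : k ∉ K) (h : FiniteOnSlices (insert k K) F) :
    Function.HasFiniteSupport fun p : (I → ℤ) × ℤ =>
      (slice K z).indicator (fun x => F (Function.update x k p.2)) p.1 := by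
  have hb := bijOn_update_slice hk z
  refine Set.Finite.of_finite_image ((h z).subset ?_) (hb.injOn.mono ?_) (f := fun p =>
    Function.update p.1 k p.2)
  · rintro _ ⟨p, hp, rfl⟩
    have hp' : p.1 ∈ slice K z := by
      by_contra hn
      simp [hn] at hp
    refine ⟨hb.mapsTo ⟨hp', trivial⟩, ?_⟩
    simpa [hp'] using hp
  · intro p hp
    refine ⟨?_, trivial⟩
    by_contra hn
    simp [hn] at hp

/-- Summation over a set of variables, the variable `k` first. -/
theorem sumOver_insert_inner {k : I} (hk : k ∉ K) (h : FiniteOnSlices (insert k K) F) :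
    sumOver (insert k K) F z = sumOver K (fun x => ∑ᶠ t : ℤ, F (Function.update x k t)) z := by
  rw [sumOver_insert_prod hk, finsum_curry _ (hasFiniteSupport_insert hk h), sumOver,
    finsum_mem_def]
  refine finsum_congr fun x => ?_
  by_cases hx : x ∈ slice K z <;> simp [hx]

/-- Summation over a set of variables, the variable `k` last. -/
theorem sumOver_insert_outer {k : I} (hk : k ∉ K) (h : FiniteOnSlices (insert k K) F) :
    sumOver (insert k K) F z = ∑ᶠ t : ℤ, sumOver K F (Function.update z k t) := by
  rw [sumOver_insert_prod hk, ← finsum_comp_equiv (Equiv.prodComm ℤ (I → ℤ)), finsum_curry]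
  · refine finsum_congr fun t => ?_
    have hbij : Set.BijOn (fun x : I → ℤ => Function.update x k t) (slice K z)
        (slice K (Function.update z k t)) := by
      refine ⟨fun x hx i hi => ?_, fun x hx y hy hxy => funext fun i => ?_, fun x hx => ?_⟩
      · by_cases hik : i = k
        · subst hik; simp
        · simpa [hik] using hx i hi
      · by_cases hik : i = k
        · subst hik; exact (hx i hk).trans (hy i hk).symm
        · simpa [hik] using congrFun hxy i
      · have hxk : x k = t := by simpa using hx k hk
        refine ⟨Function.update x k (z k), fun i hi => ?_, by simp [← hxk]⟩
        by_cases hik : i = k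
        · subst hik; simp
        · simpa [hik] using hx i hi
    rw [sumOver, ← finsum_mem_eq_of_bijOn _ hbij fun _ _ => rfl, finsum_mem_def]
    refine finsum_congr fun x => ?_
    by_cases hx : x ∈ slice K z <;> simp [Set.indicator, hx]
  · exact (hasFiniteSupport_insert (z := z) hk h).preimage
      ((Equiv.prodComm ℤ (I → ℤ)).injective.injOn)

end Slices

/-! ### Polynomials: affine substitution and discrete antiderivatives -/

namespace MvPolynomial

/-- Substituting polynomials of degree at most one does not raise the total degree. -/
theorem totalDegree_aeval_le {σ τ : Type*} (f : σ → MvPolynomial τ ℚ)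
    (hf : ∀ i, (f i).totalDegree ≤ 1) (p : MvPolynomial σ ℚ) :
    (aeval f p).totalDegree ≤ p.totalDegree := by
  classical
  rw [aeval_def, eval₂_eq]
  refine totalDegree_finsetSum_le fun d hd => ?_
  refine (totalDegree_mul _ _).trans ?_
  have h1 : (algebraMap ℚ (MvPolynomial τ ℚ) (coeff d p)).totalDegree = 0 := totalDegree_C _
  rw [h1, zero_add]
  refine (totalDegree_finsetProd _ _).trans ?_
  refine le_trans ?_ (le_totalDegree hd)
  refine Finset.sum_le_sum fun i _ => (totalDegree_pow _ _).trans ?_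
  simpa using Nat.mul_le_mul_left (d i) (hf i)

/-- The polynomial `p` with the variable `k` replaced by `L`. -/
noncomputable def substVar {I : Type*} [DecidableEq I] (k : I) (L p : MvPolynomial I ℚ) :
    MvPolynomial I ℚ :=
  aeval (Function.update X k L) p

theorem totalDegree_substVar_le {I : Type*} [DecidableEq I] (k : I) {L : MvPolynomial I ℚ}
    (hL : L.totalDegree ≤ 1) (p : MvPolynomial I ℚ) :
    (substVar k L p).totalDegree ≤ p.totalDegree := by
  refine totalDegree_aeval_le _ (fun i => ?_) p
  by_cases h : i = k
  · subst h; simpa using hL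
  · simp [h]

theorem eval_substVar {I : Type*} [DecidableEq I] (k : I) (L p : MvPolynomial I ℚ) (z : I → ℚ) :
    eval z (substVar k L p) = eval (Function.update z k (eval z L)) p := by
  rw [substVar, aeval_def, eval_eval₂, eval₂_eq, eval_eq]
  refine Finset.sum_congr rfl fun d _ => ?_
  congr 1
  · simp
  · refine Finset.prod_congr rfl fun i _ => ?_
    by_cases h : i = k
    · subst h; simp
    · simp [h]

/-- The affine polynomial `w + c`, for an integer linear form `w`. -/
noncomputable def affine {I : Type*} [Fintype I] (w : I → ℤ) (c : ℚ) : MvPolynomial I ℚ :=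
  ∑ i, C (w i : ℚ) * X i + C c

theorem totalDegree_affine_le {I : Type*} [Fintype I] (w : I → ℤ) (c : ℚ) :
    (affine w c).totalDegree ≤ 1 := by
  refine (totalDegree_add _ _).trans (max_le ?_ (by simp))
  refine totalDegree_finsetSum_le fun i _ => (totalDegree_mul _ _).trans ?_
  rw [totalDegree_C, totalDegree_X]

theorem eval_affine {I : Type*} [Fintype I] (w : I → ℤ) (c : ℚ) (z : I → ℚ) :
    eval z (affine w c) = ∑ i, (w i : ℚ) * z i + c := by
  simp [affine]

end MvPolynomial

theorem exists_antidifference_pow (j : ℕ) :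
    ∃ B : Polynomial ℚ, B.natDegree ≤ j + 1 ∧ ∀ t, B.eval (t + 1) - B.eval t = t ^ j := by
  refine ⟨Polynomial.C ((j + 1 : ℚ)⁻¹) * Polynomial.bernoulli (j + 1), ?_, fun t => ?_⟩
  · refine (Polynomial.natDegree_C_mul_le _ _).trans ?_
    rw [Polynomial.bernoulli]
    refine Polynomial.natDegree_sum_le_of_forall_le _ _ fun i hi => ?_
    refine (Polynomial.natDegree_monomial_le _).trans ?_
    simp at hi ⊢
  · have h := Polynomial.bernoulli_eval_one_add (j + 1) t
    rw [add_comm t 1, Polynomial.eval_mul, Polynomial.eval_mul, h]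
    have : (j + 1 : ℚ) ≠ 0 := by positivity
    simp
    field_simp
    ring

/-- Every polynomial is the difference, in the direction of the variable `k`, of a polynomial whose
degree is larger by at most one. -/
theorem MvPolynomial.exists_antidifference {I : Type*} [DecidableEq I] (k : I)
    (p : MvPolynomial I ℚ) :
    ∃ G : MvPolynomial I ℚ, G.totalDegree ≤ p.totalDegree + 1 ∧
      ∀ z : I → ℚ, eval (Function.update z k (z k + 1)) G - eval z G = eval z p := by
  choose B hB hB' using exists_antidifference_pow
  let G : (I →₀ ℕ) → MvPolynomial I ℚ := fun d =>
    monomial (d.erase k) (coeff d p) * Polynomial.aeval (X k) (B (d k))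
  refine ⟨∑ d ∈ p.support, G d, ?_, fun z => ?_⟩
  · refine totalDegree_finsetSum_le fun d hd => ?_
    refine (totalDegree_mul _ _).trans ?_
    have h1 : (monomial (d.erase k) (coeff d p)).totalDegree ≤ ∑ i ∈ d.support.erase k, d i := by
      refine (totalDegree_monomial_le _ _).trans ?_
      rw [Finsupp.sum, Finsupp.support_erase]
      exact Finset.sum_le_sum fun i hi => by simp [Finsupp.erase_ne (Finset.ne_of_mem_erase hi)]
    have h2 : (Polynomial.aeval (X k : MvPolynomial I ℚ) (B (d k))).totalDegree ≤ d k + 1 := by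
      rw [Polynomial.aeval_eq_sum_range]
      refine totalDegree_finsetSum_le fun i hi => ?_
      refine (totalDegree_smul_le _ _).trans ((totalDegree_pow _ _).trans ?_)
      have := hB (d k)
      simp at hi ⊢
      omega
    have h3 : ∑ i ∈ d.support.erase k, d i + d k ≤ p.totalDegree := by
      refine le_trans (le_of_eq ?_) (le_totalDegree hd)
      by_cases hk : k ∈ d.support
      · rw [Finsupp.sum, Finset.sum_erase_add _ _ hk]
      · rw [Finsupp.sum, Finset.erase_eq_of_notMem hk, Finsupp.notMem_support_iff.1 hk, add_zero]
    omega
  · rw [map_sum, map_sum, ← Finset.sum_sub_distrib, eval_eq]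
    refine Finset.sum_congr rfl fun d _ => ?_
    have hm : ∀ y : I → ℚ, eval y (monomial (d.erase k) (coeff d p)) =
        coeff d p * ∏ i ∈ d.support.erase k, y i ^ d i := by
      intro y
      rw [eval_monomial, Finsupp.prod, Finsupp.support_erase]
      congr 1
      exact Finset.prod_congr rfl fun i hi => by rw [Finsupp.erase_ne (Finset.ne_of_mem_erase hi)]
    have ha : ∀ y : I → ℚ, eval y (Polynomial.aeval (X k : MvPolynomial I ℚ) (B (d k))) =
        (B (d k)).eval (y k) := by
      intro y
      rw [Polynomial.aeval_eq_sum_range, Polynomial.eval_eq_sum_range]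
      simp [smul_eval]
    have hprod : ∏ i ∈ d.support.erase k, (Function.update z k (z k + 1)) i ^ d i
        = ∏ i ∈ d.support.erase k, z i ^ d i :=
      Finset.prod_congr rfl fun i hi => by simp [Finset.ne_of_mem_erase hi]
    simp only [G, map_mul, hm, ha, hprod, Function.update_self]
    rw [← mul_sub, hB', mul_assoc]
    congr 1
    by_cases hk : k ∈ d.support
    · rw [Finset.prod_erase_mul _ _ hk]
    · rw [Finset.erase_eq_of_notMem hk, Finsupp.notMem_support_iff.1 hk, pow_zero, mul_one]

/-! ### Summing a polynomial over an interval with several lower and upper bounds -/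

theorem sum_Ico_int_sub (G : ℤ → ℚ) {a b : ℤ} (h : a ≤ b) :
    ∑ t ∈ Finset.Ico a b, (G (t + 1) - G t) = G b - G a := by
  induction b, h using Int.leInduction with
  | base => simp
  | succ n hn ih =>
    rw [← Finset.insert_Ico_right_eq_Ico_add_one hn, Finset.sum_insert (by simp), ih]
    ring

/-- The sum of a difference over the integers in an open interval given by several lower and
several upper bounds without ties, as a sum over the bounds: a bound contributes when it is the
active one and the interval is not empty. -/
theorem finsum_interval {ι : Type*} [DecidableEq ι] (Lo Up : Finset ι) (lam mu : ι → ℚ)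
    (hLo : Lo.Nonempty) (hUp : Up.Nonempty) (hl : Set.InjOn lam Lo) (hm : Set.InjOn mu Up)
    (G : ℤ → ℚ) :
    (∑ᶠ t : ℤ, if (∀ i ∈ Lo, lam i < t) ∧ ∀ j ∈ Up, (t : ℚ) < mu j then G (t + 1) - G t else 0) =
      (∑ j ∈ Up, if (∀ i ∈ Up.erase j, mu j < mu i) ∧ ∀ i ∈ Lo, lam i < mu j
        then G ⌈mu j⌉ else 0) -
      ∑ i ∈ Lo, if (∀ j ∈ Lo.erase i, lam j < lam i) ∧ ∀ j ∈ Up, lam i < mu j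
        then G (⌊lam i⌋ + 1) else 0 := by
  obtain ⟨i₀, hi₀, hmax⟩ := Lo.exists_max_image lam hLo
  obtain ⟨j₀, hj₀, hmin⟩ := Up.exists_min_image mu hUp
  have hmax' : ∀ i ∈ Lo.erase i₀, lam i < lam i₀ := fun i hi =>
    lt_of_le_of_ne (hmax i (Finset.mem_of_mem_erase hi)) fun h =>
      Finset.ne_of_mem_erase hi (hl (Finset.mem_of_mem_erase hi) hi₀ h)
  have hmin' : ∀ j ∈ Up.erase j₀, mu j₀ < mu j := fun j hj =>
    lt_of_le_of_ne (hmin j (Finset.mem_of_mem_erase hj)) fun h =>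
      Finset.ne_of_mem_erase hj (hm (Finset.mem_of_mem_erase hj) hj₀ h.symm)
  have hcond : ∀ t : ℤ, ((∀ i ∈ Lo, lam i < t) ∧ ∀ j ∈ Up, (t : ℚ) < mu j) ↔
      t ∈ Finset.Ico (⌊lam i₀⌋ + 1) ⌈mu j₀⌉ := by
    intro t
    rw [Finset.mem_Ico, Int.add_one_le_iff, Int.floor_lt, Int.lt_ceil]
    exact ⟨fun h => ⟨h.1 _ hi₀, h.2 _ hj₀⟩, fun h =>
      ⟨fun i hi => (hmax i hi).trans_lt h.1, fun j hj => h.2.trans_le (hmin j hj)⟩⟩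
  have hL : (∑ᶠ t : ℤ, if (∀ i ∈ Lo, lam i < t) ∧ ∀ j ∈ Up, (t : ℚ) < mu j
      then G (t + 1) - G t else 0) =
      ∑ t ∈ Finset.Ico (⌊lam i₀⌋ + 1) ⌈mu j₀⌉, (G (t + 1) - G t) := by
    rw [finsum_eq_sum_of_support_subset (s := Finset.Ico (⌊lam i₀⌋ + 1) ⌈mu j₀⌉)]
    · exact Finset.sum_congr rfl fun t ht => if_pos ((hcond t).2 ht)
    · intro t ht
      by_contra hn
      exact ht (if_neg fun h => hn ((hcond t).1 h))
  rw [hL]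
  have hU : ∀ j ∈ Up, j ≠ j₀ → (if (∀ i ∈ Up.erase j, mu j < mu i) ∧ ∀ i ∈ Lo, lam i < mu j
        then G ⌈mu j⌉ else 0) = 0 := fun j hj hne => if_neg fun h =>
    absurd (h.1 j₀ (Finset.mem_erase.2 ⟨hne.symm, hj₀⟩)) (not_lt.2 (hmin j hj))
  have hD : ∀ i ∈ Lo, i ≠ i₀ → (if (∀ j ∈ Lo.erase i, lam j < lam i) ∧ ∀ j ∈ Up, lam i < mu j
        then G (⌊lam i⌋ + 1) else 0) = 0 := fun i hi hne => if_neg fun h =>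
    absurd (h.1 i₀ (Finset.mem_erase.2 ⟨hne.symm, hi₀⟩)) (not_lt.2 (hmax i hi))
  rw [Finset.sum_eq_single_of_mem j₀ hj₀ hU, Finset.sum_eq_single_of_mem i₀ hi₀ hD]
  by_cases h : lam i₀ < mu j₀
  · rw [if_pos ⟨hmin', fun i hi => (hmax i hi).trans_lt h⟩,
      if_pos ⟨hmax', fun j hj => h.trans_le (hmin j hj)⟩, sum_Ico_int_sub]
    rw [Int.add_one_le_iff, Int.floor_lt]
    exact h.trans_le (Int.le_ceil _)
  · rw [if_neg fun h' => h (h'.2 i₀ hi₀), if_neg fun h' => h (h'.2 j₀ hj₀), sub_zero,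
      Finset.Ico_eq_empty, Finset.sum_empty]
    rw [Int.lt_ceil]
    push Not at h ⊢
    refine h.trans ?_
    push_cast
    exact (Int.lt_floor_add_one _).le

/-! ### Polynomial sums over perturbed unimodular regions -/

section Forms

variable {I : Type*} [Fintype I]

/-- The value of an integer linear form at a rational point. -/
def ratEval (w : I → ℤ) (ζ : I → ℚ) : ℚ := ∑ i, (w i : ℚ) * ζ i

theorem ratEval_intCast (w z : I → ℤ) : ratEval w (fun i => (z i : ℚ)) = ((w ⬝ᵥ z : ℤ) : ℚ) := by
  simp [ratEval, dotProduct]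

theorem ratEval_pivotForm (w₀ : I → ℤ) (k : I) (w : I → ℤ) (ζ : I → ℚ) :
    ratEval (pivotForm w₀ k w) ζ = ratEval w ζ - w k * w₀ k * ratEval w₀ ζ := by
  simp only [ratEval, pivotForm, Finset.mul_sum, ← Finset.sum_sub_distrib]
  refine Finset.sum_congr rfl fun i _ => ?_
  push_cast
  ring

theorem pivotForm_dotProduct (w₀ : I → ℤ) (k : I) (w z : I → ℤ) :
    pivotForm w₀ k w ⬝ᵥ z = w ⬝ᵥ z - w k * w₀ k * (w₀ ⬝ᵥ z) := by
  simp only [dotProduct, pivotForm, Finset.mul_sum, ← Finset.sum_sub_distrib]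
  exact Finset.sum_congr rfl fun i _ => by ring

theorem dotProduct_update [DecidableEq I] (w z : I → ℤ) (k : I) (t : ℤ) :
    w ⬝ᵥ Function.update z k t = w ⬝ᵥ z + w k * (t - z k) := by
  have : Function.update z k t = z + Pi.single k (t - z k) := by
    ext i
    by_cases h : i = k
    · subst h; simp
    · simp [h]
  rw [this, dotProduct_add, dotProduct_single]

/-- On each slice in the variables `K`, bounds from below on the forms in `R` bound all variables
in `K`. -/
def Confines (R : Finset (I → ℤ)) (K : Finset I) : Prop :=
  ∀ (z : I → ℤ) (C : ℤ), ∃ B : ℤ, ∀ x ∈ slice K z, (∀ w ∈ R, -C ≤ w ⬝ᵥ x) → ∀ k ∈ K, |x k| ≤ B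

/-- The polynomial `p` on the integer points of the region where all the forms `w ∈ R`, shifted by
their values at the point `ζ`, are positive. -/
noncomputable def perturbed (R : Finset (I → ℤ)) (ζ : I → ℚ) (p : MvPolynomial I ℚ)
    (x : I → ℤ) : ℚ :=
  open Classical in
  if ∀ w ∈ R, 0 < ((w ⬝ᵥ x : ℤ) : ℚ) + ratEval w ζ then MvPolynomial.eval (fun i => (x i : ℚ)) p
  else 0

theorem finite_slice_box (K : Finset I) (z : I → ℤ) (B : ℤ) :
    {x ∈ slice K z | ∀ k ∈ K, |x k| ≤ B}.Finite := by
  classical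
  refine (Set.Finite.pi' (t := fun i => if i ∈ K then Set.Icc (-B) B else {z i})
    fun i => ?_).subset ?_
  · split_ifs
    · exact Set.finite_Icc _ _
    · exact Set.finite_singleton _
  · rintro x ⟨hx, hB⟩ i
    by_cases hi : i ∈ K
    · simpa [hi] using abs_le.1 (hB i hi)
    · simpa [hi] using hx i hi

theorem finiteOnSlices_of_confines {R : Finset (I → ℤ)} {K : Finset I} (h : Confines R K)
    {F : (I → ℤ) → ℚ} (C : ℤ) (hF : ∀ x, F x ≠ 0 → ∀ w ∈ R, -C ≤ w ⬝ᵥ x) :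
    FiniteOnSlices K F := by
  intro z
  obtain ⟨B, hB⟩ := h z C
  exact (finite_slice_box K z B).subset fun x hx => ⟨hx.1, hB x hx.1 (hF x hx.2)⟩

theorem finiteOnSlices_perturbed {R : Finset (I → ℤ)} {K : Finset I} (h : Confines R K)
    (ζ : I → ℚ) (p : MvPolynomial I ℚ) : FiniteOnSlices K (perturbed R ζ p) := by
  refine finiteOnSlices_of_confines h (∑ w ∈ R, ⌈|ratEval w ζ|⌉) fun x hx w hw => ?_
  have hpos : ∀ w ∈ R, 0 < ((w ⬝ᵥ x : ℤ) : ℚ) + ratEval w ζ := by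
    by_contra hn
    exact hx (if_neg hn)
  have h1 : ⌈|ratEval w ζ|⌉ ≤ ∑ w ∈ R, ⌈|ratEval w ζ|⌉ :=
    Finset.single_le_sum (f := fun w => ⌈|ratEval w ζ|⌉)
      (fun v _ => Int.ceil_nonneg (abs_nonneg _)) hw
  have h2 : (ratEval w ζ) ≤ ⌈|ratEval w ζ|⌉ := (le_abs_self _).trans (Int.le_ceil _)
  have h3 : (-⌈|ratEval w ζ|⌉ : ℚ) ≤ ((w ⬝ᵥ x : ℤ) : ℚ) := by
    linarith [hpos w hw]
  have h4 : -⌈|ratEval w ζ|⌉ ≤ w ⬝ᵥ x := by exact_mod_cast h3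
  omega

variable [DecidableEq I]

theorem Confines.exists_coeff_eq_one {R : Finset (I → ℤ)} {K : Finset I} (h : Confines R K)
    (hU : Unimodular (R : Set (I → ℤ)) K) {k : I} (hk : k ∈ K) (s : ℤ) (hs : s = 1 ∨ s = -1) :
    ∃ w ∈ R, w k = s := by
  by_contra hn
  push Not at hn
  have hss : s * s = 1 := by rcases hs with rfl | rfl <;> rfl
  obtain ⟨B, hB⟩ := h 0 0
  have hx : Function.update (0 : I → ℤ) k (-s * (|B| + 1)) ∈ slice K 0 := by
    intro i hi
    have : i ≠ k := fun h => hi (h ▸ hk)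
    simp [this]
  have := hB _ hx (fun w hw => ?_) k hk
  · have h0 : |s| = 1 := by rcases hs with rfl | rfl <;> rfl
    rw [Function.update_self, abs_mul, abs_neg, h0, one_mul, abs_of_nonneg (by positivity)] at this
    have := le_abs_self B
    omega
  · rw [dotProduct_update]
    have h1 := abs_le.1 (hU.abs_coeff_le (Finset.mem_coe.2 hw) (Finset.mem_coe.2 hk))
    have h2 := hn w hw
    have h3 : 0 ≤ |B| + 1 := by positivity
    have h4 : w k * (-s) ≥ 0 := by
      rcases hs with rfl | rfl
      · omega
      · omega
    simp only [dotProduct_zero, Pi.zero_apply, sub_zero, zero_add, neg_zero]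
    rw [← mul_assoc]
    exact mul_nonneg h4 h3

theorem Confines.pivot {R : Finset (I → ℤ)} {K : Finset I} {k : I}
    (h : Confines R (insert k K)) {w₀ : I → ℤ} (hsq : w₀ k * w₀ k = 1) (hk : k ∉ K) :
    Confines ((R.erase w₀).image (pivotForm w₀ k)) K := by
  intro z C
  obtain ⟨B, hB⟩ := h z (max C 0)
  refine ⟨B, fun x hx hw i hi => ?_⟩
  have hik : i ≠ k := fun h => hk (h ▸ hi)
  have hdot : ∀ w, w ⬝ᵥ Function.update x k (x k - w₀ k * (w₀ ⬝ᵥ x)) = pivotForm w₀ k w ⬝ᵥ x := by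
    intro w
    rw [dotProduct_update, pivotForm_dotProduct]
    ring
  have := hB (Function.update x k (x k - w₀ k * (w₀ ⬝ᵥ x))) (fun j hj => ?_) (fun w hwR => ?_) i
    (Finset.mem_insert_of_mem hi)
  · simpa [hik] using this
  · simp only [Finset.mem_insert, not_or] at hj
    simpa [hj.1] using hx j hj.2
  · rw [hdot]
    by_cases hww : w = w₀
    · subst hww
      rw [pivotForm_dotProduct, hsq]
      have := le_max_right C 0
      linarith
    · have := hw _ (Finset.mem_image_of_mem _ (Finset.mem_erase.2 ⟨hww, hwR⟩))
      have := le_max_left C 0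
      linarith

end Forms

section UnimodularSums

variable {I : Type*} [Fintype I] [DecidableEq I]

/-- The rows of the system obtained from `R` by solving `w₀ = 0` for the variable `k`. -/
def pivotRows (R : Finset (I → ℤ)) (k : I) (w₀ : I → ℤ) : Finset (I → ℤ) :=
  (R.erase w₀).image (pivotForm w₀ k)

/-- The integer at which the summation over the variable `k` starts or ends when the bound given by
the form `w₀` is active, as an affine function of the other variables. -/
noncomputable def boundPoly (ζ : I → ℚ) (k : I) (w₀ : I → ℤ) : MvPolynomial I ℚ :=
  MvPolynomial.affine (fun i => if i = k then 0 else -w₀ k * w₀ i)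
    (if w₀ k = 1 then (⌊-ratEval w₀ ζ⌋ + 1 : ℤ) else (⌈ratEval w₀ ζ⌉ : ℤ))

/-- The contribution of the bound `w₀` to the sum over the variable `k` of a polynomial with
antidifference `G`: lower bounds count negatively, upper bounds positively. -/
noncomputable def boundTerm (ζ : I → ℚ) (k : I) (G : MvPolynomial I ℚ) (w₀ : I → ℤ) :
    MvPolynomial I ℚ :=
  MvPolynomial.C (-w₀ k : ℚ) * MvPolynomial.substVar k (boundPoly ζ k w₀) G

theorem totalDegree_boundTerm_le (ζ : I → ℚ) (k : I) (G : MvPolynomial I ℚ) (w₀ : I → ℤ) :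
    (boundTerm ζ k G w₀).totalDegree ≤ G.totalDegree := by
  refine (MvPolynomial.totalDegree_mul _ _).trans ?_
  rw [MvPolynomial.totalDegree_C, zero_add]
  exact MvPolynomial.totalDegree_substVar_le _ (MvPolynomial.totalDegree_affine_le _ _) _

/-- Summation over one variable of a polynomial on a perturbed region: the perturbation excludes
ties between the bounds, so each bound is active on a region of the same kind. -/
theorem finsum_perturbed {R : Finset (I → ℤ)} {k : I} {ζ : I → ℚ} {p G : MvPolynomial I ℚ}
    (hcoef : ∀ w ∈ R, w k ≠ 0 → w k = 1 ∨ w k = -1)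
    (hLo : ∃ w ∈ R, w k = 1) (hUp : ∃ w ∈ R, w k = -1)
    (hζ : ∀ w₀ ∈ R, w₀ k ≠ 0 → ∀ v ∈ pivotRows R k w₀, v ≠ 0 →
      ratEval v ζ ≠ 0 ∧ |ratEval v ζ| < 1)
    (hG : ∀ z : I → ℚ, MvPolynomial.eval (Function.update z k (z k + 1)) G
      - MvPolynomial.eval z G = MvPolynomial.eval z p) (x : I → ℤ) :
    ∑ᶠ t : ℤ, perturbed R ζ p (Function.update x k t) =
      ∑ w₀ ∈ R with w₀ k ≠ 0, perturbed (pivotRows R k w₀) ζ (boundTerm ζ k G w₀) x := by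
  classical
  let rest : (I → ℤ) → ℤ := fun w => w ⬝ᵥ x - w k * x k
  let rho : (I → ℤ) → ℚ := fun w => rest w + ratEval w ζ
  have hrow : ∀ w (t : ℤ), ((w ⬝ᵥ Function.update x k t : ℤ) : ℚ) + ratEval w ζ
      = rho w + w k * t := by
    intro w t
    simp only [rho, rest, dotProduct_update]
    push_cast
    ring
  have hpiv : ∀ w₀ w, w₀ k * w₀ k = 1 → ((pivotForm w₀ k w ⬝ᵥ x : ℤ) : ℚ)
      + ratEval (pivotForm w₀ k w) ζ = rho w - w k * w₀ k * rho w₀ := by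
    intro w₀ w h
    have h' : (w₀ k : ℚ) * w₀ k = 1 := by exact_mod_cast h
    simp only [rho, rest, pivotForm_dotProduct, ratEval_pivotForm]
    push_cast
    linear_combination (-(w k : ℚ) * x k) * h'
  by_cases hZ : ∀ w ∈ R, w k = 0 → 0 < rho w
  swap
  · -- a violated condition not involving the variable `k` makes both sides vanish
    push Not at hZ
    obtain ⟨w, hw, hwk, hneg⟩ := hZ
    have h1 : ∀ t : ℤ, perturbed R ζ p (Function.update x k t) = 0 := by
      intro t
      refine if_neg fun h => ?_
      have := h w hw
      rw [hrow, hwk] at this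
      simp only [Int.cast_zero, zero_mul, add_zero] at this
      linarith
    have h2 : ∀ w₀ ∈ R.filter (fun w₀ => w₀ k ≠ 0),
        perturbed (pivotRows R k w₀) ζ (boundTerm ζ k G w₀) x = 0 := by
      intro w₀ hw₀
      rw [Finset.mem_filter] at hw₀
      have hsq : w₀ k * w₀ k = 1 := by
        rcases hcoef _ hw₀.1 hw₀.2 with h | h <;> rw [h] <;> rfl
      refine if_neg fun h => ?_
      have := h (pivotForm w₀ k w) (Finset.mem_image_of_mem _ (Finset.mem_erase.2
        ⟨fun e => hw₀.2 (e ▸ hwk), hw⟩))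
      rw [hpiv _ _ hsq, hwk] at this
      simp only [Int.cast_zero, zero_mul, sub_zero] at this
      linarith
    rw [Finset.sum_eq_zero h2]
    simp [h1]
  let Lo := R.filter fun w => w k = 1
  let Up := R.filter fun w => w k = -1
  let g : ℤ → ℚ := fun t => MvPolynomial.eval (Function.update (fun i => (x i : ℚ)) k (t : ℚ)) G
  have hcast : ∀ t : ℤ, (fun i => ((Function.update x k t i : ℤ) : ℚ))
      = Function.update (fun i => (x i : ℚ)) k (t : ℚ) := by
    intro t
    ext i
    by_cases h : i = k
    · subst h; simp
    · simp [h]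
  have hL : ∀ t : ℤ, perturbed R ζ p (Function.update x k t) =
      if (∀ i ∈ Lo, -rho i < t) ∧ ∀ j ∈ Up, (t : ℚ) < rho j then g (t + 1) - g t else 0 := by
    intro t
    have hiff : (∀ w ∈ R, 0 < ((w ⬝ᵥ Function.update x k t : ℤ) : ℚ) + ratEval w ζ) ↔
        (∀ i ∈ Lo, -rho i < t) ∧ ∀ j ∈ Up, (t : ℚ) < rho j := by
      simp only [hrow, Lo, Up, Finset.mem_filter]
      constructor
      · intro h
        refine ⟨fun i hi => ?_, fun j hj => ?_⟩
        · have := h i hi.1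
          rw [hi.2] at this
          push_cast at this
          linarith
        · have := h j hj.1
          rw [hj.2] at this
          push_cast at this
          linarith
      · rintro ⟨h1, h2⟩ w hw
        by_cases h0 : w k = 0
        · rw [h0]
          simpa using hZ w hw h0
        · rcases hcoef w hw h0 with h | h
          · have := h1 w ⟨hw, h⟩
            rw [h]
            push_cast
            linarith
          · have := h2 w ⟨hw, h⟩
            rw [h]
            push_cast
            linarith
    have hval : MvPolynomial.eval (fun i => ((Function.update x k t i : ℤ) : ℚ)) p
        = g (t + 1) - g t := by
      rw [hcast, ← hG]
      simp [g]
    by_cases h : ∀ w ∈ R, 0 < ((w ⬝ᵥ Function.update x k t : ℤ) : ℚ) + ratEval w ζ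
    · rw [perturbed, if_pos h, if_pos (hiff.1 h), hval]
    · rw [perturbed, if_neg h, if_neg fun h' => h (hiff.2 h')]
  have hinj : ∀ s : ℤ, s = 1 ∨ s = -1 → ∀ w ∈ R, w k = s → ∀ w' ∈ R, w' k = s →
      rho w = rho w' → w = w' := by
    intro s hs w hw hwk w' hw' hwk' he
    by_contra hne
    have hss : s * s = 1 := by rcases hs with rfl | rfl <;> rfl
    have hs0 : s ≠ 0 := by rcases hs with rfl | rfl <;> decide
    have hv : pivotForm w k w' ≠ 0 := by
      intro h
      apply hne
      ext i
      have := congrFun h i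
      simp only [pivotForm, hwk, hwk', hss, Pi.zero_apply] at this
      omega
    obtain ⟨h1, h2⟩ := hζ w hw (hwk ▸ hs0) (pivotForm w k w') (Finset.mem_image_of_mem _
      (Finset.mem_erase.2 ⟨Ne.symm hne, hw'⟩)) hv
    have h3 := hpiv w w' (by rw [hwk, hss])
    have hss' : (s : ℚ) * s = 1 := by exact_mod_cast hss
    rw [hwk, hwk', hss', he, one_mul, sub_self] at h3
    have h4 : ratEval (pivotForm w k w') ζ = ((-(pivotForm w k w' ⬝ᵥ x) : ℤ) : ℚ) := by
      push_cast
      linarith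
    rw [h4] at h1 h2
    have h5 : |(-(pivotForm w k w' ⬝ᵥ x) : ℤ)| < 1 := by exact_mod_cast h2
    rw [Int.abs_lt_one_iff] at h5
    exact h1 (by rw [h5]; rfl)
  have key := finsum_interval Lo Up (fun w => -rho w) rho
    (by obtain ⟨w, hw, h⟩ := hLo; exact ⟨w, Finset.mem_filter.2 ⟨hw, h⟩⟩)
    (by obtain ⟨w, hw, h⟩ := hUp; exact ⟨w, Finset.mem_filter.2 ⟨hw, h⟩⟩)
    (fun w hw w' hw' he => by
      have h1 := Finset.mem_filter.1 (Finset.mem_coe.1 hw)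
      have h2 := Finset.mem_filter.1 (Finset.mem_coe.1 hw')
      exact hinj 1 (Or.inl rfl) w h1.1 h1.2 w' h2.1 h2.2 (neg_injective he))
    (fun w hw w' hw' he => by
      have h1 := Finset.mem_filter.1 (Finset.mem_coe.1 hw)
      have h2 := Finset.mem_filter.1 (Finset.mem_coe.1 hw')
      exact hinj (-1) (Or.inr rfl) w h1.1 h1.2 w' h2.1 h2.2 he) g
  rw [finsum_congr hL, key]
  have hsplit : R.filter (fun w₀ => w₀ k ≠ 0) = Up ∪ Lo := by
    ext w
    simp only [Up, Lo, Finset.mem_filter, Finset.mem_union]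
    constructor
    · rintro ⟨h1, h2⟩
      rcases hcoef w h1 h2 with h | h
      · exact Or.inr ⟨h1, h⟩
      · exact Or.inl ⟨h1, h⟩
    · rintro (⟨h1, h2⟩ | ⟨h1, h2⟩)
      · exact ⟨h1, by omega⟩
      · exact ⟨h1, by omega⟩
  have hdisj : Disjoint Up Lo := by
    rw [Finset.disjoint_left]
    intro w h1 h2
    have := (Finset.mem_filter.1 h1).2
    have := (Finset.mem_filter.1 h2).2
    omega
  have hbp : ∀ w₀ : I → ℤ, MvPolynomial.eval (fun i => (x i : ℚ)) (boundPoly ζ k w₀)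
      = ((-w₀ k * rest w₀ + if w₀ k = 1 then ⌊-ratEval w₀ ζ⌋ + 1 else ⌈ratEval w₀ ζ⌉ : ℤ) : ℚ) := by
    intro w₀
    have : (-w₀ k * rest w₀) = ∑ i, (if i = k then 0 else -w₀ k * w₀ i) * x i := by
      simp only [rest, dotProduct]
      rw [← Finset.add_sum_erase _ _ (Finset.mem_univ k), add_sub_cancel_left,
        ← Finset.add_sum_erase _ _ (Finset.mem_univ k), Finset.mul_sum]
      simp only [if_true, zero_mul, zero_add]
      refine Finset.sum_congr rfl fun i hi => ?_
      rw [if_neg (Finset.ne_of_mem_erase hi)]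
      ring
    rw [boundPoly, MvPolynomial.eval_affine, this]
    push_cast
    split_ifs <;> rfl
  have hrowcond : ∀ w₀ ∈ R, ∀ s : ℤ, s = 1 ∨ s = -1 → w₀ k = s →
      ((∀ v ∈ pivotRows R k w₀, 0 < ((v ⬝ᵥ x : ℤ) : ℚ) + ratEval v ζ) ↔
        ∀ w ∈ R.erase w₀, 0 < rho w - w k * s * rho w₀) := by
    intro w₀ hw₀ s hs hsk
    have hss : w₀ k * w₀ k = 1 := by rw [hsk]; rcases hs with rfl | rfl <;> rfl
    simp only [pivotRows, Finset.mem_image, forall_exists_index, and_imp,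
      forall_apply_eq_imp_iff₂, hpiv _ _ hss]
    rw [hsk]
  rw [hsplit, Finset.sum_union hdisj, sub_eq_add_neg, ← Finset.sum_neg_distrib]
  congr 1
  · refine Finset.sum_congr rfl fun w₀ hw₀ => ?_
    obtain ⟨hw₀R, hw₀k⟩ := Finset.mem_filter.1 hw₀
    have hiff : ((∀ i ∈ Up.erase w₀, rho w₀ < rho i) ∧ ∀ i ∈ Lo, -rho i < rho w₀) ↔
        ∀ v ∈ pivotRows R k w₀, 0 < ((v ⬝ᵥ x : ℤ) : ℚ) + ratEval v ζ := by
      rw [hrowcond w₀ hw₀R (-1) (Or.inr rfl) hw₀k]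
      constructor
      · rintro ⟨h1, h2⟩ w hw
        obtain ⟨hne, hwR⟩ := Finset.mem_erase.1 hw
        by_cases h0 : w k = 0
        · rw [h0]; simpa using hZ w hwR h0
        · rcases hcoef w hwR h0 with h | h
          · have := h2 w (Finset.mem_filter.2 ⟨hwR, h⟩)
            rw [h]; push_cast; linarith
          · have := h1 w (Finset.mem_erase.2 ⟨hne, Finset.mem_filter.2 ⟨hwR, h⟩⟩)
            rw [h]; push_cast; linarith
      · intro h
        refine ⟨fun i hi => ?_, fun i hi => ?_⟩
        · obtain ⟨hne, hi⟩ := Finset.mem_erase.1 hi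
          obtain ⟨hi, hik⟩ := Finset.mem_filter.1 hi
          have := h i (Finset.mem_erase.2 ⟨hne, hi⟩)
          rw [hik] at this; push_cast at this; linarith
        · obtain ⟨hi, hik⟩ := Finset.mem_filter.1 hi
          have := h i (Finset.mem_erase.2 ⟨fun e => by rw [e] at hik; omega, hi⟩)
          rw [hik] at this; push_cast at this; linarith
    have hval : MvPolynomial.eval (fun i => (x i : ℚ)) (boundTerm ζ k G w₀) = g ⌈rho w₀⌉ := by
      have hc : ⌈rho w₀⌉ = rest w₀ + ⌈ratEval w₀ ζ⌉ := by
        simp only [rho]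
        rw [Int.ceil_intCast_add]
      have h01 : ¬ w₀ k = 1 := by omega
      rw [boundTerm, MvPolynomial.eval_mul, MvPolynomial.eval_C, MvPolynomial.eval_substVar, hbp,
        hc, if_neg h01, hw₀k]
      simp only [g]
      push_cast
      simp
    by_cases h : ∀ v ∈ pivotRows R k w₀, 0 < ((v ⬝ᵥ x : ℤ) : ℚ) + ratEval v ζ
    · rw [if_pos (hiff.2 h), perturbed, if_pos h, hval]
    · rw [if_neg fun h' => h (hiff.1 h'), perturbed, if_neg h]
  · refine Finset.sum_congr rfl fun w₀ hw₀ => ?_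
    obtain ⟨hw₀R, hw₀k⟩ := Finset.mem_filter.1 hw₀
    have hiff : ((∀ i ∈ Lo.erase w₀, -rho i < -rho w₀) ∧ ∀ j ∈ Up, -rho w₀ < rho j) ↔
        ∀ v ∈ pivotRows R k w₀, 0 < ((v ⬝ᵥ x : ℤ) : ℚ) + ratEval v ζ := by
      rw [hrowcond w₀ hw₀R 1 (Or.inl rfl) hw₀k]
      constructor
      · rintro ⟨h1, h2⟩ w hw
        obtain ⟨hne, hwR⟩ := Finset.mem_erase.1 hw
        by_cases h0 : w k = 0
        · rw [h0]; simpa using hZ w hwR h0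
        · rcases hcoef w hwR h0 with h | h
          · have := h1 w (Finset.mem_erase.2 ⟨hne, Finset.mem_filter.2 ⟨hwR, h⟩⟩)
            rw [h]; push_cast; linarith
          · have := h2 w (Finset.mem_filter.2 ⟨hwR, h⟩)
            rw [h]; push_cast; linarith
      · intro h
        refine ⟨fun i hi => ?_, fun i hi => ?_⟩
        · obtain ⟨hne, hi⟩ := Finset.mem_erase.1 hi
          obtain ⟨hi, hik⟩ := Finset.mem_filter.1 hi
          have := h i (Finset.mem_erase.2 ⟨hne, hi⟩)
          rw [hik] at this; push_cast at this; linarith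
        · obtain ⟨hi, hik⟩ := Finset.mem_filter.1 hi
          have := h i (Finset.mem_erase.2 ⟨fun e => by rw [e] at hik; omega, hi⟩)
          rw [hik] at this; push_cast at this; linarith
    have hval : MvPolynomial.eval (fun i => (x i : ℚ)) (boundTerm ζ k G w₀)
        = -g (⌊-rho w₀⌋ + 1) := by
      have hc : ⌊-rho w₀⌋ = -rest w₀ + ⌊-ratEval w₀ ζ⌋ := by
        have : -rho w₀ = ((-rest w₀ : ℤ) : ℚ) + -ratEval w₀ ζ := by
          simp only [rho]; push_cast; ring
        rw [this, Int.floor_intCast_add]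
      rw [boundTerm, MvPolynomial.eval_mul, MvPolynomial.eval_C, MvPolynomial.eval_substVar, hbp,
        hc, if_pos hw₀k, hw₀k]
      simp only [g]
      push_cast
      simp [add_assoc]
    by_cases h : ∀ v ∈ pivotRows R k w₀, 0 < ((v ⬝ᵥ x : ℤ) : ℚ) + ratEval v ζ
    · rw [if_pos (hiff.2 h), perturbed, if_pos h, hval]
    · rw [if_neg fun h' => h (hiff.1 h'), perturbed, if_neg h, neg_zero]

/-- The sum of a polynomial over the integer points of a bounded unimodular region, perturbed by a
small generic `ζ`, is given by one polynomial at all integer points whose position relative to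
finitely many walls is weakly that of `ζ`. -/
theorem exists_polynomial_sumOver_perturbed (K : Finset I) :
    ∀ R : Finset (I → ℤ), Unimodular (R : Set (I → ℤ)) K → Confines R K →
      ∃ 𝓑 : Finset (I → ℤ), ∀ ζ : I → ℚ,
        (∀ w ∈ 𝓑, w ≠ 0 → ratEval w ζ ≠ 0 ∧ |ratEval w ζ| < 1) →
        ∀ p : MvPolynomial I ℚ, ∃ Q : MvPolynomial I ℚ, Q.totalDegree ≤ p.totalDegree + K.card ∧
          ∀ z : I → ℤ, (∀ w ∈ 𝓑, 0 ≤ ((w ⬝ᵥ z : ℤ) : ℚ) * ratEval w ζ) →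
            sumOver K (perturbed R ζ p) z = MvPolynomial.eval (fun i => (z i : ℚ)) Q := by
  classical
  induction K using Finset.induction_on with
  | empty =>
    intro R _ _
    refine ⟨R, fun ζ hζ p => ?_⟩
    by_cases h : ∀ w ∈ R, 0 < ratEval w ζ
    · refine ⟨p, by simp, fun z hz => ?_⟩
      rw [sumOver_empty, perturbed, if_pos]
      intro w hw
      have h1 := h w hw
      have h2 := hz w hw
      have : 0 ≤ ((w ⬝ᵥ z : ℤ) : ℚ) := nonneg_of_mul_nonneg_left h2 h1
      linarith
    · push Not at h
      obtain ⟨w, hw, hneg⟩ := h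
      refine ⟨0, by simp, fun z hz => ?_⟩
      rw [sumOver_empty, perturbed, if_neg, map_zero]
      intro hall
      have h1 := hall w hw
      by_cases hw0 : w = 0
      · subst hw0
        simp [ratEval] at h1
      · have h2 : ratEval w ζ < 0 := lt_of_le_of_ne hneg (hζ w hw hw0).1
        have h3 := hz w hw
        have : ((w ⬝ᵥ z : ℤ) : ℚ) ≤ 0 := by
          by_contra hc
          push Not at hc
          linarith [mul_neg_of_pos_of_neg hc h2]
        linarith
  | insert k K hk ih =>
    intro R hU hC
    have hkK : k ∈ ((insert k K : Finset I) : Set I) := by simp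
    have hsq : ∀ w₀ ∈ R, w₀ k ≠ 0 → w₀ k * w₀ k = 1 := fun w₀ hw₀ h0 =>
      hU.coeff_mul_self (Finset.mem_coe.2 hw₀) hkK h0
    have hUR : ∀ w₀ ∈ R, w₀ k ≠ 0 → Unimodular (pivotRows R k w₀ : Set (I → ℤ)) K := by
      intro w₀ hw₀ h0
      refine (hU.pivot (Finset.mem_coe.2 hw₀) hkK h0).mono ?_ (by simp)
      rw [pivotRows, Finset.coe_image]
      exact Set.image_mono (by simp)
    have hCR : ∀ w₀ ∈ R, w₀ k ≠ 0 → Confines (pivotRows R k w₀) K := fun w₀ hw₀ h0 =>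
      hC.pivot (hsq w₀ hw₀ h0) hk
    have hB : ∀ w₀ : I → ℤ, ∃ 𝓑 : Finset (I → ℤ), w₀ ∈ R → w₀ k ≠ 0 → ∀ ζ : I → ℚ,
        (∀ w ∈ 𝓑, w ≠ 0 → ratEval w ζ ≠ 0 ∧ |ratEval w ζ| < 1) →
        ∀ p : MvPolynomial I ℚ, ∃ Q : MvPolynomial I ℚ, Q.totalDegree ≤ p.totalDegree + K.card ∧
          ∀ z : I → ℤ, (∀ w ∈ 𝓑, 0 ≤ ((w ⬝ᵥ z : ℤ) : ℚ) * ratEval w ζ) →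
            sumOver K (perturbed (pivotRows R k w₀) ζ p) z
              = MvPolynomial.eval (fun i => (z i : ℚ)) Q := by
      intro w₀
      by_cases h : w₀ ∈ R ∧ w₀ k ≠ 0
      · obtain ⟨𝓑, h𝓑⟩ := ih (pivotRows R k w₀) (hUR w₀ h.1 h.2) (hCR w₀ h.1 h.2)
        exact ⟨𝓑, fun _ _ => h𝓑⟩
      · exact ⟨∅, fun h1 h2 => absurd ⟨h1, h2⟩ h⟩
    choose 𝓑 h𝓑 using hB
    refine ⟨R.biUnion fun w₀ => pivotRows R k w₀ ∪ 𝓑 w₀, fun ζ hζ p => ?_⟩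
    obtain ⟨G, hGdeg, hG⟩ := p.exists_antidifference k
    have hQ : ∀ w₀ : I → ℤ, ∃ Q : MvPolynomial I ℚ, w₀ ∈ R → w₀ k ≠ 0 →
        Q.totalDegree ≤ (boundTerm ζ k G w₀).totalDegree + K.card ∧
          ∀ z : I → ℤ, (∀ w ∈ 𝓑 w₀, 0 ≤ ((w ⬝ᵥ z : ℤ) : ℚ) * ratEval w ζ) →
            sumOver K (perturbed (pivotRows R k w₀) ζ (boundTerm ζ k G w₀)) z
              = MvPolynomial.eval (fun i => (z i : ℚ)) Q := by
      intro w₀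
      by_cases h : w₀ ∈ R ∧ w₀ k ≠ 0
      · obtain ⟨Q, hQ⟩ := h𝓑 w₀ h.1 h.2 ζ (fun w hw => hζ w (Finset.mem_biUnion.2
          ⟨w₀, h.1, Finset.mem_union_right _ hw⟩)) (boundTerm ζ k G w₀)
        exact ⟨Q, fun _ _ => hQ⟩
      · exact ⟨0, fun h1 h2 => absurd ⟨h1, h2⟩ h⟩
    choose Q hQ using hQ
    refine ⟨∑ w₀ ∈ R with w₀ k ≠ 0, Q w₀, ?_, fun z hz => ?_⟩
    · refine MvPolynomial.totalDegree_finsetSum_le fun w₀ hw₀ => ?_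
      obtain ⟨h1, h2⟩ := Finset.mem_filter.1 hw₀
      have h3 := (hQ w₀ h1 h2).1
      have h4 := totalDegree_boundTerm_le ζ k G w₀
      rw [Finset.card_insert_of_notMem hk]
      omega
    · rw [sumOver_insert_inner hk (finiteOnSlices_perturbed hC ζ p)]
      have hstep : ∀ x ∈ slice K z, ∑ᶠ t : ℤ, perturbed R ζ p (Function.update x k t) =
          ∑ w₀ ∈ R with w₀ k ≠ 0, perturbed (pivotRows R k w₀) ζ (boundTerm ζ k G w₀) x := by
        intro x _
        refine finsum_perturbed (fun w hw h0 => ?_)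
          (hC.exists_coeff_eq_one hU (Finset.mem_insert_self k K) 1 (Or.inl rfl))
          (hC.exists_coeff_eq_one hU (Finset.mem_insert_self k K) (-1) (Or.inr rfl))
          (fun w₀ hw₀ _ v hv => hζ v (Finset.mem_biUnion.2
            ⟨w₀, hw₀, Finset.mem_union_left _ hv⟩)) hG x
        have := hsq w hw h0
        exact mul_self_eq_one_iff.1 this
      rw [sumOver_congr hstep, sumOver_sum, map_sum]
      · refine Finset.sum_congr rfl fun w₀ hw₀ => ?_
        obtain ⟨h1, h2⟩ := Finset.mem_filter.1 hw₀
        exact (hQ w₀ h1 h2).2 z fun w hw => hz w (Finset.mem_biUnion.2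
            ⟨w₀, h1, Finset.mem_union_right _ hw⟩)
      · intro w₀ hw₀
        obtain ⟨h1, h2⟩ := Finset.mem_filter.1 hw₀
        exact finiteOnSlices_perturbed (hCR w₀ h1 h2) _ _

end UnimodularSums

/-! ### Elimination of equations -/

section Elimination

variable {I : Type*} [Fintype I]

/-- The polynomial `p` on the integer points where the forms `u j`, `j ∈ J`, vanish and the forms
in `R` are positive. -/
noncomputable def constrained {V : Type*} (J : Finset V) (u : V → I → ℤ) (R : Finset (I → ℤ))
    (p : MvPolynomial I ℚ) (x : I → ℤ) : ℚ :=
  open Classical in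
  if (∀ j ∈ J, u j ⬝ᵥ x = 0) ∧ ∀ w ∈ R, 0 < w ⬝ᵥ x then MvPolynomial.eval (fun i => (x i : ℚ)) p
  else 0

/-- A system of equations `u j = 0`, `j ∈ J`, and inequalities `w ≥ 0`, `w ∈ R`, confines the
variables in `K` if, on each slice, approximate solutions are bounded. -/
def ConfinesSystem {V : Type*} (J : Finset V) (u : V → I → ℤ) (R : Finset (I → ℤ))
    (K : Finset I) : Prop :=
  ∀ (z : I → ℤ) (C : ℤ), ∃ B : ℤ, ∀ x ∈ slice K z, (∀ j ∈ J, |u j ⬝ᵥ x| ≤ C) →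
    (∀ w ∈ R, -C ≤ w ⬝ᵥ x) → ∀ k ∈ K, |x k| ≤ B

/-- On the set `D` the equations `u j = 0`, `j ∈ J`, have, up to scaling, exactly one linear
dependency modulo the variables outside `K`: the sum of all of them. -/
def SingleDependency {V : Type*} (J : Finset V) (u : V → I → ℤ) (K : Finset I)
    (D : Set (I → ℤ)) : Prop :=
  ∀ c : V → ℚ, (∀ k ∈ K, ∑ j ∈ J, c j * u j k = 0) →
    (∀ i ∈ J, ∀ j ∈ J, c i = c j) ∧ ∀ z ∈ D, ∑ j ∈ J, c j * ((u j ⬝ᵥ z : ℤ) : ℚ) = 0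

/-- On the slices through points of `D`, the polynomial `p` vanishes at the solutions of the weak
system at which one of the inequalities is an equality. -/
def VanishesOnBoundary {V : Type*} (J : Finset V) (u : V → I → ℤ) (R : Finset (I → ℤ))
    (K : Finset I) (D : Set (I → ℤ)) (p : MvPolynomial I ℚ) : Prop :=
  ∀ z ∈ D, ∀ x ∈ slice K z, (∀ j ∈ J, u j ⬝ᵥ x = 0) → (∀ w ∈ R, 0 ≤ w ⬝ᵥ x) →
    (∃ w ∈ R, w ⬝ᵥ x = 0) → MvPolynomial.eval (fun i => (x i : ℚ)) p = 0

theorem finiteOnSlices_constrained {V : Type*} {J : Finset V} {u : V → I → ℤ}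
    {R : Finset (I → ℤ)} {K : Finset I} (h : ConfinesSystem J u R K) (p : MvPolynomial I ℚ) :
    FiniteOnSlices K (constrained J u R p) := by
  intro z
  obtain ⟨B, hB⟩ := h z 0
  refine (finite_slice_box K z B).subset fun x hx => ⟨hx.1, ?_⟩
  have : (∀ j ∈ J, u j ⬝ᵥ x = 0) ∧ ∀ w ∈ R, 0 < w ⬝ᵥ x := by
    by_contra hn
    exact hx.2 (if_neg hn)
  exact hB x hx.1 (fun j hj => by rw [this.1 j hj]; simp) fun w hw => by
    have := this.2 w hw
    omega

/-- A polynomial that vanishes on the boundary of a region does not see a perturbation by less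
than one unit. -/
theorem constrained_empty_eq_perturbed {R : Finset (I → ℤ)} {ζ : I → ℚ}
    (hζ : ∀ w ∈ R, w ≠ 0 → ratEval w ζ ≠ 0 ∧ |ratEval w ζ| < 1) (p : MvPolynomial I ℚ)
    (x : I → ℤ) (hp : (∀ w ∈ R, 0 ≤ w ⬝ᵥ x) → (∃ w ∈ R, w ⬝ᵥ x = 0) →
      MvPolynomial.eval (fun i => (x i : ℚ)) p = 0) :
    (open Classical in if ∀ w ∈ R, 0 < w ⬝ᵥ x then
      MvPolynomial.eval (fun i => (x i : ℚ)) p else 0) = perturbed R ζ p x := by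
  have hlt : ∀ w ∈ R, |ratEval w ζ| < 1 := by
    intro w hw
    by_cases h0 : w = 0
    · subst h0; simp [ratEval]
    · exact (hζ w hw h0).2
  by_cases h : ∀ w ∈ R, 0 < w ⬝ᵥ x
  · rw [if_pos h, perturbed, if_pos]
    intro w hw
    have h1 : (1 : ℚ) ≤ ((w ⬝ᵥ x : ℤ) : ℚ) := by exact_mod_cast h w hw
    have := (abs_lt.1 (hlt w hw)).1
    linarith
  · rw [if_neg h, perturbed]
    split_ifs with h'
    · refine (hp (fun w hw => ?_) ?_).symm
      · have h1 := h' w hw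
        have h2 := (abs_lt.1 (hlt w hw)).2
        have h3 : (-1 : ℚ) < ((w ⬝ᵥ x : ℤ) : ℚ) := by linarith
        have : (-1 : ℤ) < w ⬝ᵥ x := by exact_mod_cast h3
        omega
      · push Not at h
        obtain ⟨w, hw, hle⟩ := h
        refine ⟨w, hw, ?_⟩
        have h1 := h' w hw
        have h2 := (abs_lt.1 (hlt w hw)).2
        have h3 : (-1 : ℚ) < ((w ⬝ᵥ x : ℤ) : ℚ) := by linarith
        have : (-1 : ℤ) < w ⬝ᵥ x := by exact_mod_cast h3
        omega
    · rfl

variable [DecidableEq I]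

/-- The solution for the variable `k` of the equation `v = 0`, when `v` has coefficient `±1` at
`k`. -/
noncomputable def solvePoly (v : I → ℤ) (k : I) : MvPolynomial I ℚ :=
  MvPolynomial.affine (fun i => if i = k then 0 else -v k * v i) 0

theorem eval_solvePoly {v : I → ℤ} {k : I} (hs : v k * v k = 1) (x : I → ℤ) :
    MvPolynomial.eval (fun i => (x i : ℚ)) (solvePoly v k) = ((x k - v k * (v ⬝ᵥ x) : ℤ) : ℚ) := by
  have : x k - v k * (v ⬝ᵥ x) = ∑ i, (if i = k then 0 else -v k * v i) * x i := by
    simp only [dotProduct]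
    rw [← Finset.add_sum_erase _ _ (Finset.mem_univ k),
      ← Finset.add_sum_erase _ (fun i => (if i = k then 0 else -v k * v i) * x i)
        (Finset.mem_univ k), mul_add, ← mul_assoc, hs, Finset.mul_sum]
    simp only [if_true, zero_mul, zero_add, one_mul]
    rw [sub_add_cancel_left, ← Finset.sum_neg_distrib]
    refine Finset.sum_congr rfl fun i hi => ?_
    rw [if_neg (Finset.ne_of_mem_erase hi)]
    ring
  rw [solvePoly, MvPolynomial.eval_affine, add_zero, this, Int.cast_sum]
  exact Finset.sum_congr rfl fun i _ => by push_cast; rfl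

/-- Elimination of the variable `k` by means of the equation `u j = 0`. -/
theorem finsum_constrained {V : Type*} [DecidableEq V] {J : Finset V} {u : V → I → ℤ}
    {R : Finset (I → ℤ)} {j : V} (hj : j ∈ J) {k : I} (hs : u j k * u j k = 1)
    (p : MvPolynomial I ℚ) (x : I → ℤ) :
    ∑ᶠ t : ℤ, constrained J u R p (Function.update x k t) =
      constrained (J.erase j) (fun i => pivotForm (u j) k (u i)) (R.image (pivotForm (u j) k))
        (MvPolynomial.substVar k (solvePoly (u j) k) p) x := by
  have hdot : ∀ w : I → ℤ, w ⬝ᵥ Function.update x k (x k - u j k * (u j ⬝ᵥ x))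
      = pivotForm (u j) k w ⬝ᵥ x := by
    intro w
    rw [dotProduct_update, pivotForm_dotProduct]
    ring
  rw [finsum_eq_single _ (x k - u j k * (u j ⬝ᵥ x))]
  · have hval := eval_solvePoly hs x
    have hcast : (fun i => ((Function.update x k (x k - u j k * (u j ⬝ᵥ x)) i : ℤ) : ℚ))
        = Function.update (fun i => (x i : ℚ)) k ((x k - u j k * (u j ⬝ᵥ x) : ℤ) : ℚ) := by
      ext i
      by_cases h : i = k
      · subst h; simp
      · simp [h]
    unfold constrained
    rw [MvPolynomial.eval_substVar, hval, ← hcast]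
    refine if_congr ?_ rfl rfl
    simp only [hdot, Finset.mem_image, forall_exists_index, and_imp, forall_apply_eq_imp_iff₂]
    refine and_congr_left fun _ => ⟨fun h i hi => h i (Finset.mem_of_mem_erase hi), fun h i hi => ?_⟩
    by_cases hij : i = j
    · subst hij
      rw [pivotForm_dotProduct, hs]
      ring
    · exact h i (Finset.mem_erase.2 ⟨hij, hi⟩)
  · intro t ht
    refine if_neg fun h => ht ?_
    have h1 := h.1 j hj
    rw [dotProduct_update] at h1
    linear_combination u j k * h1 - (t - x k) * hs

/-- The sum of a polynomial over the positive solutions of a bounded unimodular system is given by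
one polynomial at all points of `D` whose position relative to finitely many walls is weakly that
of a small generic `ζ`. Each equation but one lowers the degree by one. -/
theorem exists_polynomial_sumOver_constrained {V : Type*} [DecidableEq V] (D : Set (I → ℤ))
    (N : ℕ) :
    ∀ (J : Finset V) (u : V → I → ℤ) (R : Finset (I → ℤ)) (K : Finset I) (p : MvPolynomial I ℚ),
      J.card = N → Unimodular ((R : Set (I → ℤ)) ∪ u '' J) K → ConfinesSystem J u R K →
      SingleDependency J u K D → VanishesOnBoundary J u R K D p →
      ∃ 𝓑 : Finset (I → ℤ), ∀ ζ : I → ℚ,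
        (∀ w ∈ 𝓑, w ≠ 0 → ratEval w ζ ≠ 0 ∧ |ratEval w ζ| < 1) →
        ∃ Q : MvPolynomial I ℚ, Q.totalDegree + J.card ≤ p.totalDegree + K.card + 1 ∧
          ∀ z ∈ D, (∀ w ∈ 𝓑, 0 ≤ ((w ⬝ᵥ z : ℤ) : ℚ) * ratEval w ζ) →
            sumOver K (constrained J u R p) z = MvPolynomial.eval (fun i => (z i : ℚ)) Q := by
  classical
  induction N with
  | zero =>
    intro J u R K p hJ hU hC _ hV
    obtain rfl : J = ∅ := Finset.card_eq_zero.1 hJ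
    have hC' : Confines R K := fun z C => by
      obtain ⟨B, hB⟩ := hC z C
      exact ⟨B, fun x hx hw => hB x hx (by simp) hw⟩
    obtain ⟨𝓑, h𝓑⟩ := exists_polynomial_sumOver_perturbed K R
      (hU.mono Set.subset_union_left le_rfl) hC'
    refine ⟨𝓑 ∪ R, fun ζ hζ => ?_⟩
    obtain ⟨Q, hQd, hQ⟩ := h𝓑 ζ (fun w hw => hζ w (Finset.mem_union_left _ hw)) p
    refine ⟨Q, by simp; omega, fun z hz hzw => ?_⟩
    rw [← hQ z fun w hw => hzw w (Finset.mem_union_left _ hw)]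
    refine sumOver_congr fun x hx => ?_
    rw [← constrained_empty_eq_perturbed (fun w hw => hζ w (Finset.mem_union_right _ hw)) p x
      (hV z hz x hx (by simp))]
    simp [constrained]
  | succ N ih =>
    intro J u R K p hJ hU hC hS hV
    by_cases hpiv : ∃ j ∈ J, ∃ k ∈ K, u j k ≠ 0
    · obtain ⟨j, hj, k, hk, h0⟩ := hpiv
      have hmem : u j ∈ (R : Set (I → ℤ)) ∪ u '' J := Or.inr ⟨j, Finset.mem_coe.2 hj, rfl⟩
      have hs : u j k * u j k = 1 := hU.coeff_mul_self hmem (Finset.mem_coe.2 hk) h0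
      have hKins : insert k (K.erase k) = K := Finset.insert_erase hk
      have hdot : ∀ (w x : I → ℤ), w ⬝ᵥ Function.update x k (x k - u j k * (u j ⬝ᵥ x))
          = pivotForm (u j) k w ⬝ᵥ x := by
        intro w x
        rw [dotProduct_update, pivotForm_dotProduct]
        ring
      have hslice : ∀ (z x : I → ℤ) (t : ℤ), x ∈ slice (K.erase k) z →
          Function.update x k t ∈ slice K z := by
        intro z x t hx i hi
        have hik : i ≠ k := fun h => hi (h ▸ hk)
        rw [Function.update_of_ne hik]
        exact hx i fun h => hi (Finset.mem_of_mem_erase h)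
      have hself : ∀ x : I → ℤ, pivotForm (u j) k (u j) ⬝ᵥ x = 0 := by
        intro x
        rw [pivotForm_dotProduct, hs]
        ring
      have hcard : (J.erase j).card + 1 = J.card := Finset.card_erase_add_one hj
      have hcardK : (K.erase k).card + 1 = K.card := Finset.card_erase_add_one hk
      have hU' : Unimodular ((R.image (pivotForm (u j) k) : Set (I → ℤ)) ∪
          (fun i => pivotForm (u j) k (u i)) '' (J.erase j : Finset V)) (K.erase k : Finset I) := by
        refine (hU.pivot hmem (Finset.mem_coe.2 hk) h0).mono ?_ (by simp)
        rintro w (hw | ⟨i, hi, rfl⟩)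
        · obtain ⟨v, hv, rfl⟩ := Finset.mem_image.1 (Finset.mem_coe.1 hw)
          exact ⟨v, Or.inl hv, rfl⟩
        · exact ⟨u i, Or.inr ⟨i, Finset.mem_of_mem_erase hi, rfl⟩, rfl⟩
      have hC' : ConfinesSystem (J.erase j) (fun i => pivotForm (u j) k (u i))
          (R.image (pivotForm (u j) k)) (K.erase k) := by
        intro z C
        obtain ⟨B, hB⟩ := hC z (max C 0)
        refine ⟨B, fun x hx hx1 hx2 i hi => ?_⟩
        have := hB _ (hslice z x (x k - u j k * (u j ⬝ᵥ x)) hx) (fun l hl => ?_) (fun w hw => ?_) i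
          (Finset.mem_of_mem_erase hi)
        · simpa [Finset.ne_of_mem_erase hi] using this
        · rw [hdot]
          by_cases hlj : l = j
          · subst hlj
            rw [hself]
            simp
          · exact (hx1 l (Finset.mem_erase.2 ⟨hlj, hl⟩)).trans (le_max_left _ _)
        · rw [hdot]
          have := hx2 _ (Finset.mem_image_of_mem _ hw)
          have := le_max_left C 0
          omega
      have hS' : SingleDependency (J.erase j) (fun i => pivotForm (u j) k (u i)) (K.erase k) D := by
        intro c hc
        -- a dependency of the new system extends to one of the old system
        let c' : V → ℚ := fun i => if i = j then
          -∑ l ∈ J.erase j, c l * (u l k * u j k : ℤ) else c i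
        have hsum : ∀ f : V → ℚ, ∑ l ∈ J, c' l * f l =
            ∑ l ∈ J.erase j, c l * (f l - (u l k * u j k : ℤ) * f j) := by
          intro f
          rw [← Finset.add_sum_erase _ _ hj]
          simp only [c', if_true, neg_mul, Finset.sum_mul]
          rw [← Finset.sum_neg_distrib, ← Finset.sum_add_distrib]
          refine Finset.sum_congr rfl fun l hl => ?_
          rw [if_neg (Finset.ne_of_mem_erase hl)]
          ring
        have hform : ∀ (l : V) (i : I), ((pivotForm (u j) k (u l) i : ℤ) : ℚ) =
            u l i - (u l k * u j k : ℤ) * u j i := by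
          intro l i
          simp [pivotForm]
        obtain ⟨h1, h2⟩ := hS c' fun i hi => by
          rw [hsum]
          by_cases hik : i = k
          · subst hik
            refine Finset.sum_eq_zero fun l _ => ?_
            have : (u j i : ℚ) * u j i = 1 := by exact_mod_cast hs
            push_cast
            linear_combination (-(c l) * u l i) * this
          · rw [← hc i (Finset.mem_erase.2 ⟨hik, hi⟩)]
            exact Finset.sum_congr rfl fun l _ => by rw [hform]
        refine ⟨fun a ha b hb => ?_, fun z hz => ?_⟩
        · have := h1 a (Finset.mem_of_mem_erase ha) b (Finset.mem_of_mem_erase hb)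
          simpa [c', Finset.ne_of_mem_erase ha, Finset.ne_of_mem_erase hb] using this
        · have := h2 z hz
          rw [hsum] at this
          rw [← this]
          refine Finset.sum_congr rfl fun l _ => ?_
          rw [pivotForm_dotProduct]
          push_cast
          ring
      have hV' : VanishesOnBoundary (J.erase j) (fun i => pivotForm (u j) k (u i))
          (R.image (pivotForm (u j) k)) (K.erase k) D
          (MvPolynomial.substVar k (solvePoly (u j) k) p) := by
        intro z hz x hx h1 h2 h3
        have hxx := hV z hz _ (hslice z x (x k - u j k * (u j ⬝ᵥ x)) hx) (fun l hl => ?_)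
          (fun w hw => ?_) ?_
        · rw [MvPolynomial.eval_substVar]
          have hfun : Function.update (fun i => (x i : ℚ)) k
              (MvPolynomial.eval (fun i => (x i : ℚ)) (solvePoly (u j) k)) =
              fun i => ((Function.update x k (x k - u j k * (u j ⬝ᵥ x)) i : ℤ) : ℚ) := by
            rw [eval_solvePoly hs]
            ext i
            by_cases hik : i = k
            · subst hik; simp
            · simp [hik]
          rw [hfun]
          exact hxx
        · rw [hdot]
          by_cases hlj : l = j
          · subst hlj
            exact hself x
          · exact h1 l (Finset.mem_erase.2 ⟨hlj, hl⟩)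
        · rw [hdot]
          exact h2 _ (Finset.mem_image_of_mem _ hw)
        · obtain ⟨w, hw, hw0⟩ := h3
          obtain ⟨v, hv, rfl⟩ := Finset.mem_image.1 hw
          exact ⟨v, hv, by rw [hdot]; exact hw0⟩
      obtain ⟨𝓑, h𝓑⟩ := ih (J.erase j) _ _ (K.erase k) _ (by omega) hU' hC' hS' hV'
      refine ⟨𝓑, fun ζ hζ => ?_⟩
      obtain ⟨Q, hQd, hQ⟩ := h𝓑 ζ hζ
      refine ⟨Q, ?_, fun z hz hzw => ?_⟩
      · have := MvPolynomial.totalDegree_substVar_le k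
          (L := solvePoly (u j) k) (MvPolynomial.totalDegree_affine_le _ _) p
        omega
      · rw [← hQ z hz hzw]
        have hfin : FiniteOnSlices (insert k (K.erase k)) (constrained J u R p) := by
          rw [hKins]
          exact finiteOnSlices_constrained hC p
        conv_lhs => rw [← hKins]
        rw [sumOver_insert_inner (Finset.notMem_erase k K) hfin]
        exact sumOver_congr fun x _ => finsum_constrained hj hs p x
    · push Not at hpiv
      -- the equations left do not involve the variables of summation: there is only one of them
      have hone : J.card ≤ 1 := by
        rw [Finset.card_le_one]
        intro a ha b hb
        by_contra hab
        have := (hS (Pi.single a 1) fun k hk => Finset.sum_eq_zero fun j hj => by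
          rw [hpiv j hj k hk]; simp).1 a ha b hb
        rw [Pi.single_eq_same, Pi.single_eq_of_ne (Ne.symm hab)] at this
        exact one_ne_zero this
      have hdot : ∀ (z : I → ℤ), ∀ x ∈ slice K z, ∀ j ∈ J, u j ⬝ᵥ x = u j ⬝ᵥ z := by
        intro z x hx j hj
        refine Finset.sum_congr rfl fun i _ => ?_
        by_cases hi : i ∈ K
        · rw [hpiv j hj i hi]; simp
        · rw [hx i hi]
      have hzero : ∀ z ∈ D, ∀ j ∈ J, u j ⬝ᵥ z = 0 := by
        intro z hz j hj
        have := (hS (Pi.single j 1) fun k hk => Finset.sum_eq_zero fun j hj => by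
          rw [hpiv j hj k hk]; simp).2 z hz
        rw [Finset.sum_eq_single j] at this
        · simpa using this
        · intro b _ hb
          simp [Pi.single_eq_of_ne hb]
        · exact fun h => absurd hj h
      have hC' : Confines R K := fun z C => by
        obtain ⟨B, hB⟩ := hC z (max C (∑ j ∈ J, |u j ⬝ᵥ z|))
        refine ⟨B, fun x hx hw => hB x hx (fun j hj => ?_) fun w hwR => ?_⟩
        · rw [hdot z x hx j hj]
          exact (Finset.single_le_sum (f := fun j => |u j ⬝ᵥ z|)
            (fun _ _ => abs_nonneg _) hj).trans (le_max_right _ _)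
        · have := hw w hwR
          have := le_max_left C (∑ j ∈ J, |u j ⬝ᵥ z|)
          omega
      obtain ⟨𝓑, h𝓑⟩ := exists_polynomial_sumOver_perturbed K R
        (hU.mono Set.subset_union_left le_rfl) hC'
      refine ⟨𝓑 ∪ R, fun ζ hζ => ?_⟩
      obtain ⟨Q, hQd, hQ⟩ := h𝓑 ζ (fun w hw => hζ w (Finset.mem_union_left _ hw)) p
      refine ⟨Q, by omega, fun z hz hzw => ?_⟩
      rw [← hQ z fun w hw => hzw w (Finset.mem_union_left _ hw)]
      refine sumOver_congr fun x hx => ?_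
      have hJx : ∀ j ∈ J, u j ⬝ᵥ x = 0 := fun j hj => by rw [hdot z x hx j hj, hzero z hz j hj]
      rw [← constrained_empty_eq_perturbed (fun w hw => hζ w (Finset.mem_union_right _ hw)) p x
        (hV z hz x hx hJx), constrained]
      exact if_congr (and_iff_right hJx) rfl rfl

end Elimination

/-! ### Piecewise polynomial functions -/

section Walls

variable {I : Type*} [Fintype I]

theorem ratEval_add_smul (w : I → ℤ) (a b : I → ℚ) (c : ℚ) :
    ratEval w (fun i => a i + c * b i) = ratEval w a + c * ratEval w b := by
  simp only [ratEval, Finset.mul_sum, ← Finset.sum_add_distrib]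
  exact Finset.sum_congr rfl fun i _ => by ring

theorem ratEval_smul (w : I → ℤ) (a : I → ℚ) (c : ℚ) :
    ratEval w (fun i => c * a i) = c * ratEval w a := by
  simp only [ratEval, Finset.mul_sum]
  exact Finset.sum_congr rfl fun i _ => by ring

theorem exists_forall_ratEval_ne_zero (𝓑 : Finset (I → ℤ)) :
    ∃ u : I → ℚ, ∀ w ∈ 𝓑, w ≠ 0 → ratEval w u ≠ 0 := by
  classical
  let f : {w // w ∈ 𝓑 ∧ w ≠ 0} → Module.Dual ℚ (I → ℚ) := fun w =>
    { toFun := ratEval w.1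
      map_add' := fun a b => by
        have := ratEval_add_smul w.1 a b 1
        simp only [one_mul] at this
        exact this
      map_smul' := fun c a => ratEval_smul w.1 a c }
  have hfin : Finite {w // w ∈ 𝓑 ∧ w ≠ 0} :=
    Finite.of_injective (fun w => (⟨w.1, w.2.1⟩ : 𝓑)) fun a b h => by
      simpa [Subtype.ext_iff] using h
  obtain ⟨u, hu⟩ := Module.Dual.exists_forall_ne_zero_of_forall_exists f fun w => by
    obtain ⟨i, hi⟩ := Function.ne_iff.1 w.2.2
    refine ⟨Pi.single i 1, ?_⟩
    have : ratEval w.1 (Pi.single i 1) = w.1 i := by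
      simp [ratEval, Pi.single_apply]
    change ratEval w.1 (Pi.single i 1) ≠ 0
    rw [this]
    exact_mod_cast hi
  exact ⟨u, fun w hw h0 => hu ⟨w, hw, h0⟩⟩

/-- Every integer point lies in the closure of the chamber of a small generic vector. -/
theorem exists_generic (𝓑 : Finset (I → ℤ)) (z : I → ℤ) :
    ∃ ζ : I → ℚ, (∀ w ∈ 𝓑, w ≠ 0 → ratEval w ζ ≠ 0 ∧ |ratEval w ζ| < 1) ∧
      ∀ w ∈ 𝓑, 0 ≤ ((w ⬝ᵥ z : ℤ) : ℚ) * ratEval w ζ := by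
  obtain ⟨u, hu⟩ := exists_forall_ratEval_ne_zero 𝓑
  -- `z + ε u` is generic, and close enough to `z` to respect the signs of the forms at `z`
  let ε : ℚ := (1 + ∑ w ∈ 𝓑, |ratEval w u|)⁻¹
  have hS : 0 < 1 + ∑ w ∈ 𝓑, |ratEval w u| := by positivity
  have hε : 0 < ε := inv_pos.2 hS
  have hsmall : ∀ w ∈ 𝓑, |ε * ratEval w u| < 1 := by
    intro w hw
    rw [abs_mul, abs_of_pos hε, inv_mul_lt_iff₀ hS, mul_one]
    have := Finset.single_le_sum (f := fun w => |ratEval w u|) (fun _ _ => abs_nonneg _) hw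
    linarith
  let y : I → ℚ := fun i => (z i : ℚ) + ε * u i
  have hy : ∀ w, ratEval w y = ((w ⬝ᵥ z : ℤ) : ℚ) + ε * ratEval w u := by
    intro w
    rw [← ratEval_intCast]
    exact ratEval_add_smul w _ u ε
  have hsign : ∀ w ∈ 𝓑, 0 ≤ ((w ⬝ᵥ z : ℤ) : ℚ) * ratEval w y := by
    intro w hw
    rw [hy]
    have h1 := abs_lt.1 (hsmall w hw)
    rcases lt_trichotomy (w ⬝ᵥ z) 0 with h | h | h
    · have h2 : ((w ⬝ᵥ z : ℤ) : ℚ) ≤ -1 := by exact_mod_cast Int.le_sub_one_of_lt h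
      exact mul_nonneg_of_nonpos_of_nonpos (by linarith) (by linarith)
    · simp [h]
    · have h2 : (1 : ℚ) ≤ ((w ⬝ᵥ z : ℤ) : ℚ) := by exact_mod_cast h
      exact mul_nonneg (by linarith) (by linarith)
  have hne : ∀ w ∈ 𝓑, w ≠ 0 → ratEval w y ≠ 0 := by
    intro w hw h0
    rw [hy]
    have h1 := abs_lt.1 (hsmall w hw)
    have h3 := mul_ne_zero hε.ne' (hu w hw h0)
    rcases lt_trichotomy (w ⬝ᵥ z) 0 with h | h | h
    · have h2 : ((w ⬝ᵥ z : ℤ) : ℚ) ≤ -1 := by exact_mod_cast Int.le_sub_one_of_lt h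
      intro h4
      linarith
    · simpa [h] using h3
    · have h2 : (1 : ℚ) ≤ ((w ⬝ᵥ z : ℤ) : ℚ) := by exact_mod_cast h
      intro h4
      linarith
  let δ : ℚ := (1 + ∑ w ∈ 𝓑, |ratEval w y|)⁻¹
  have hT : 0 < 1 + ∑ w ∈ 𝓑, |ratEval w y| := by positivity
  have hδ : 0 < δ := inv_pos.2 hT
  refine ⟨fun i => δ * y i, fun w hw h0 => ?_, fun w hw => ?_⟩
  · rw [ratEval_smul]
    refine ⟨mul_ne_zero hδ.ne' (hne w hw h0), ?_⟩
    rw [abs_mul, abs_of_pos hδ, inv_mul_lt_iff₀ hT, mul_one]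
    have := Finset.single_le_sum (f := fun w => |ratEval w y|) (fun _ _ => abs_nonneg _) hw
    linarith
  · rw [ratEval_smul, mul_left_comm]
    exact mul_nonneg hδ.le (hsign w hw)

/-- The integer vector with coordinates copied from `x` along `r`, and zero where `r` has no
value. -/
def copyAlong {ι : Type*} (r : I → Option ι) (x : ι → ℕ) : I → ℤ :=
  fun i => (r i).elim 0 fun a => (x a : ℤ)

theorem dotProduct_copyAlong {ι : Type*} [Fintype ι] [DecidableEq ι] (r : I → Option ι)
    (w : I → ℤ) (x : ι → ℕ) :
    w ⬝ᵥ copyAlong r x = ∑ a, (∑ i, if r i = some a then w i else 0) * (x a : ℤ) := by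
  simp only [Finset.sum_mul]
  rw [Finset.sum_comm]
  refine Finset.sum_congr rfl fun i _ => ?_
  cases h : r i with
  | none => simp [copyAlong, h]
  | some b => simp [copyAlong, h]

/-- A function given by one polynomial on the closure of each chamber of a finite system of walls
is piecewise polynomial. -/
theorem isPiecewisePolynomialOn_of_walls {ι : Type*} [Fintype ι] [Nonempty ι]
    {S : Set (ι → ℕ)} (hS : ∀ x ∈ S, ∀ i, 0 < x i) {f : (ι → ℕ) → ℚ} {D : ℕ}
    (r : I → Option ι) (𝓑 : Finset (I → ℤ))
    (h : ∀ ζ : I → ℚ, (∀ w ∈ 𝓑, w ≠ 0 → ratEval w ζ ≠ 0 ∧ |ratEval w ζ| < 1) →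
      ∃ Q : MvPolynomial I ℚ, Q.totalDegree ≤ D ∧ ∀ x ∈ S,
        (∀ w ∈ 𝓑, 0 ≤ ((w ⬝ᵥ copyAlong r x : ℤ) : ℚ) * ratEval w ζ) →
          f x = MvPolynomial.eval (fun i => (copyAlong r x i : ℚ)) Q) :
    IsPiecewisePolynomialOn S f D := by
  classical
  let Good : (𝓑 → Bool) → (I → ℚ) → Prop := fun s ζ =>
    (∀ w ∈ 𝓑, w ≠ 0 → ratEval w ζ ≠ 0 ∧ |ratEval w ζ| < 1) ∧
      ∀ w : 𝓑, s w = decide (0 < ratEval w.1 ζ)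
  let form : (I → ℤ) → ι → ℤ := fun w a => ∑ i, if r i = some a then w i else 0
  have hcone : ∀ s : 𝓑 → Bool, ∃ (A : Finset (ι → ℤ)) (p : MvPolynomial ι ℚ),
      p.totalDegree ≤ D ∧ (∀ x ∈ S ∩ coneLatticePoints A,
        f x = MvPolynomial.eval (fun i => (x i : ℚ)) p) ∧
      ∀ ζ, Good s ζ → ∀ x : ι → ℕ,
        (∀ w ∈ 𝓑, 0 ≤ ((w ⬝ᵥ copyAlong r x : ℤ) : ℚ) * ratEval w ζ) →
          x ∈ coneLatticePoints A := by
    intro s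
    by_cases hs : ∃ ζ, Good s ζ
    · obtain ⟨ζ, hζ, hsζ⟩ := hs
      obtain ⟨Q, hQd, hQ⟩ := h ζ hζ
      refine ⟨𝓑.attach.image fun w => (if s w then 1 else -1 : ℤ) • form w.1,
        MvPolynomial.aeval (fun i => (r i).elim 0 MvPolynomial.X) Q,
        (MvPolynomial.totalDegree_aeval_le _ (fun i => ?_) Q).trans hQd, ?_, ?_⟩
      · cases r i <;> simp [MvPolynomial.totalDegree_X]
      · rintro x ⟨hxS, hxA⟩
        rw [hQ x hxS]
        · rw [MvPolynomial.aeval_def, MvPolynomial.eval_eval₂, MvPolynomial.eval₂_eq,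
            MvPolynomial.eval_eq]
          refine Finset.sum_congr rfl fun d _ => ?_
          congr 1
          · simp
          · refine Finset.prod_congr rfl fun i _ => ?_
            cases hr : r i <;> simp [copyAlong, hr]
        · intro w hw
          have h1 := hxA _ (Finset.mem_image_of_mem _ (Finset.mem_attach 𝓑 ⟨w, hw⟩))
          have h2 := hsζ ⟨w, hw⟩
          simp only [Pi.smul_apply, smul_eq_mul, mul_assoc] at h1
          rw [← Finset.mul_sum] at h1
          rw [dotProduct_copyAlong]
          by_cases h3 : 0 < ratEval w ζ
          · rw [h2, decide_eq_true h3, if_pos rfl, one_mul] at h1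
            exact mul_nonneg (by exact_mod_cast h1) h3.le
          · rw [h2, decide_eq_false h3, if_neg (by simp)] at h1
            have h4 : ∑ a, form w a * (x a : ℤ) ≤ 0 := by linarith
            exact mul_nonneg_of_nonpos_of_nonpos (by exact_mod_cast h4) (not_lt.1 h3)
      · rintro ζ' ⟨hζ', hsζ'⟩ x hx a ha
        obtain ⟨w, -, rfl⟩ := Finset.mem_image.1 ha
        have h1 := hx w.1 w.2
        have h2 := hsζ' w
        simp only [Pi.smul_apply, smul_eq_mul, mul_assoc]
        rw [← Finset.mul_sum]
        rw [dotProduct_copyAlong] at h1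
        by_cases h3 : 0 < ratEval w.1 ζ'
        · rw [h2, decide_eq_true h3, if_pos rfl, one_mul]
          have := nonneg_of_mul_nonneg_left h1 h3
          exact_mod_cast this
        · rw [h2, decide_eq_false h3, if_neg (by simp)]
          by_cases h0 : w.1 = 0
          · simp [form, h0]
          · have h4 : ratEval w.1 ζ' < 0 := lt_of_le_of_ne (not_lt.1 h3) (hζ' w.1 w.2 h0).1
            have h5 : ((∑ a, form w.1 a * (x a : ℤ) : ℤ) : ℚ) ≤ 0 := by
              by_contra hc
              push Not at hc
              exact absurd h1 (not_le.2 (mul_neg_of_pos_of_neg hc h4))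
            have h6 : ∑ a, form w.1 a * (x a : ℤ) ≤ 0 := by exact_mod_cast h5
            linarith
    · -- a sign pattern that is not realized: its cone contains no point with positive entries
      refine ⟨{fun _ => -1}, 0, by simp, fun x hx => ?_, fun ζ hζ => absurd ⟨ζ, hζ⟩ hs⟩
      exfalso
      have h1 := hx.2 _ (Finset.mem_singleton_self _)
      have h2 : 0 < ∑ i, (x i : ℤ) :=
        Finset.sum_pos (fun i _ => by exact_mod_cast hS x hx.1 i) Finset.univ_nonempty
      simp only [neg_mul, one_mul, Finset.sum_neg_distrib] at h1
      linarith
  choose A p hp hpe hcov using hcone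
  let e := Fintype.equivFin (𝓑 → Bool)
  refine ⟨Fintype.card (𝓑 → Bool), fun c => A (e.symm c), fun c => p (e.symm c), fun x hx => ?_,
    fun c => ⟨hp _, hpe _⟩⟩
  obtain ⟨ζ, hζ, hζx⟩ := exists_generic 𝓑 (copyAlong r x)
  rw [Set.mem_iUnion]
  refine ⟨e fun w => decide (0 < ratEval w.1 ζ), ?_⟩
  simp only [Equiv.symm_apply_apply]
  exact hcov _ ζ ⟨hζ, fun _ => rfl⟩ x hζx

end Walls

namespace IsPiecewisePolynomialOn

variable {ι : Type*} [Fintype ι] {S : Set (ι → ℕ)} {f g : (ι → ℕ) → ℚ} {D : ℕ}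

theorem congr (hf : IsPiecewisePolynomialOn S f D) (h : ∀ x ∈ S, g x = f x) :
    IsPiecewisePolynomialOn S g D := by
  obtain ⟨k, A, p, hA, hp⟩ := hf
  exact ⟨k, A, p, hA, fun c => ⟨(hp c).1, fun x hx => (h x hx.1).trans ((hp c).2 x hx)⟩⟩

theorem zero (S : Set (ι → ℕ)) (D : ℕ) : IsPiecewisePolynomialOn S (fun _ => 0) D :=
  ⟨1, fun _ => ∅, fun _ => 0, fun x _ => Set.mem_iUnion.2 ⟨0, by simp [coneLatticePoints]⟩,
    fun c => ⟨by simp, fun x _ => by simp⟩⟩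

theorem const_mul (hf : IsPiecewisePolynomialOn S f D) (a : ℚ) :
    IsPiecewisePolynomialOn S (fun x => a * f x) D := by
  obtain ⟨k, A, p, hA, hp⟩ := hf
  refine ⟨k, A, fun c => MvPolynomial.C a * p c, hA, fun c => ⟨?_, fun x hx => ?_⟩⟩
  · refine (MvPolynomial.totalDegree_mul _ _).trans ?_
    rw [MvPolynomial.totalDegree_C, zero_add]
    exact (hp c).1
  · rw [MvPolynomial.eval_mul, MvPolynomial.eval_C, ← (hp c).2 x hx]

/-- The sum of two piecewise polynomial functions is polynomial on the intersections of the
cones. -/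
theorem add (hf : IsPiecewisePolynomialOn S f D) (hg : IsPiecewisePolynomialOn S g D) :
    IsPiecewisePolynomialOn S (fun x => f x + g x) D := by
  classical
  obtain ⟨k, A, p, hA, hp⟩ := hf
  obtain ⟨l, B, q, hB, hq⟩ := hg
  have hmem : ∀ (a : Fin k) (b : Fin l) (x : ι → ℕ), x ∈ coneLatticePoints (A a ∪ B b) ↔
      x ∈ coneLatticePoints (A a) ∧ x ∈ coneLatticePoints (B b) := by
    intro a b x
    simp only [coneLatticePoints, Finset.mem_union, Set.mem_ofPred_eq]
    exact ⟨fun h => ⟨fun v hv => h v (Or.inl hv), fun v hv => h v (Or.inr hv)⟩,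
      fun h v hv => hv.elim (h.1 v) (h.2 v)⟩
  refine ⟨k * l, fun c => A (finProdFinEquiv.symm c).1 ∪ B (finProdFinEquiv.symm c).2,
    fun c => p (finProdFinEquiv.symm c).1 + q (finProdFinEquiv.symm c).2, fun x hx => ?_,
    fun c => ⟨?_, fun x hx => ?_⟩⟩
  · obtain ⟨a, ha⟩ := Set.mem_iUnion.1 (hA hx)
    obtain ⟨b, hb⟩ := Set.mem_iUnion.1 (hB hx)
    refine Set.mem_iUnion.2 ⟨finProdFinEquiv (a, b), ?_⟩
    simp only [Equiv.symm_apply_apply]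
    exact (hmem a b x).2 ⟨ha, hb⟩
  · exact (MvPolynomial.totalDegree_add _ _).trans (max_le (hp _).1 (hq _).1)
  · have h := (hmem _ _ x).1 hx.2
    rw [MvPolynomial.eval_add, ← (hp _).2 x ⟨hx.1, h.1⟩, ← (hq _).2 x ⟨hx.1, h.2⟩]

/-- On a ray a piecewise polynomial function is a polynomial, since the cones are invariant under
scaling. -/
theorem exists_polynomial_on_ray (hf : IsPiecewisePolynomialOn S f D) {x : ι → ℕ} (hx : x ∈ S)
    (hray : ∀ t : ℕ, 1 ≤ t → (fun i => t * x i) ∈ S) :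
    ∃ q : Polynomial ℚ, q.natDegree ≤ D ∧
      ∀ t : ℕ, 1 ≤ t → f (fun i => t * x i) = q.eval (t : ℚ) := by
  obtain ⟨k, A, p, hA, hp⟩ := hf
  obtain ⟨c, hc⟩ := Set.mem_iUnion.1 (hA hx)
  refine ⟨MvPolynomial.aeval (fun i => Polynomial.C (x i : ℚ) * Polynomial.X) (p c), ?_,
    fun t ht => ?_⟩
  · refine le_trans ?_ (hp c).1
    rw [MvPolynomial.aeval_def, MvPolynomial.eval₂_eq]
    refine Polynomial.natDegree_sum_le_of_forall_le _ _ fun d hd => ?_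
    refine (Polynomial.natDegree_C_mul_le _ _).trans ((Polynomial.natDegree_prod_le _ _).trans ?_)
    refine le_trans (Finset.sum_le_sum fun i _ => ?_) (MvPolynomial.le_totalDegree hd)
    refine Polynomial.natDegree_pow_le.trans ?_
    have : (Polynomial.C (x i : ℚ) * Polynomial.X).natDegree ≤ 1 := by
      simpa using Polynomial.natDegree_C_mul_X_pow_le (x i : ℚ) 1
    exact (Nat.mul_le_mul_left _ this).trans (by simp)
  · rw [(hp c).2 _ ⟨hray t ht, fun a ha => ?_⟩]
    · rw [MvPolynomial.aeval_def, ← Polynomial.coe_evalRingHom, MvPolynomial.hom_eval₂,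
        MvPolynomial.eval₂_eq, MvPolynomial.eval_eq]
      refine Finset.sum_congr rfl fun d _ => ?_
      congr 1
      · simp
      · refine Finset.prod_congr rfl fun i _ => ?_
        simp [mul_comm]
    · have h1 := hc a ha
      have : ∑ i, a i * ((t * x i : ℕ) : ℤ) = t * ∑ i, a i * (x i : ℤ) := by
        rw [Finset.mul_sum]
        exact Finset.sum_congr rfl fun i _ => by push_cast; ring
      rw [this]
      positivity

end IsPiecewisePolynomialOn

/-! ### Systems of flows with weights -/

/-- A directed graph with unknown flows on its edges. The variables are edges: those in `K` are
internal, and their flows are summed over; the other edges have prescribed flows. The vertices, in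
`J`, are named by variables as well. The internal edges in `W` carry their flow as weight. The
variables `Sum.inr i` stand for edges that leave the graph. -/
structure FlowSystem (L : Type*) (m : ℕ) where
  /-- The vertex into which an edge runs. -/
  head : L ⊕ Fin m → Option (L ⊕ Fin m)
  /-- The vertex out of which an edge runs. -/
  tail : L ⊕ Fin m → Option (L ⊕ Fin m)
  /-- The internal edges. -/
  K : Finset (L ⊕ Fin m)
  /-- The vertices. -/
  J : Finset (L ⊕ Fin m)
  /-- The weighted edges. -/
  W : Finset (L ⊕ Fin m)

namespace FlowSystem

variable {L : Type*} [Fintype L] [DecidableEq L] {m : ℕ}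

/-- The forms that are required to be positive: the flows on internal edges. -/
def rows (G : FlowSystem L m) : Finset (L ⊕ Fin m → ℤ) := G.K.image fun k => Pi.single k 1

/-- The product of the weights of the edges, for a positive conserved flow `x`. -/
noncomputable def summand (G : FlowSystem L m) : (L ⊕ Fin m → ℤ) → ℚ :=
  constrained G.J (incidenceForm G.head G.tail) G.rows (∏ k ∈ G.W, MvPolynomial.X k)

/-- The weighted number of positive integer flows with prescribed flows on the outer edges. -/
noncomputable def value (G : FlowSystem L m) (z : L ⊕ Fin m → ℤ) : ℚ := sumOver G.K G.summand z

/-- The edge `k` runs into the end vertex of the outer edge `Sum.inr i`, and no further edge is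
there: the flow on `k` is the prescribed one. -/
def Dangling (G : FlowSystem L m) (k : L ⊕ Fin m) (i : Fin m) : Prop :=
  G.head k = some (Sum.inr i) ∧ (∀ k', G.head k' = some (Sum.inr i) → k' = k) ∧
    ∀ k', G.tail k' = some (Sum.inr i) → k' = Sum.inr i

/-- The properties of the flow systems which describe the completions of a partial monodromy
graph: `A` is the set of its loose strands, `U ⊆ A` the set of those that run into a vertex where
something happens, `b` records which strands are connected in the past, `Z` is a set of labels
already used, and `r` is the number of proper vertices. -/
structure Valid (G : FlowSystem L m) (A U : Finset L) (b : L → L) (Z : Finset L) (r : ℕ) :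
    Prop where
  avoid : ∀ l ∈ Z, Sum.inl l ∉ G.K ∧ Sum.inl l ∉ G.J
  inr_notMem : ∀ i, Sum.inr i ∉ G.K
  head_K : ∀ k ∈ G.K, ∃ j ∈ G.J, G.head k = some j
  tail_K : ∀ k ∈ G.K, ∃ j ∈ G.J, G.tail k = some j
  head_A : ∀ p ∈ A, ∃ j ∈ G.J, G.head (Sum.inl p) = some j
  tail_A : ∀ p ∈ A, G.tail (Sum.inl p) = none
  head_inr : ∀ i, G.head (Sum.inr i) = none
  tail_inr : ∀ i, G.tail (Sum.inr i) = some (Sum.inr i)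
  inr_mem : ∀ i, Sum.inr i ∈ G.J
  other : ∀ l, l ∉ A → Sum.inl l ∉ G.K →
    G.head (Sum.inl l) = none ∧ G.tail (Sum.inl l) = none
  W_subset : G.W ⊆ G.K
  U_subset : U ⊆ A
  unweighted : ∀ k ∈ G.K, k ∉ G.W → ∃ i, G.Dangling k i
  unused : ∀ p ∈ A, p ∉ U → ∃ i, G.Dangling (Sum.inl p) i
  connected : ∀ c : L ⊕ Fin m → ℚ,
    (∀ k ∈ G.K, ∀ j j', G.head k = some j → G.tail k = some j' → c j = c j') →
    (∀ p ∈ A, ∀ q ∈ A, b p = b q → ∀ j j', G.head (Sum.inl p) = some j →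
      G.head (Sum.inl q) = some j' → c j = c j') →
    ∀ i ∈ G.J, ∀ j ∈ G.J, c i = c j
  confined : ∀ C : ℤ, ∃ B : ℤ, ∀ x : L ⊕ Fin m → ℤ,
    (∀ j ∈ G.J, |incidenceForm G.head G.tail j ⬝ᵥ x| ≤ C) → (∀ k ∈ G.K, -C ≤ x k) →
    (∀ p ∈ A, |x (Sum.inl p)| ≤ C) → ∀ k ∈ G.K, |x k| ≤ B
  card_J : G.J.card = m + r
  card_edges : G.W.card + G.K.card + U.card = 3 * r

theorem incidence_dotProduct (G : FlowSystem L m) (j : L ⊕ Fin m) (x : L ⊕ Fin m → ℤ) :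
    incidenceForm G.head G.tail j ⬝ᵥ x =
      (∑ k with G.head k = some j, x k) - ∑ k with G.tail k = some j, x k := by
  simp only [dotProduct, incidenceForm, sub_mul, Finset.sum_sub_distrib, ite_mul, one_mul,
    zero_mul, Finset.sum_filter]

theorem summand_eq (G : FlowSystem L m) (x : L ⊕ Fin m → ℤ) :
    G.summand x = open Classical in
      if (∀ j ∈ G.J, incidenceForm G.head G.tail j ⬝ᵥ x = 0) ∧ ∀ k ∈ G.K, 0 < x k
      then ∏ k ∈ G.W, (x k : ℚ) else 0 := by
  classical
  have hiff : (∀ w ∈ G.rows, 0 < w ⬝ᵥ x) ↔ ∀ k ∈ G.K, 0 < x k := by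
    rw [rows, Finset.forall_mem_image]
    simp only [single_dotProduct, one_mul]
  by_cases h : (∀ j ∈ G.J, incidenceForm G.head G.tail j ⬝ᵥ x = 0) ∧ ∀ k ∈ G.K, 0 < x k
  · rw [if_pos h, summand, constrained, if_pos ⟨h.1, hiff.2 h.2⟩]
    simp [map_prod]
  · rw [if_neg h, summand, constrained, if_neg fun h' => h ⟨h'.1, hiff.1 h'.2⟩]

/-- The flow system with a new vertex, named by the label `s`, through which the loose strands in
`Q` are fed by the loose strands in `P`. -/
def addVertex (G : FlowSystem L m) (U P Q : Finset L) (s : L) : FlowSystem L m where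
  head k := if k ∈ P.image Sum.inl then some (Sum.inl s) else G.head k
  tail k := if k ∈ Q.image Sum.inl then some (Sum.inl s) else G.tail k
  K := G.K ∪ Q.image Sum.inl
  J := insert (Sum.inl s) G.J
  W := G.W ∪ (Q ∩ U).image Sum.inl

section AddVertex

variable {G : FlowSystem L m} {A U Z A' U' Z' P Q : Finset L} {b b' : L → L} {s : L} {r : ℕ}

/-- The combinatorial conditions for feeding the strands `Q` by the strands `P`: before, the loose
strands are `A` and the used labels `Z`; after, they are `A'` and `Z'`. -/
structure Feeds (A Z A' Z' P Q : Finset L) (b b' : L → L) (s : L) : Prop where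
  s_mem : s ∈ Q
  Q_subset : Q ⊆ A'
  A_eq : A = (A' \ Q) ∪ P
  P_disjoint : Disjoint P A'
  A_subset : A ⊆ Z
  Z_subset : Z ⊆ Z'
  Q_subset_Z' : Q ⊆ Z'
  Q_disjoint : Disjoint Q Z
  card : P.card + Q.card = 3
  blocks : ∀ h : L → ℚ, ∀ γ, (∀ p ∈ P, h p = γ) → (∀ q ∈ Q, h q = γ) →
    (∀ a ∈ A, ∀ a' ∈ A, b a = b a' → h a = h a') → ∀ a ∈ A', ∀ a' ∈ A', b' a = b' a' → h a = h a'

omit [Fintype L] in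
theorem Feeds.P_subset (hF : Feeds A Z A' Z' P Q b b' s) : P ⊆ A := by
  rw [hF.A_eq]; exact Finset.subset_union_right

theorem incidenceForm_addVertex (hF : Feeds A Z A' Z' P Q b b' s) (hG : G.Valid A' U' b' Z' r)
    {j : L ⊕ Fin m} (hj : j ∈ G.J) :
    incidenceForm (G.addVertex U' P Q s).head (G.addVertex U' P Q s).tail j
      = incidenceForm G.head G.tail j := by
  have hsJ : Sum.inl s ∉ G.J := (hG.avoid s (hF.Q_subset_Z' hF.s_mem)).2
  have hjs : ¬ (some (Sum.inl s) = some j) := fun h => hsJ (by rwa [Option.some_inj.1 h])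
  ext k
  have h1 : (G.addVertex U' P Q s).head k = some j ↔ G.head k = some j := by
    by_cases hk : k ∈ P.image Sum.inl
    · have e : (G.addVertex U' P Q s).head k = some (Sum.inl s) := if_pos hk
      obtain ⟨p, hp, rfl⟩ := Finset.mem_image.1 hk
      have hpA' : p ∉ A' := Finset.disjoint_left.1 hF.P_disjoint hp
      have hpK := (hG.avoid p (hF.Z_subset (hF.A_subset (hF.P_subset hp)))).1
      rw [e, (hG.other p hpA' hpK).1]
      simp [hjs]
    · have e : (G.addVertex U' P Q s).head k = G.head k := if_neg hk
      rw [e]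
  have h2 : (G.addVertex U' P Q s).tail k = some j ↔ G.tail k = some j := by
    by_cases hk : k ∈ Q.image Sum.inl
    · have e : (G.addVertex U' P Q s).tail k = some (Sum.inl s) := if_pos hk
      obtain ⟨q, hq, rfl⟩ := Finset.mem_image.1 hk
      rw [e, hG.tail_A q (hF.Q_subset hq)]
      simp [hjs]
    · have e : (G.addVertex U' P Q s).tail k = G.tail k := if_neg hk
      rw [e]
  simp only [incidenceForm, h1, h2]

theorem Valid.head_ne (hG : G.Valid A' U' b' Z' r) {l : L} (hl : Sum.inl l ∉ G.J)
    (k : L ⊕ Fin m) : G.head k ≠ some (Sum.inl l) := by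
  intro h
  rcases k with a | i
  · by_cases ha : a ∈ A'
    · obtain ⟨j, hj, hh⟩ := hG.head_A a ha
      rw [hh, Option.some_inj] at h
      exact hl (h ▸ hj)
    · by_cases hk : Sum.inl a ∈ G.K
      · obtain ⟨j, hj, hh⟩ := hG.head_K _ hk
        rw [hh, Option.some_inj] at h
        exact hl (h ▸ hj)
      · rw [(hG.other a ha hk).1] at h
        simp at h
  · rw [hG.head_inr] at h
    simp at h

theorem Valid.tail_ne (hG : G.Valid A' U' b' Z' r) {l : L} (hl : Sum.inl l ∉ G.J)
    (k : L ⊕ Fin m) : G.tail k ≠ some (Sum.inl l) := by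
  intro h
  rcases k with a | i
  · by_cases hk : Sum.inl a ∈ G.K
    · obtain ⟨j, hj, hh⟩ := hG.tail_K _ hk
      rw [hh, Option.some_inj] at h
      exact hl (h ▸ hj)
    · by_cases ha : a ∈ A'
      · rw [hG.tail_A a ha] at h
        simp at h
      · rw [(hG.other a ha hk).2] at h
        simp at h
  · rw [hG.tail_inr] at h
    simp at h

theorem incidence_addVertex_self (hF : Feeds A Z A' Z' P Q b b' s)
    (hG : G.Valid A' U' b' Z' r) (x : L ⊕ Fin m → ℤ) :
    incidenceForm (G.addVertex U' P Q s).head (G.addVertex U' P Q s).tail (Sum.inl s) ⬝ᵥ x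
      = ∑ p ∈ P, x (Sum.inl p) - ∑ q ∈ Q, x (Sum.inl q) := by
  have hsJ : Sum.inl s ∉ G.J := (hG.avoid s (hF.Q_subset_Z' hF.s_mem)).2
  rw [incidence_dotProduct]
  congr 1
  · have : (Finset.univ.filter fun k => (G.addVertex U' P Q s).head k = some (Sum.inl s))
        = P.image Sum.inl := by
      ext k
      by_cases hk : k ∈ P.image Sum.inl
      · have e : (G.addVertex U' P Q s).head k = some (Sum.inl s) := if_pos hk
        exact iff_of_true (Finset.mem_filter.2 ⟨Finset.mem_univ _, e⟩) hk
      · have e : (G.addVertex U' P Q s).head k = G.head k := if_neg hk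
        refine iff_of_false (fun h => ?_) hk
        exact hG.head_ne hsJ k (e ▸ (Finset.mem_filter.1 h).2)
    rw [this, Finset.sum_image fun a _ b _ h => Sum.inl_injective h]
  · have : (Finset.univ.filter fun k => (G.addVertex U' P Q s).tail k = some (Sum.inl s))
        = Q.image Sum.inl := by
      ext k
      by_cases hk : k ∈ Q.image Sum.inl
      · have e : (G.addVertex U' P Q s).tail k = some (Sum.inl s) := if_pos hk
        exact iff_of_true (Finset.mem_filter.2 ⟨Finset.mem_univ _, e⟩) hk
      · have e : (G.addVertex U' P Q s).tail k = G.tail k := if_neg hk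
        refine iff_of_false (fun h => ?_) hk
        exact hG.tail_ne hsJ k (e ▸ (Finset.mem_filter.1 h).2)
    rw [this, Finset.sum_image fun a _ b _ h => Sum.inl_injective h]

/-- The new vertex contributes the conservation of flow there and the weights of those edges out of
it that are used later. -/
theorem summand_addVertex (hF : Feeds A Z A' Z' P Q b b' s) (hG : G.Valid A' U' b' Z' r)
    (x : L ⊕ Fin m → ℤ) :
    (G.addVertex U' P Q s).summand x = open Classical in
      if ∑ p ∈ P, x (Sum.inl p) = ∑ q ∈ Q, x (Sum.inl q) ∧ ∀ q ∈ Q, 0 < x (Sum.inl q) then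
        (∏ q ∈ Q ∩ U', (x (Sum.inl q) : ℚ)) * G.summand x else 0 := by
  classical
  rw [summand_eq, summand_eq]
  have h1 : (∀ j ∈ (G.addVertex U' P Q s).J, incidenceForm (G.addVertex U' P Q s).head
      (G.addVertex U' P Q s).tail j ⬝ᵥ x = 0) ↔
      ∑ p ∈ P, x (Sum.inl p) = ∑ q ∈ Q, x (Sum.inl q) ∧
        ∀ j ∈ G.J, incidenceForm G.head G.tail j ⬝ᵥ x = 0 := by
    have : (G.addVertex U' P Q s).J = insert (Sum.inl s) G.J := rfl
    rw [this, Finset.forall_mem_insert, incidence_addVertex_self hF hG, sub_eq_zero]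
    refine and_congr_right fun _ => forall₂_congr fun j hj => ?_
    rw [incidenceForm_addVertex hF hG hj]
  have h2 : (∀ k ∈ (G.addVertex U' P Q s).K, 0 < x k) ↔
      (∀ k ∈ G.K, 0 < x k) ∧ ∀ q ∈ Q, 0 < x (Sum.inl q) := by
    simp only [addVertex, Finset.mem_union, Finset.mem_image]
    constructor
    · exact fun h => ⟨fun k hk => h k (Or.inl hk), fun q hq => h _ (Or.inr ⟨q, hq, rfl⟩)⟩
    · rintro ⟨ha, hb⟩ k (hk | ⟨q, hq, rfl⟩)
      · exact ha k hk
      · exact hb q hq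
  have h3 : ∏ k ∈ (G.addVertex U' P Q s).W, (x k : ℚ) =
      (∏ q ∈ Q ∩ U', (x (Sum.inl q) : ℚ)) * ∏ k ∈ G.W, (x k : ℚ) := by
    simp only [addVertex]
    rw [Finset.prod_union, mul_comm, Finset.prod_image fun a _ b _ h => Sum.inl_injective h]
    rw [Finset.disjoint_left]
    rintro k hk hk'
    obtain ⟨q, hq, rfl⟩ := Finset.mem_image.1 hk'
    exact (hG.avoid q (hF.Q_subset_Z' (Finset.mem_inter.1 hq).1)).1 (hG.W_subset hk)
  rw [h3]
  by_cases hnew : ∑ p ∈ P, x (Sum.inl p) = ∑ q ∈ Q, x (Sum.inl q) ∧ ∀ q ∈ Q, 0 < x (Sum.inl q)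
  · rw [if_pos hnew]
    by_cases hold : (∀ j ∈ G.J, incidenceForm G.head G.tail j ⬝ᵥ x = 0) ∧ ∀ k ∈ G.K, 0 < x k
    · rw [if_pos hold, if_pos ⟨h1.2 ⟨hnew.1, hold.1⟩, h2.2 ⟨hold.2, hnew.2⟩⟩]
    · rw [if_neg hold, mul_zero, if_neg fun h => hold ⟨(h1.1 h.1).2, (h2.1 h.2).1⟩]
  · rw [if_neg hnew, if_neg fun h => hnew ⟨(h1.1 h.1).1, (h2.1 h.2).2⟩]

omit [Fintype L] in
theorem Dangling.addVertex {k : L ⊕ Fin m} {i : Fin m} (hk : k ∉ P.image Sum.inl)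
    (h : G.Dangling k i) : (G.addVertex U' P Q s).Dangling k i := by
  obtain ⟨h1, h2, h3⟩ := h
  refine ⟨by simp only [FlowSystem.addVertex, if_neg hk, h1], fun k' hk' => ?_, fun k' hk' => ?_⟩
  · simp only [FlowSystem.addVertex] at hk'
    split_ifs at hk' with hp
    · simp at hk'
    · exact h2 k' hk'
  · simp only [FlowSystem.addVertex] at hk'
    split_ifs at hk' with hp
    · simp at hk'
    · exact h3 k' hk'

theorem Valid.addVertex (hF : Feeds A Z A' Z' P Q b b' s) (hG : G.Valid A' U' b' Z' r) :
    (G.addVertex U' P Q s).Valid A ((U' \ Q) ∪ P) b Z (r + 1) := by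
  have hsJ : Sum.inl s ∉ G.J := (hG.avoid s (hF.Q_subset_Z' hF.s_mem)).2
  have hQK : ∀ q ∈ Q, Sum.inl q ∉ G.K := fun q hq => (hG.avoid q (hF.Q_subset_Z' hq)).1
  have hQP : ∀ q ∈ Q, Sum.inl q ∉ P.image (Sum.inl : L → L ⊕ Fin m) := by
    intro q hq h
    obtain ⟨p, hp, h⟩ := Finset.mem_image.1 h
    rw [← Sum.inl_injective h] at hq
    exact Finset.disjoint_left.1 hF.P_disjoint hp (hF.Q_subset hq)
  have hPQ : ∀ p ∈ P, Sum.inl p ∉ Q.image (Sum.inl : L → L ⊕ Fin m) := by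
    intro p hp h
    obtain ⟨q, hq, h⟩ := Finset.mem_image.1 h
    rw [Sum.inl_injective h] at hq
    exact Finset.disjoint_left.1 hF.P_disjoint hp (hF.Q_subset hq)
  have hKP : ∀ k ∈ G.K, k ∉ P.image (Sum.inl : L → L ⊕ Fin m) := by
    intro k hk h
    obtain ⟨p, hp, rfl⟩ := Finset.mem_image.1 h
    exact (hG.avoid p (hF.Z_subset (hF.A_subset (hF.P_subset hp)))).1 hk
  have hKQ : ∀ k ∈ G.K, k ∉ Q.image (Sum.inl : L → L ⊕ Fin m) := by
    intro k hk h
    obtain ⟨p, hp, rfl⟩ := Finset.mem_image.1 h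
    exact hQK p hp hk
  have hAcases : ∀ a ∈ A, a ∈ P ∨ (a ∈ A' ∧ a ∉ Q ∧ a ∉ P) := by
    intro a ha
    rw [hF.A_eq, Finset.mem_union, Finset.mem_sdiff] at ha
    by_cases haP : a ∈ P
    · exact Or.inl haP
    · exact Or.inr ⟨(ha.resolve_right haP).1, (ha.resolve_right haP).2, haP⟩
  have hnotimg : ∀ (T : Finset L) (a : L), a ∉ T → Sum.inl a ∉ T.image (Sum.inl : L → L ⊕ Fin m) :=
    fun T a ha h => by
      obtain ⟨t, ht, h⟩ := Finset.mem_image.1 h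
      exact ha (Sum.inl_injective h ▸ ht)
  refine
    { avoid := fun l hl => ⟨fun h => ?_, fun h => ?_⟩
      inr_notMem := fun i h => ?_
      head_K := fun k hk => ?_
      tail_K := fun k hk => ?_
      head_A := fun p hp => ?_
      tail_A := fun p hp => ?_
      head_inr := fun i => ?_
      tail_inr := fun i => ?_
      inr_mem := fun i => Finset.mem_insert_of_mem (hG.inr_mem i)
      other := fun l hl hlK => ?_
      W_subset := ?_
      U_subset := ?_
      unweighted := fun k hk hkW => ?_
      unused := fun p hp hpU => ?_
      connected := fun c hc hb => ?_
      confined := fun C => ?_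
      card_J := ?_
      card_edges := ?_ }
  · rcases Finset.mem_union.1 h with h | h
    · exact (hG.avoid l (hF.Z_subset hl)).1 h
    · obtain ⟨q, hq, h⟩ := Finset.mem_image.1 h
      exact Finset.disjoint_left.1 hF.Q_disjoint hq (Sum.inl_injective h ▸ hl)
  · rcases Finset.mem_insert.1 h with h | h
    · exact Finset.disjoint_left.1 hF.Q_disjoint hF.s_mem (Sum.inl_injective h ▸ hl)
    · exact (hG.avoid l (hF.Z_subset hl)).2 h
  · rcases Finset.mem_union.1 h with h | h
    · exact hG.inr_notMem i h
    · obtain ⟨q, hq, h⟩ := Finset.mem_image.1 h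
      simp at h
  · rcases Finset.mem_union.1 hk with h | h
    · obtain ⟨j, hj, hh⟩ := hG.head_K k h
      exact ⟨j, Finset.mem_insert_of_mem hj, by simp only [FlowSystem.addVertex, if_neg (hKP k h), hh]⟩
    · obtain ⟨q, hq, rfl⟩ := Finset.mem_image.1 h
      obtain ⟨j, hj, hh⟩ := hG.head_A q (hF.Q_subset hq)
      exact ⟨j, Finset.mem_insert_of_mem hj, by simp only [FlowSystem.addVertex, if_neg (hQP q hq), hh]⟩
  · rcases Finset.mem_union.1 hk with h | h
    · obtain ⟨j, hj, hh⟩ := hG.tail_K k h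
      exact ⟨j, Finset.mem_insert_of_mem hj, by simp only [FlowSystem.addVertex, if_neg (hKQ k h), hh]⟩
    · exact ⟨_, Finset.mem_insert_self _ _, by simp only [FlowSystem.addVertex, if_pos h]⟩
  · rcases hAcases p hp with h | ⟨h1, h2, h3⟩
    · exact ⟨_, Finset.mem_insert_self _ _, by
        simp only [FlowSystem.addVertex, if_pos (Finset.mem_image_of_mem _ h)]⟩
    · obtain ⟨j, hj, hh⟩ := hG.head_A p h1
      exact ⟨j, Finset.mem_insert_of_mem hj, by
        simp only [FlowSystem.addVertex, if_neg (hnotimg P p h3), hh]⟩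
  · rcases hAcases p hp with h | ⟨h1, h2, h3⟩
    · simp only [FlowSystem.addVertex, if_neg (hPQ p h)]
      exact (hG.other p (Finset.disjoint_left.1 hF.P_disjoint h)
        (hG.avoid p (hF.Z_subset (hF.A_subset hp))).1).2
    · simp only [FlowSystem.addVertex, if_neg (hnotimg Q p h2)]
      exact hG.tail_A p h1
  · simp [FlowSystem.addVertex, hG.head_inr]
  · simp [FlowSystem.addVertex, hG.tail_inr]
  · have hlP : l ∉ P := fun h => hl (hF.P_subset h)
    have hlQ : l ∉ Q := fun h => hlK (Finset.mem_union_right _ (Finset.mem_image_of_mem _ h))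
    have hlA' : l ∉ A' := fun h => hl (by
      rw [hF.A_eq]; exact Finset.mem_union_left _ (Finset.mem_sdiff.2 ⟨h, hlQ⟩))
    simp only [FlowSystem.addVertex, if_neg (hnotimg Q l hlQ), if_neg (hnotimg P l hlP)]
    exact hG.other l hlA' fun h => hlK (Finset.mem_union_left _ h)
  · exact Finset.union_subset_union hG.W_subset (Finset.image_subset_image Finset.inter_subset_left)
  · rw [hF.A_eq]
    exact Finset.union_subset_union (Finset.sdiff_subset_sdiff hG.U_subset le_rfl) le_rfl
  · rcases Finset.mem_union.1 hk with h | h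
    · obtain ⟨i, hi⟩ := hG.unweighted k h fun h' => hkW (Finset.mem_union_left _ h')
      exact ⟨i, Dangling.addVertex (hKP k h) hi⟩
    · obtain ⟨q, hq, rfl⟩ := Finset.mem_image.1 h
      obtain ⟨i, hi⟩ := hG.unused q (hF.Q_subset hq) fun h' => hkW (Finset.mem_union_right _
        (Finset.mem_image_of_mem _ (Finset.mem_inter.2 ⟨hq, h'⟩)))
      exact ⟨i, Dangling.addVertex (hQP q hq) hi⟩
  · rcases hAcases p hp with h | ⟨h1, h2, h3⟩
    · exact absurd (Finset.mem_union_right _ h) hpU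
    · obtain ⟨i, hi⟩ := hG.unused p h1 fun h' => hpU (Finset.mem_union_left _
        (Finset.mem_sdiff.2 ⟨h', h2⟩))
      exact ⟨i, Dangling.addVertex (hnotimg P p h3) hi⟩
  · -- connectedness
    have hQhead : ∀ q ∈ Q, ∀ j, G.head (Sum.inl q) = some j → c j = c (Sum.inl s) := by
      intro q hq j hj
      have hqi : Sum.inl q ∈ Q.image (Sum.inl : L → L ⊕ Fin m) := Finset.mem_image_of_mem _ hq
      refine hc (Sum.inl q) (Finset.mem_union_right _ hqi) _ _ ?_ ?_
      · simp only [FlowSystem.addVertex, if_neg (hQP q hq), hj]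
      · simp only [FlowSystem.addVertex, if_pos hqi]
    let h : L → ℚ := fun a => if a ∈ P then c (Sum.inl s) else
      (G.head (Sum.inl a)).elim 0 c
    have hval : ∀ a, a ∉ P → ∀ j, G.head (Sum.inl a) = some j → h a = c j := by
      intro a ha j hj
      simp [h, ha, hj]
    have hA'P : ∀ a ∈ A', a ∉ P := fun a ha hP => Finset.disjoint_left.1 hF.P_disjoint hP ha
    have hold := hG.connected c (fun k hk j j' hj hj' => hc k (Finset.mem_union_left _ hk) j j'
        (by simp only [FlowSystem.addVertex, if_neg (hKP k hk), hj])
        (by simp only [FlowSystem.addVertex, if_neg (hKQ k hk), hj']))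
      (fun a ha a' ha' hbb j j' hj hj' => by
        rw [← hval a (hA'P a ha) j hj, ← hval a' (hA'P a' ha') j' hj']
        refine hF.blocks h (c (Sum.inl s)) (fun p hp => by simp [h, hp]) (fun q hq => ?_)
          (fun e he e' he' hee => ?_) a ha a' ha' hbb
        · obtain ⟨j, hj, hh⟩ := hG.head_A q (hF.Q_subset hq)
          rw [hval q (hA'P q (hF.Q_subset hq)) j hh, hQhead q hq j hh]
        · have hnew : ∀ e ∈ A, ∃ j, (G.addVertex U' P Q s).head (Sum.inl e) = some j
              ∧ h e = c j := by
            intro e he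
            rcases hAcases e he with hP | ⟨h1, h2, h3⟩
            · exact ⟨Sum.inl s, by simp only [FlowSystem.addVertex,
                if_pos (Finset.mem_image_of_mem _ hP)], by simp [h, hP]⟩
            · obtain ⟨j, hj, hh⟩ := hG.head_A e h1
              exact ⟨j, by simp only [FlowSystem.addVertex, if_neg (hnotimg P e h3), hh],
                hval e h3 j hh⟩
          obtain ⟨j, hj, hje⟩ := hnew e he
          obtain ⟨j', hj', hje'⟩ := hnew e' he'
          rw [hje, hje']
          exact hb e he e' he' hee j j' hj hj')
    obtain ⟨j₀, hj₀, hh₀⟩ := hG.head_A s (hF.Q_subset hF.s_mem)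
    have hs₀ := hQhead s hF.s_mem j₀ hh₀
    have hall : ∀ i ∈ (G.addVertex U' P Q s).J, c i = c j₀ := by
      intro i hi
      rcases Finset.mem_insert.1 hi with rfl | hi
      · exact hs₀.symm
      · exact hold i hi j₀ hj₀
    exact fun i hi j hj => (hall i hi).trans (hall j hj).symm
  · -- boundedness
    obtain ⟨B, hB⟩ := hG.confined (3 * |C|)
    refine ⟨max B (3 * |C|), fun x hx1 hx2 hx3 => ?_⟩
    have hC0 : C ≤ |C| := le_abs_self C
    have hQb : ∀ q ∈ Q, |x (Sum.inl q)| ≤ 3 * |C| := by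
      intro q hq
      have h1 := hx1 (Sum.inl s) (Finset.mem_insert_self _ _)
      rw [incidence_addVertex_self hF hG] at h1
      have h2 : ∀ q ∈ Q, -|C| ≤ x (Sum.inl q) := fun q hq => by
        have := hx2 (Sum.inl q) (Finset.mem_union_right _ (Finset.mem_image_of_mem _ hq))
        omega
      have h3 : ∑ p ∈ P, x (Sum.inl p) ≤ P.card * |C| := by
        rw [← nsmul_eq_mul]
        refine Finset.sum_le_card_nsmul _ _ _ fun p hp => ?_
        have := hx3 p (hF.P_subset hp)
        exact (le_abs_self _).trans (this.trans hC0)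
      have h4 : ((Q.erase q).card : ℤ) * -|C| ≤ ∑ q' ∈ Q.erase q, x (Sum.inl q') := by
        rw [← nsmul_eq_mul]
        exact Finset.card_nsmul_le_sum _ _ _ fun q' hq' => h2 q' (Finset.mem_of_mem_erase hq')
      have h5 := Finset.add_sum_erase Q (fun q => x (Sum.inl q)) hq
      have h6 : ((Q.erase q).card : ℤ) + 1 = Q.card := by
        exact_mod_cast Finset.card_erase_add_one hq
      have h7 : (P.card : ℤ) + Q.card = 3 := by exact_mod_cast hF.card
      have h8 := (abs_le.1 h1).1
      have h9 : (P.card : ℤ) * |C| = 3 * |C| - Q.card * |C| := by rw [← h7]; ring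
      have h10 : ((Q.erase q).card : ℤ) * -|C| = |C| - Q.card * |C| := by rw [← h6]; ring
      have h11 := h2 q hq
      have h12 := abs_nonneg C
      rw [abs_le]
      constructor <;> linarith
    intro k hk
    rcases Finset.mem_union.1 hk with hk | hk
    · refine (hB x (fun j hj => ?_) (fun k hk => ?_) (fun a ha => ?_) k hk).trans (le_max_left _ _)
      · have := hx1 j (Finset.mem_insert_of_mem hj)
        rw [incidenceForm_addVertex hF hG hj] at this
        have := abs_nonneg C
        linarith
      · have := hx2 k (Finset.mem_union_left _ hk)
        have := abs_nonneg C
        linarith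
      · by_cases haQ : a ∈ Q
        · exact hQb a haQ
        · have := hx3 a (by
            rw [hF.A_eq]; exact Finset.mem_union_left _ (Finset.mem_sdiff.2 ⟨ha, haQ⟩))
          have := abs_nonneg C
          linarith
    · obtain ⟨q, hq, rfl⟩ := Finset.mem_image.1 hk
      exact (hQb q hq).trans (le_max_right _ _)
  · have : (G.addVertex U' P Q s).J = insert (Sum.inl s) G.J := rfl
    rw [this, Finset.card_insert_of_notMem hsJ, hG.card_J]
    ring
  · have h1 : (G.addVertex U' P Q s).W.card = G.W.card + (Q ∩ U').card := by
      simp only [FlowSystem.addVertex]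
      rw [Finset.card_union_of_disjoint, Finset.card_image_of_injective _ Sum.inl_injective]
      rw [Finset.disjoint_left]
      rintro k hk hk'
      obtain ⟨q, hq, rfl⟩ := Finset.mem_image.1 hk'
      exact hQK q (Finset.mem_inter.1 hq).1 (hG.W_subset hk)
    have h2 : (G.addVertex U' P Q s).K.card = G.K.card + Q.card := by
      simp only [FlowSystem.addVertex]
      rw [Finset.card_union_of_disjoint, Finset.card_image_of_injective _ Sum.inl_injective]
      rw [Finset.disjoint_left]
      exact fun k hk hk' => hKQ k hk hk'
    have h3 : (U' \ Q ∪ P).card = (U' \ Q).card + P.card := by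
      rw [Finset.card_union_of_disjoint]
      rw [Finset.disjoint_left]
      exact fun a ha haP => Finset.disjoint_left.1 hF.P_disjoint haP
        (hG.U_subset (Finset.mem_sdiff.1 ha).1)
    have h4 : (U' \ Q).card + (Q ∩ U').card = U'.card := by
      rw [Finset.inter_comm, Finset.card_sdiff_add_card_inter]
    have h5 := hF.card
    have h6 := hG.card_edges
    rw [h1, h2, h3]
    omega

end AddVertex

end FlowSystem

/-! ### Weighted completions of a partial monodromy graph -/

section Completions

variable {L : Type*} [DecidableEq L] {m : ℕ}

/-- The block names after the strands `p` and `q` are joined to the new strand `s`. -/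
def joinBlocks (b : L → L) (p q s : L) : L → L :=
  fun x => if Function.update b s (b p) x = b q then b p else Function.update b s (b p) x

/-- The block names after the strand `p` is cut into the new strands `s` and `s'`. -/
def cutBlocks (b : L → L) (p s s' : L) : L → L :=
  Function.update (Function.update b s (b p)) s' (b p)

/-- The matching `e` of end labels with strands uses each strand of `A` once, and all strands lie
in one block. -/
def IsMatching (A : Finset L) (b : L → L) (e : Fin m → L) : Prop :=
  Function.Injective e ∧ Finset.univ.image e = A ∧ ∀ i j, b (e i) = b (e j)

/-- The weighted number of ways to get from strands of lengths `ℓ p`, `p ∈ A`, to strands of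
lengths `α` by one operation for each pair in the list of new labels. Joining the strands `p` and
`q` has weight `ℓ p * ℓ q`, cutting the strand `p` has weight `ℓ p`, and the factor `1 / 2` accounts
for the order of `p` and `q`, or of the two parts. These are the numbers of transpositions that
join two given cycles of a permutation, or cut a cycle into parts of given lengths. The function `b`
names blocks of strands; all of them have to be connected in the end. -/
noncomputable def completions (α : Fin m → ℕ) :
    List (L × L) → Finset L → (L → L) → (L → ℕ) → ℚ
  | [], A, b, ℓ => open Classical in
      (Nat.card {e : Fin m → L // IsMatching A b e ∧ ∀ i, ℓ (e i) = α i} : ℚ)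
  | (s, s') :: fr, A, b, ℓ =>
      1 / 2 * ((∑ p ∈ A, ∑ q ∈ A.erase p, (ℓ p : ℚ) * ℓ q *
        completions α fr (insert s ((A.erase p).erase q)) (joinBlocks b p q s)
          (Function.update ℓ s (ℓ p + ℓ q))) +
      ∑ p ∈ A, ∑ k ∈ Finset.Ico 1 (ℓ p), (ℓ p : ℚ) *
        completions α fr (insert s (insert s' (A.erase p))) (cutBlocks b p s s')
          (Function.update (Function.update ℓ s k) s' (ℓ p - k)))

/-- The new labels in the list are distinct, and not in `Z`. -/
def Fresh : List (L × L) → Finset L → Prop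
  | [], _ => True
  | (s, s') :: fr, Z => s ∉ Z ∧ s' ∉ Z ∧ s ≠ s' ∧ Fresh fr (insert s (insert s' Z))

namespace FlowSystem

theorem feeds_join {A Z : Finset L} {b : L → L} {p q s s' : L} (hp : p ∈ A) (hq : q ∈ A.erase p)
    (hAZ : A ⊆ Z) (hs : s ∉ Z) :
    Feeds A Z (insert s ((A.erase p).erase q)) (insert s (insert s' Z)) {p, q} {s} b
      (joinBlocks b p q s) s := by
  have hqA := Finset.mem_of_mem_erase hq
  have hqp := Finset.ne_of_mem_erase hq
  have hsA : s ∉ A := fun h => hs (hAZ h)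
  have hsp : s ≠ p := fun h => hsA (h ▸ hp)
  have hsq : s ≠ q := fun h => hsA (h ▸ hqA)
  refine
    { s_mem := by simp
      Q_subset := by simp
      A_eq := ?_
      P_disjoint := ?_
      A_subset := hAZ
      Z_subset := fun x hx => by simp [hx]
      Q_subset_Z' := by simp
      Q_disjoint := by simpa using hs
      card := by rw [Finset.card_pair hqp.symm]; rfl
      blocks := ?_ }
  · ext x
    simp only [Finset.mem_union, Finset.mem_sdiff, Finset.mem_insert, Finset.mem_erase,
      Finset.mem_singleton]
    constructor
    · intro hx
      have : x ≠ s := fun h => hsA (h ▸ hx)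
      tauto
    · rintro (⟨rfl | h, h'⟩ | rfl | rfl)
      · exact absurd rfl h'
      · exact h.2.2
      · exact hp
      · exact hqA
  · rw [Finset.disjoint_left]
    intro x hx
    simp only [Finset.mem_insert, Finset.mem_singleton] at hx
    rcases hx with rfl | rfl
    · simp [hsp.symm]
    · simp [hsq.symm]
  · intro h γ hP hQ hb a ha a' ha' hbb
    have hrep : ∀ a ∈ insert s ((A.erase p).erase q), ∃ c ∈ A, h c = h a ∧
        Function.update b s (b p) a = b c := by
      intro a ha
      rcases Finset.mem_insert.1 ha with rfl | ha
      · exact ⟨p, hp, by rw [hP p (by simp), hQ a (by simp)], by simp⟩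
      · have haA := Finset.mem_of_mem_erase (Finset.mem_of_mem_erase ha)
        have : a ≠ s := fun h => hsA (h ▸ haA)
        exact ⟨a, haA, rfl, by simp [this]⟩
    obtain ⟨c, hc, hca, hcb⟩ := hrep a ha
    obtain ⟨c', hc', hca', hcb'⟩ := hrep a' ha'
    rw [← hca, ← hca']
    simp only [joinBlocks, hcb, hcb'] at hbb
    have hpγ : ∀ c ∈ A, b c = b p → h c = γ := fun c hc h' => by
      rw [hb c hc p hp h', hP p (by simp)]
    have hqγ : ∀ c ∈ A, b c = b q → h c = γ := fun c hc h' => by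
      rw [hb c hc q hqA h', hP q (by simp)]
    split_ifs at hbb with h1 h2 h2
    · rw [hqγ c hc h1, hqγ c' hc' h2]
    · rw [hqγ c hc h1, hpγ c' hc' hbb.symm]
    · rw [hpγ c hc hbb, hqγ c' hc' h2]
    · exact hb c hc c' hc' hbb

theorem feeds_cut {A Z : Finset L} {b : L → L} {p s s' : L} (hp : p ∈ A)
    (hAZ : A ⊆ Z) (hs : s ∉ Z) (hs' : s' ∉ Z) (hss : s ≠ s') :
    Feeds A Z (insert s (insert s' (A.erase p))) (insert s (insert s' Z)) {p} {s, s'} b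
      (cutBlocks b p s s') s := by
  have hsA : s ∉ A := fun h => hs (hAZ h)
  have hsA' : s' ∉ A := fun h => hs' (hAZ h)
  have hsp : s ≠ p := fun h => hsA (h ▸ hp)
  have hsp' : s' ≠ p := fun h => hsA' (h ▸ hp)
  refine
    { s_mem := by simp
      Q_subset := by intro x; simp; tauto
      A_eq := ?_
      P_disjoint := by simp [hsp.symm, hsp'.symm]
      A_subset := hAZ
      Z_subset := fun x hx => by simp [hx]
      Q_subset_Z' := by intro x; simp; tauto
      Q_disjoint := by simp [hs, hs']
      card := by rw [Finset.card_pair hss]; rfl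
      blocks := ?_ }
  · ext x
    simp only [Finset.mem_union, Finset.mem_sdiff, Finset.mem_insert, Finset.mem_erase,
      Finset.mem_singleton]
    constructor
    · intro hx
      have : x ≠ s := fun h => hsA (h ▸ hx)
      have : x ≠ s' := fun h => hsA' (h ▸ hx)
      tauto
    · rintro (⟨rfl | rfl | h, h'⟩ | rfl)
      · simp at h'
      · simp at h'
      · exact h.2
      · exact hp
  · intro h γ hP hQ hb a ha a' ha' hbb
    have hrep : ∀ a ∈ insert s (insert s' (A.erase p)), ∃ c ∈ A, h c = h a ∧
        cutBlocks b p s s' a = b c := by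
      intro a ha
      rcases Finset.mem_insert.1 ha with rfl | ha
      · exact ⟨p, hp, by rw [hP p (by simp), hQ a (by simp)], by simp [cutBlocks, hss]⟩
      rcases Finset.mem_insert.1 ha with rfl | ha
      · exact ⟨p, hp, by rw [hP p (by simp), hQ a (by simp)], by simp [cutBlocks]⟩
      · have haA := Finset.mem_of_mem_erase ha
        have h1 : a ≠ s := fun h => hsA (h ▸ haA)
        have h2 : a ≠ s' := fun h => hsA' (h ▸ haA)
        exact ⟨a, haA, rfl, by simp [cutBlocks, h1, h2]⟩
    obtain ⟨c, hc, hca, hcb⟩ := hrep a ha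
    obtain ⟨c', hc', hca', hcb'⟩ := hrep a' ha'
    rw [← hca, ← hca']
    exact hb c hc c' hc' (by rw [← hcb, ← hcb', hbb])

variable [Fintype L] {G : FlowSystem L m} {A U Z A' U' Z' P Q : Finset L} {b b' : L → L} {s s' : L}
  {r : ℕ}

theorem Valid.finiteOnSlices (hG : G.Valid A U b Z r) (hAZ : A ⊆ Z) :
    FiniteOnSlices G.K G.summand := by
  classical
  intro z
  obtain ⟨B, hB⟩ := hG.confined (∑ p ∈ A, |z (Sum.inl p)|)
  have h0 : 0 ≤ ∑ p ∈ A, |z (Sum.inl p)| := Finset.sum_nonneg fun _ _ => abs_nonneg _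
  refine (finite_slice_box G.K z B).subset fun x hx => ⟨hx.1, ?_⟩
  have hx2 := hx.2
  rw [Function.mem_support, summand_eq] at hx2
  have hcond : (∀ j ∈ G.J, incidenceForm G.head G.tail j ⬝ᵥ x = 0) ∧ ∀ k ∈ G.K, 0 < x k := by
    by_contra hn
    exact hx2 (if_neg hn)
  refine hB x (fun j hj => by rw [hcond.1 j hj]; simpa using h0) (fun k hk => ?_) fun p hp => ?_
  · have := hcond.2 k hk
    omega
  · rw [hx.1 (Sum.inl p) (hG.avoid p (hAZ hp)).1]
    exact Finset.single_le_sum (f := fun p => |z (Sum.inl p)|) (fun _ _ => abs_nonneg _) hp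

theorem sumOver_summand_addVertex (hF : Feeds A Z A' Z' P Q b b' s)
    (hG : G.Valid A' U' b' Z' r) (z : L ⊕ Fin m → ℤ) :
    sumOver G.K (G.addVertex U' P Q s).summand z = open Classical in
      if ∑ p ∈ P, z (Sum.inl p) = ∑ q ∈ Q, z (Sum.inl q) ∧ ∀ q ∈ Q, 0 < z (Sum.inl q) then
        (∏ q ∈ Q ∩ U', (z (Sum.inl q) : ℚ)) * G.value z else 0 := by
  classical
  have hQ : ∀ x ∈ slice G.K z, ∀ q ∈ Q, x (Sum.inl q) = z (Sum.inl q) := fun x hx q hq =>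
    hx _ (hG.avoid q (hF.Q_subset_Z' hq)).1
  have hP : ∀ x ∈ slice G.K z, ∀ p ∈ P, x (Sum.inl p) = z (Sum.inl p) := fun x hx p hp =>
    hx _ (hG.avoid p (hF.Z_subset (hF.A_subset (hF.P_subset hp)))).1
  have hiff : ∀ x ∈ slice G.K z, (∑ p ∈ P, x (Sum.inl p) = ∑ q ∈ Q, x (Sum.inl q) ∧
      ∀ q ∈ Q, 0 < x (Sum.inl q)) ↔ (∑ p ∈ P, z (Sum.inl p) = ∑ q ∈ Q, z (Sum.inl q) ∧
      ∀ q ∈ Q, 0 < z (Sum.inl q)) := by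
    intro x hx
    rw [Finset.sum_congr rfl (hP x hx), Finset.sum_congr rfl (hQ x hx)]
    refine and_congr_right fun _ => forall₂_congr fun q hq => by rw [hQ x hx q hq]
  by_cases h : ∑ p ∈ P, z (Sum.inl p) = ∑ q ∈ Q, z (Sum.inl q) ∧ ∀ q ∈ Q, 0 < z (Sum.inl q)
  · rw [if_pos h, value, ← sumOver_const_mul]
    refine sumOver_congr fun x hx => ?_
    rw [summand_addVertex hF hG, if_pos ((hiff x hx).2 h)]
    congr 1
    exact Finset.prod_congr rfl fun q hq => by rw [hQ x hx q (Finset.mem_inter.1 hq).1]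
  · rw [if_neg h]
    refine sumOver_zero fun x hx => ?_
    rw [summand_addVertex hF hG, if_neg fun h' => h ((hiff x hx).1 h')]

/-- The value of a flow system, weighted by the flows on those outer edges that are used. -/
noncomputable def weightedValue (G : FlowSystem L m) (U : Finset L) (z : L ⊕ Fin m → ℤ) : ℚ :=
  (∏ p ∈ U, (z (Sum.inl p) : ℚ)) * G.value z

omit [Fintype L] in
/-- The weights of the strands in `Q` pass from loose strands to internal edges. -/
theorem prod_weights (hF : Feeds A Z A' Z' P Q b b' s) (hU : U' ⊆ A') {z z' : L ⊕ Fin m → ℤ}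
    (hz : ∀ l, l ∉ Q → z' (Sum.inl l) = z (Sum.inl l)) :
    (∏ p ∈ P, (z (Sum.inl p) : ℚ)) * ∏ p ∈ U', (z' (Sum.inl p) : ℚ) =
      (∏ p ∈ (U' \ Q) ∪ P, (z (Sum.inl p) : ℚ)) * ∏ q ∈ Q ∩ U', (z' (Sum.inl q) : ℚ) := by
  rw [Finset.prod_union, ← Finset.prod_inter_mul_prod_sdiff U' Q, Finset.inter_comm,
    Finset.prod_congr (s₁ := U' \ Q) rfl fun l hl => by rw [hz l (Finset.mem_sdiff.1 hl).2]]
  · ring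
  · rw [Finset.disjoint_left]
    exact fun a ha haP => Finset.disjoint_left.1 hF.P_disjoint haP (hU (Finset.mem_sdiff.1 ha).1)

/-- The vector of prescribed flows with values `ℓ` on the strands and `α` on the ends. -/
def toVec (ℓ : L → ℕ) (α : Fin m → ℕ) : L ⊕ Fin m → ℤ :=
  Sum.elim (fun l => (ℓ l : ℤ)) fun i => (α i : ℤ)

omit [Fintype L] in
theorem toVec_update (ℓ : L → ℕ) (α : Fin m → ℕ) (s : L) (a : ℕ) :
    toVec (Function.update ℓ s a) α = Function.update (toVec ℓ α) (Sum.inl s) (a : ℤ) := by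
  ext (l | i)
  · by_cases h : l = s
    · subst h; simp [toVec]
    · simp [toVec, h]
  · simp [toVec]

theorem weightedValue_join {p q : L} (hF : Feeds A Z A' Z' {p, q} {s} b b' s) (hpq : p ≠ q)
    (hG : G.Valid A' U' b' Z' r) (ℓ : L → ℕ) (α : Fin m → ℕ) (hp : 0 < ℓ p) :
    (ℓ p : ℚ) * ℓ q * G.weightedValue U' (toVec (Function.update ℓ s (ℓ p + ℓ q)) α) =
      (G.addVertex U' {p, q} {s} s).weightedValue ((U' \ {s}) ∪ {p, q}) (toVec ℓ α) := by
  classical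
  have hsK : Sum.inl s ∉ G.K := (hG.avoid s (hF.Q_subset_Z' (by simp))).1
  have hK : (G.addVertex U' {p, q} {s} s).K = insert (Sum.inl s) G.K := by
    simp [addVertex]
  have hsP : ∀ x ∈ ({p, q} : Finset L), x ≠ s := fun x hx h =>
    Finset.disjoint_left.1 hF.P_disjoint hx (h ▸ hF.Q_subset (by simp))
  have hps : p ≠ s := hsP p (by simp)
  have hqs : q ≠ s := hsP q (by simp)
  have hfin : FiniteOnSlices (insert (Sum.inl s) G.K) (G.addVertex U' {p, q} {s} s).summand := by
    rw [← hK]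
    exact (hG.addVertex hF).finiteOnSlices hF.A_subset
  have hval : (G.addVertex U' {p, q} {s} s).value (toVec ℓ α) =
      (∏ x ∈ {s} ∩ U', (toVec (Function.update ℓ s (ℓ p + ℓ q)) α (Sum.inl x) : ℚ)) *
        G.value (toVec (Function.update ℓ s (ℓ p + ℓ q)) α) := by
    rw [value, hK, sumOver_insert_outer hsK hfin, finsum_eq_single _ ((ℓ p + ℓ q : ℕ) : ℤ),
      ← toVec_update, sumOver_summand_addVertex hF hG, if_pos]
    · rw [Finset.sum_pair hpq]
      simp [toVec, hps, hqs]
      omega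
    · intro t ht
      rw [sumOver_summand_addVertex hF hG, if_neg]
      rintro ⟨h, -⟩
      rw [Finset.sum_pair hpq] at h
      simp only [Finset.sum_singleton, Function.update_self, ne_eq, Sum.inl.injEq, hps, hqs,
        not_false_eq_true, Function.update_of_ne] at h
      apply ht
      rw [← h]
      simp [toVec]
  have hprod := prod_weights hF hG.U_subset (z := toVec ℓ α)
    (z' := toVec (Function.update ℓ s (ℓ p + ℓ q)) α) (fun l hl => by
      have : l ≠ s := by simpa using hl
      simp [toVec, this])
  rw [Finset.prod_pair hpq] at hprod
  rw [weightedValue, weightedValue, hval, ← mul_assoc, ← mul_assoc, ← hprod]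
  simp [toVec]

theorem weightedValue_cut {p : L} (hF : Feeds A Z A' Z' {p} {s, s'} b b' s) (hss : s ≠ s')
    (hG : G.Valid A' U' b' Z' r) (ℓ : L → ℕ) (α : Fin m → ℕ) :
    ∑ k ∈ Finset.Ico 1 (ℓ p), (ℓ p : ℚ) * G.weightedValue U'
        (toVec (Function.update (Function.update ℓ s k) s' (ℓ p - k)) α) =
      (G.addVertex U' {p} {s, s'} s).weightedValue ((U' \ {s, s'}) ∪ {p}) (toVec ℓ α) := by
  classical
  have hsK : Sum.inl s ∉ G.K := (hG.avoid s (hF.Q_subset_Z' (by simp))).1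
  have hsK' : Sum.inl s' ∉ G.K := (hG.avoid s' (hF.Q_subset_Z' (by simp))).1
  have hK : (G.addVertex U' {p} {s, s'} s).K = insert (Sum.inl s) (insert (Sum.inl s') G.K) := by
    ext x
    simp only [addVertex, Finset.mem_union, Finset.mem_image, Finset.mem_insert,
      Finset.mem_singleton, exists_eq_or_imp, exists_eq_left]
    tauto
  have hsQ : ∀ x ∈ ({s, s'} : Finset L), x ≠ p := fun x hx h =>
    Finset.disjoint_left.1 hF.P_disjoint (Finset.mem_singleton_self p) (h ▸ hF.Q_subset hx)
  have hps : p ≠ s := (hsQ s (by simp)).symm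
  have hps' : p ≠ s' := (hsQ s' (by simp)).symm
  have hsins : Sum.inl s ∉ insert (Sum.inl s') G.K := by
    simp [hss, hsK]
  have hfin : FiniteOnSlices (insert (Sum.inl s) (insert (Sum.inl s') G.K))
      (G.addVertex U' {p} {s, s'} s).summand := by
    rw [← hK]
    exact (hG.addVertex hF).finiteOnSlices hF.A_subset
  have hzero : ∀ t t' : ℤ, ¬ ((ℓ p : ℤ) = t + t' ∧ 0 < t ∧ 0 < t') →
      sumOver G.K (G.addVertex U' {p} {s, s'} s).summand
        (Function.update (Function.update (toVec ℓ α) (Sum.inl s) t) (Sum.inl s') t') = 0 := by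
    intro t t' hn
    rw [sumOver_summand_addVertex hF hG, if_neg]
    rintro ⟨h1, h2⟩
    apply hn
    have e1 := h2 s (by simp)
    have e2 := h2 s' (by simp)
    rw [Finset.sum_pair hss] at h1
    have hss' : (Sum.inl s : L ⊕ Fin m) ≠ Sum.inl s' := fun h => hss (Sum.inl_injective h)
    have hp1 : (Sum.inl p : L ⊕ Fin m) ≠ Sum.inl s := fun h => hps (Sum.inl_injective h)
    have hp2 : (Sum.inl p : L ⊕ Fin m) ≠ Sum.inl s' := fun h => hps' (Sum.inl_injective h)
    rw [Finset.sum_singleton, Function.update_of_ne hp2, Function.update_of_ne hp1,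
      Function.update_of_ne hss', Function.update_self, Function.update_self] at h1
    rw [Function.update_of_ne hss', Function.update_self] at e1
    rw [Function.update_self] at e2
    exact ⟨h1, e1, e2⟩
  have hval : (G.addVertex U' {p} {s, s'} s).value (toVec ℓ α) = ∑ k ∈ Finset.Ico 1 (ℓ p),
      (∏ x ∈ {s, s'} ∩ U', (toVec (Function.update (Function.update ℓ s k) s' (ℓ p - k)) α
        (Sum.inl x) : ℚ)) *
        G.value (toVec (Function.update (Function.update ℓ s k) s' (ℓ p - k)) α) := by
    rw [value, hK, sumOver_insert_outer hsins hfin]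
    have hin : ∀ t : ℤ, sumOver (insert (Sum.inl s') G.K) (G.addVertex U' {p} {s, s'} s).summand
        (Function.update (toVec ℓ α) (Sum.inl s) t) =
        sumOver G.K (G.addVertex U' {p} {s, s'} s).summand (Function.update
          (Function.update (toVec ℓ α) (Sum.inl s) t) (Sum.inl s') (ℓ p - t)) := by
      intro t
      rw [sumOver_insert_outer hsK' (hfin.mono (Finset.subset_insert _ _) fun _ h => h),
        finsum_eq_single _ ((ℓ p : ℤ) - t)]
      intro t' ht'
      exact hzero t t' fun h => ht' (by omega)
    rw [finsum_congr hin, finsum_eq_sum_of_support_subset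
      (s := (Finset.Ico 1 (ℓ p)).map Nat.castEmbedding), Finset.sum_map]
    · refine Finset.sum_congr rfl fun k hk => ?_
      obtain ⟨hk1, hk2⟩ := Finset.mem_Ico.1 hk
      have hcast : ((ℓ p : ℤ) - (Nat.castEmbedding k : ℤ)) = ((ℓ p - k : ℕ) : ℤ) := by
        simp only [Nat.castEmbedding_apply]
        omega
      rw [hcast, Nat.castEmbedding_apply, ← toVec_update, ← toVec_update,
        sumOver_summand_addVertex hF hG, if_pos]
      rw [Finset.sum_pair hss]
      simp [toVec, hps, hps', hss]
      omega
    · intro t ht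
      rw [Function.mem_support] at ht
      have h : (ℓ p : ℤ) = t + (ℓ p - t) ∧ 0 < t ∧ 0 < ℓ p - t := by
        by_contra hn
        exact ht (hzero t _ hn)
      rw [Finset.mem_coe, Finset.mem_map]
      exact ⟨t.toNat, Finset.mem_Ico.2 (by omega), by
        simp only [Nat.castEmbedding_apply]; omega⟩
  rw [weightedValue, hval, Finset.mul_sum]
  refine Finset.sum_congr rfl fun k _ => ?_
  have hprod := prod_weights hF hG.U_subset (z := toVec ℓ α)
    (z' := toVec (Function.update (Function.update ℓ s k) s' (ℓ p - k)) α) (fun l hl => by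
      simp only [Finset.mem_insert, Finset.mem_singleton, not_or] at hl
      simp [toVec, hl.1, hl.2])
  rw [Finset.prod_singleton] at hprod
  rw [weightedValue, ← mul_assoc, ← mul_assoc, ← hprod]
  simp [toVec]

end FlowSystem

end Completions

/-! ### Completions as combinations of weighted flow counts -/

namespace FlowSystem

section Span

variable {L : Type*} [DecidableEq L] [Fintype L] {m : ℕ}

/-- The system without proper vertices and without internal edges, in which the strand `e i` runs
into the end `i`. -/
noncomputable def ends (e : Fin m → L) : FlowSystem L m where
  head := Sum.elim (fun l => open Classical in
    if h : ∃ i, e i = l then some (Sum.inr h.choose) else none) fun _ => none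
  tail := Sum.elim (fun _ => none) fun i => some (Sum.inr i)
  K := ∅
  J := Finset.univ.image Sum.inr
  W := ∅

omit [Fintype L] in
theorem ends_head {e : Fin m → L} (he : Function.Injective e) (k : L ⊕ Fin m) (i : Fin m) :
    (ends e).head k = some (Sum.inr i) ↔ k = Sum.inl (e i) := by
  rcases k with l | i'
  · by_cases h : ∃ i, e i = l
    · simp only [ends, Sum.elim_inl, dif_pos h, Option.some_inj, Sum.inr.injEq, Sum.inl.injEq]
      have := h.choose_spec
      constructor
      · rintro rfl
        exact this.symm
      · rintro rfl
        exact he this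
    · simp only [ends, Sum.elim_inl, dif_neg h, Sum.inl.injEq]
      refine iff_of_false (by simp) fun h' => h ⟨i, h'.symm⟩
  · simp [ends]

omit [Fintype L] in
theorem ends_tail (e : Fin m → L) (k : L ⊕ Fin m) (i : Fin m) :
    (ends e).tail k = some (Sum.inr i) ↔ k = Sum.inr i := by
  rcases k with l | i' <;> simp [ends]

theorem valid_ends {A Z : Finset L} {b : L → L} {e : Fin m → L} (he : IsMatching A b e) :
    (ends e).Valid A ∅ b Z 0 := by
  obtain ⟨hinj, hA, hb⟩ := he
  have hmem : ∀ p ∈ A, ∃ i, e i = p := by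
    intro p hp
    rw [← hA] at hp
    simpa using hp
  exact
    { avoid := fun l _ => by simp [ends]
      inr_notMem := fun i => by simp [ends]
      head_K := fun k hk => by simp [ends] at hk
      tail_K := fun k hk => by simp [ends] at hk
      head_A := fun p hp => by
        obtain ⟨i, rfl⟩ := hmem p hp
        exact ⟨Sum.inr i, by simp [ends], (ends_head hinj _ i).2 rfl⟩
      tail_A := fun p _ => rfl
      head_inr := fun i => rfl
      tail_inr := fun i => rfl
      inr_mem := fun i => by simp [ends]
      other := fun l hl _ => by
        refine ⟨?_, rfl⟩
        simp only [ends, Sum.elim_inl]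
        refine dif_neg ?_
        rintro ⟨i, rfl⟩
        exact hl (hA ▸ Finset.mem_image_of_mem e (Finset.mem_univ i))
      W_subset := fun _ h => h
      U_subset := Finset.empty_subset _
      unweighted := fun k hk => by simp [ends] at hk
      unused := fun p hp _ => by
        obtain ⟨i, rfl⟩ := hmem p hp
        exact ⟨i, (ends_head hinj _ i).2 rfl, fun k' h => (ends_head hinj _ i).1 h,
          fun k' h => (ends_tail e _ i).1 h⟩
      connected := fun c _ hc j hj j' hj' => by
        simp only [ends, Finset.mem_image, Finset.mem_univ, true_and] at hj hj'
        obtain ⟨i, rfl⟩ := hj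
        obtain ⟨i', rfl⟩ := hj'
        exact hc (e i) (hA ▸ Finset.mem_image_of_mem e (Finset.mem_univ i)) (e i')
          (hA ▸ Finset.mem_image_of_mem e (Finset.mem_univ i')) (hb i i') _ _
          ((ends_head hinj _ i).2 rfl) ((ends_head hinj _ i').2 rfl)
      confined := fun C => ⟨0, fun x _ _ _ k hk => by simp [ends] at hk⟩
      card_J := by
        simp [ends, Finset.card_image_of_injective _ Sum.inr_injective]
      card_edges := by simp [ends] }

open Classical in
theorem weightedValue_ends {e : Fin m → L} (he : Function.Injective e) (ℓ : L → ℕ)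
    (α : Fin m → ℕ) :
    (ends e).weightedValue ∅ (toVec ℓ α) = if ∀ i, ℓ (e i) = α i then 1 else 0 := by
  have hinc : ∀ i, incidenceForm (ends e).head (ends e).tail (Sum.inr i) ⬝ᵥ toVec ℓ α =
      (ℓ (e i) : ℤ) - α i := by
    intro i
    rw [incidence_dotProduct]
    simp only [ends_head he, ends_tail, Finset.sum_filter]
    simp [toVec]
  rw [weightedValue, Finset.prod_empty, one_mul, value]
  have hK : (ends e).K = ∅ := rfl
  rw [hK, sumOver_empty, summand_eq]
  simp [ends]
  congr 1
  refine propext (forall_congr' fun i => ?_)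
  have := hinc i
  simp only [ends] at this
  rw [this, sub_eq_zero, Nat.cast_inj]

/-- The weighted flow counts of the systems with given invariants. -/
def counts (A : Finset L) (b : L → L) (Z : Finset L) (m r : ℕ) : Set ((L ⊕ Fin m → ℤ) → ℚ) :=
  {f | ∃ (G : FlowSystem L m) (U : Finset L), G.Valid A U b Z r ∧ f = G.weightedValue U}

/-- Positive lengths of the strands, and lengths of the ends. -/
abbrev Lengths (A : Finset L) (m : ℕ) : Type _ :=
  {x : (L → ℕ) × (Fin m → ℕ) // ∀ p ∈ A, 0 < x.1 p}

/-- The functions of the lengths which are linear combinations of weighted flow counts. -/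
noncomputable def countSpan (A : Finset L) (b : L → L) (Z : Finset L) (m r : ℕ) :
    Submodule ℚ (Lengths A m → ℚ) :=
  (Submodule.span ℚ (counts A b Z m r)).map
    (LinearMap.funLeft ℚ ℚ fun x : Lengths A m => toVec x.1.1 x.1.2)

theorem mem_countSpan_of_valid {A U Z : Finset L} {b : L → L} {r : ℕ} {G : FlowSystem L m}
    (hG : G.Valid A U b Z r) {F : Lengths A m → ℚ}
    (hF : ∀ x, F x = G.weightedValue U (toVec x.1.1 x.1.2)) : F ∈ countSpan A b Z m r :=
  ⟨G.weightedValue U, Submodule.subset_span ⟨G, U, hG, rfl⟩, funext fun x => (hF x).symm⟩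

theorem join_mem_countSpan {A Z : Finset L} {b : L → L} {p q s s' : L} {r : ℕ} (hp : p ∈ A)
    (hq : q ∈ A.erase p) (hAZ : A ⊆ Z) (hs : s ∉ Z) {f : (L ⊕ Fin m → ℤ) → ℚ}
    (hf : f ∈ Submodule.span ℚ (counts (insert s ((A.erase p).erase q)) (joinBlocks b p q s)
      (insert s (insert s' Z)) m r)) :
    (fun x : Lengths A m => (x.1.1 p : ℚ) * x.1.1 q *
      f (toVec (Function.update x.1.1 s (x.1.1 p + x.1.1 q)) x.1.2)) ∈
        countSpan A b Z m (r + 1) := by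
  have hF := feeds_join (b := b) (s' := s') hp hq hAZ hs
  induction hf using Submodule.span_induction with
  | mem f h =>
    obtain ⟨G, U, hG, rfl⟩ := h
    exact mem_countSpan_of_valid (hG.addVertex hF) fun x =>
      weightedValue_join hF (Finset.ne_of_mem_erase hq).symm hG _ _ (x.2 p hp)
  | zero =>
    simp only [Pi.zero_apply, mul_zero]
    exact (countSpan A b Z m (r + 1)).zero_mem
  | add f g _ _ h1 h2 =>
    convert Submodule.add_mem _ h1 h2 using 1
    ext x
    simp only [Pi.add_apply]
    ring
  | smul a f _ h =>
    convert Submodule.smul_mem _ a h using 1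
    ext x
    simp only [Pi.smul_apply, smul_eq_mul]
    ring

theorem cut_mem_countSpan {A Z : Finset L} {b : L → L} {p s s' : L} {r : ℕ} (hp : p ∈ A)
    (hAZ : A ⊆ Z) (hs : s ∉ Z) (hs' : s' ∉ Z) (hss : s ≠ s') {f : (L ⊕ Fin m → ℤ) → ℚ}
    (hf : f ∈ Submodule.span ℚ (counts (insert s (insert s' (A.erase p))) (cutBlocks b p s s')
      (insert s (insert s' Z)) m r)) :
    (fun x : Lengths A m => ∑ k ∈ Finset.Ico 1 (x.1.1 p), (x.1.1 p : ℚ) *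
      f (toVec (Function.update (Function.update x.1.1 s k) s' (x.1.1 p - k)) x.1.2)) ∈
        countSpan A b Z m (r + 1) := by
  have hF := feeds_cut (b := b) hp hAZ hs hs' hss
  induction hf using Submodule.span_induction with
  | mem f h =>
    obtain ⟨G, U, hG, rfl⟩ := h
    exact mem_countSpan_of_valid (hG.addVertex hF) fun x => weightedValue_cut hF hss hG _ _
  | zero =>
    simp only [Pi.zero_apply, mul_zero, Finset.sum_const_zero]
    exact (countSpan A b Z m (r + 1)).zero_mem
  | add f g _ _ h1 h2 =>
    convert Submodule.add_mem _ h1 h2 using 1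
    ext x
    simp only [Pi.add_apply, mul_add, Finset.sum_add_distrib]
  | smul a f _ h =>
    convert Submodule.smul_mem _ a h using 1
    ext x
    simp only [Pi.smul_apply, smul_eq_mul, Finset.mul_sum]
    exact Finset.sum_congr rfl fun k _ => by ring

/-- The cut and join recursion builds up flow systems vertex by vertex. -/
theorem completions_mem_countSpan (fr : List (L × L)) : ∀ {A Z : Finset L} {b : L → L}, A ⊆ Z →
    Fresh fr Z → (fun x : Lengths A m => completions x.1.2 fr A b x.1.1) ∈
      countSpan A b Z m fr.length := by
  classical
  induction fr with
  | nil =>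
    intro A Z b _ _
    have h : (fun x : Lengths A m => completions x.1.2 [] A b x.1.1) =
        ∑ e : {e : Fin m → L // IsMatching A b e},
          fun x : Lengths A m => (ends e.1).weightedValue ∅ (toVec x.1.1 x.1.2) := by
      ext x
      rw [Finset.sum_apply]
      simp only [fun e : {e : Fin m → L // IsMatching A b e} =>
        weightedValue_ends e.2.1 x.1.1 x.1.2, Finset.sum_boole]
      rw [completions, Nat.cast_inj, ← Fintype.card_subtype, ← Nat.card_eq_fintype_card]
      exact Nat.card_congr
        (Equiv.subtypeSubtypeEquivSubtypeInter (IsMatching A b)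
          fun e : Fin m → L => ∀ i, x.1.1 (e i) = x.1.2 i).symm
    rw [h]
    exact Submodule.sum_mem _ fun e _ => mem_countSpan_of_valid (valid_ends e.2) fun _ => rfl
  | cons a fr ih =>
    obtain ⟨s, s'⟩ := a
    intro A Z b hAZ hfr
    obtain ⟨hs, hs', hss, hfr'⟩ := hfr
    have h : (fun x : Lengths A m => completions x.1.2 ((s, s') :: fr) A b x.1.1) =
        (1 / 2 : ℚ) • ((∑ p ∈ A, ∑ q ∈ A.erase p, fun x : Lengths A m =>
          (x.1.1 p : ℚ) * x.1.1 q *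
          completions x.1.2 fr (insert s ((A.erase p).erase q)) (joinBlocks b p q s)
          (Function.update x.1.1 s (x.1.1 p + x.1.1 q))) +
        ∑ p ∈ A, fun x : Lengths A m => ∑ k ∈ Finset.Ico 1 (x.1.1 p), (x.1.1 p : ℚ) *
          completions x.1.2 fr (insert s (insert s' (A.erase p))) (cutBlocks b p s s')
          (Function.update (Function.update x.1.1 s k) s' (x.1.1 p - k))) := by
      ext x
      simp only [completions, Pi.smul_apply, Pi.add_apply, Finset.sum_apply, smul_eq_mul]
    rw [h, List.length_cons]
    refine Submodule.smul_mem _ _ (Submodule.add_mem _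
      (Submodule.sum_mem _ fun p hp => Submodule.sum_mem _ fun q hq => ?_)
      (Submodule.sum_mem _ fun p hp => ?_))
    · have hF := feeds_join (b := b) (s' := s') hp hq hAZ hs
      have hq' := Finset.mem_of_mem_erase hq
      obtain ⟨f, hf, hfe⟩ := ih (A := insert s ((A.erase p).erase q)) (b := joinBlocks b p q s)
        (fun a ha => by
          rcases Finset.mem_insert.1 ha with rfl | ha
          · simp
          · exact hF.Z_subset (hAZ (Finset.mem_of_mem_erase (Finset.mem_of_mem_erase ha)))) hfr'
      convert join_mem_countSpan hp hq hAZ hs hf using 1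
      ext x
      have hx : ∀ a ∈ insert s ((A.erase p).erase q),
          0 < Function.update x.1.1 s (x.1.1 p + x.1.1 q) a := by
        intro a ha
        by_cases has : a = s
        · subst has
          have := x.2 p hp
          simp only [Function.update_self]
          omega
        · rw [Function.update_of_ne has]
          exact x.2 a (Finset.mem_of_mem_erase (Finset.mem_of_mem_erase
            (Finset.mem_of_mem_insert_of_ne ha has)))
      have := congrFun hfe ⟨(Function.update x.1.1 s (x.1.1 p + x.1.1 q), x.1.2), hx⟩
      simp only [LinearMap.funLeft_apply] at this
      rw [this]
    · have hF := feeds_cut (b := b) hp hAZ hs hs' hss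
      obtain ⟨f, hf, hfe⟩ := ih (A := insert s (insert s' (A.erase p)))
        (b := cutBlocks b p s s') (fun a ha => by
          rcases Finset.mem_insert.1 ha with rfl | ha
          · simp
          rcases Finset.mem_insert.1 ha with rfl | ha
          · simp
          · exact hF.Z_subset (hAZ (Finset.mem_of_mem_erase ha))) hfr'
      convert cut_mem_countSpan hp hAZ hs hs' hss hf using 1
      ext x
      refine Finset.sum_congr rfl fun k hk => ?_
      have hx : ∀ a ∈ insert s (insert s' (A.erase p)),
          0 < Function.update (Function.update x.1.1 s k) s' (x.1.1 p - k) a := by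
        intro a ha
        obtain ⟨hk1, hk2⟩ := Finset.mem_Ico.1 hk
        by_cases has' : a = s'
        · subst has'
          simp only [Function.update_self]
          omega
        rw [Function.update_of_ne has']
        by_cases has : a = s
        · subst has
          simp only [Function.update_self]
          omega
        · rw [Function.update_of_ne has]
          exact x.2 a (Finset.mem_of_mem_erase (Finset.mem_of_mem_insert_of_ne
            (Finset.mem_of_mem_insert_of_ne ha has) has'))
      have := congrFun hfe ⟨(Function.update (Function.update x.1.1 s k) s' (x.1.1 p - k),
        x.1.2), hx⟩
      simp only [LinearMap.funLeft_apply] at this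
      rw [this]

end Span

end FlowSystem

/-! ### Piecewise polynomiality of flow counts -/

namespace FlowSystem

section Chambers

variable {L : Type*} [Fintype L] [DecidableEq L] {m : ℕ} {G : FlowSystem L m} {A U Z : Finset L}
  {b : L → L} {r : ℕ}

theorem Dangling.incidence {k : L ⊕ Fin m} {i : Fin m} (h : G.Dangling k i)
    (ht : G.tail (Sum.inr i) = some (Sum.inr i)) (x : L ⊕ Fin m → ℤ) :
    incidenceForm G.head G.tail (Sum.inr i) ⬝ᵥ x = x k - x (Sum.inr i) := by
  have h1 : (Finset.univ.filter fun k' => G.head k' = some (Sum.inr i)) = {k} := by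
    ext k'
    simp only [Finset.mem_filter, Finset.mem_univ, true_and, Finset.mem_singleton]
    exact ⟨h.2.1 k', fun e => e ▸ h.1⟩
  have h2 : (Finset.univ.filter fun k' => G.tail k' = some (Sum.inr i)) = {Sum.inr i} := by
    ext k'
    simp only [Finset.mem_filter, Finset.mem_univ, true_and, Finset.mem_singleton]
    exact ⟨h.2.2 k', fun e => e ▸ ht⟩
  rw [incidence_dotProduct, h1, h2, Finset.sum_singleton, Finset.sum_singleton]

/-- A strand that runs directly to an end forms a connected component of its own, if all blocks
are single strands. -/
theorem Valid.unused_eq_empty (hG : G.Valid A U b Z r) (hAZ : A ⊆ Z) (hb : Set.InjOn b A)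
    (hr : 1 ≤ r) : U = A := by
  refine Finset.Subset.antisymm hG.U_subset fun p hp => ?_
  by_contra hpU
  obtain ⟨i, hi⟩ := hG.unused p hp hpU
  have hc := hG.connected (fun j => if j = Sum.inr i then 1 else 0)
    (fun k hk j j' hj hj' => by
      have h1 : j ≠ Sum.inr i := by
        rintro rfl
        exact (hG.avoid p (hAZ hp)).1 (hi.2.1 k hj ▸ hk)
      have h2 : j' ≠ Sum.inr i := by
        rintro rfl
        exact hG.inr_notMem i (hi.2.2 k hj' ▸ hk)
      rw [if_neg h1, if_neg h2])
    (fun q hq q' hq' hqq j j' hj hj' => by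
      obtain rfl := hb hq hq' hqq
      rw [hj, Option.some_inj] at hj'
      rw [hj'])
  have hJ : G.J ⊆ {Sum.inr i} := fun j hj => by
    have := hc j hj _ (hG.inr_mem i)
    rw [if_pos rfl] at this
    by_contra hne
    rw [if_neg (by simpa using hne)] at this
    exact zero_ne_one this
  have h1 := Finset.card_le_card hJ
  have h2 := i.pos
  rw [hG.card_J, Finset.card_singleton] at h1
  omega

theorem Valid.unimodular (G : FlowSystem L m) :
    Unimodular ((G.rows : Set (L ⊕ Fin m → ℤ)) ∪ incidenceForm G.head G.tail '' G.J) G.K := by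
  refine (unimodular_incidence G.head G.tail).mono ?_ (Set.subset_univ _)
  rintro w (hw | ⟨j, -, rfl⟩)
  · obtain ⟨k, -, rfl⟩ := Finset.mem_image.1 (Finset.mem_coe.1 hw)
    exact Or.inr ⟨k, rfl⟩
  · exact Or.inl ⟨j, rfl⟩

theorem Valid.confinesSystem (hG : G.Valid A U b Z r) (hAZ : A ⊆ Z) :
    ConfinesSystem G.J (incidenceForm G.head G.tail) G.rows G.K := by
  intro z C
  obtain ⟨B, hB⟩ := hG.confined (|C| + ∑ p ∈ A, |z (Sum.inl p)|)
  have h0 : 0 ≤ ∑ p ∈ A, |z (Sum.inl p)| := Finset.sum_nonneg fun _ _ => abs_nonneg _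
  have hC := le_abs_self C
  refine ⟨B, fun x hx hJ hR => hB x (fun j hj => (hJ j hj).trans (by linarith)) (fun k hk => ?_)
    fun p hp => ?_⟩
  · have := hR (Pi.single k 1) (Finset.mem_image_of_mem _ hk)
    rw [single_dotProduct, one_mul] at this
    linarith
  · rw [hx (Sum.inl p) (hG.avoid p (hAZ hp)).1]
    have := Finset.single_le_sum (f := fun p => |z (Sum.inl p)|) (fun _ _ => abs_nonneg _) hp
    have := abs_nonneg C
    linarith

theorem Valid.singleDependency (hG : G.Valid A U b Z r) (hb : Set.InjOn b A) :
    SingleDependency G.J (incidenceForm G.head G.tail) G.K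
      {z | ∑ p ∈ A, z (Sum.inl p) = ∑ i, z (Sum.inr i) ∧ ∀ i, 0 < z (Sum.inr i)} := by
  intro c hc
  have hhead : ∀ (c : L ⊕ Fin m → ℚ) k j₀, G.head k = some j₀ → j₀ ∈ G.J →
      ∑ j ∈ G.J, c j * (if G.head k = some j then 1 else 0) = c j₀ := by
    intro c k j₀ h hj
    simp only [h, Option.some_inj]
    simp [hj]
  have htail : ∀ (c : L ⊕ Fin m → ℚ) k j₀, G.tail k = some j₀ → j₀ ∈ G.J →
      ∑ j ∈ G.J, c j * (if G.tail k = some j then 1 else 0) = c j₀ := by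
    intro c k j₀ h hj
    simp only [h, Option.some_inj]
    simp [hj]
  have hsplit : ∀ (c : L ⊕ Fin m → ℚ) k,
      ∑ j ∈ G.J, c j * (incidenceForm G.head G.tail j k : ℚ) =
      ∑ j ∈ G.J, c j * (if G.head k = some j then 1 else 0) -
        ∑ j ∈ G.J, c j * (if G.tail k = some j then 1 else 0) := by
    intro c k
    rw [← Finset.sum_sub_distrib]
    refine Finset.sum_congr rfl fun j _ => ?_
    simp only [incidenceForm]
    push_cast
    ring
  have hconst := hG.connected c
    (fun k hk j j' hj hj' => by
      have h := hc k hk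
      obtain ⟨i, hi, hki⟩ := hG.head_K k hk
      obtain ⟨i', hi', hki'⟩ := hG.tail_K k hk
      rw [hsplit, hhead c k i hki hi, htail c k i' hki' hi', sub_eq_zero] at h
      rw [hki, Option.some_inj] at hj
      rw [hki', Option.some_inj] at hj'
      rw [← hj, ← hj', h])
    (fun q hq q' hq' hqq j j' hj hj' => by
      obtain rfl := hb hq hq' hqq
      rw [hj, Option.some_inj] at hj'
      rw [hj'])
  refine ⟨hconst, fun z hz => ?_⟩
  rcases G.J.eq_empty_or_nonempty with hJ | ⟨j₀, hj₀⟩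
  · rw [hJ, Finset.sum_empty]
  have hsum : ∀ k, ∑ j ∈ G.J, c j * (incidenceForm G.head G.tail j k : ℚ) =
      c j₀ * Sum.elim (fun l => if l ∈ A then 1 else 0) (fun _ => -1) k := by
    intro k
    rw [hsplit]
    rcases k with l | i
    · by_cases hK : Sum.inl l ∈ G.K
      · have hlA : l ∉ A := fun h => by
          obtain ⟨i', hi', hki'⟩ := hG.tail_K _ hK
          rw [hG.tail_A l h] at hki'
          simp at hki'
        have := hc _ hK
        rw [hsplit] at this
        rw [this]
        simp [hlA]
      · by_cases hlA : l ∈ A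
        · obtain ⟨j, hj, hh⟩ := hG.head_A l hlA
          rw [hhead c _ j hh hj, hG.tail_A l hlA, hconst j hj j₀ hj₀]
          simp [hlA]
        · obtain ⟨h1, h2⟩ := hG.other l hlA hK
          simp [h1, h2, hlA]
    · rw [hG.head_inr, htail c _ _ (hG.tail_inr i) (hG.inr_mem i),
        hconst _ (hG.inr_mem i) j₀ hj₀]
      simp
  have : ∑ j ∈ G.J, c j * ((incidenceForm G.head G.tail j ⬝ᵥ z : ℤ) : ℚ) =
      ∑ k, (∑ j ∈ G.J, c j * (incidenceForm G.head G.tail j k : ℚ)) * (z k : ℚ) := by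
    simp only [dotProduct, Int.cast_sum, Int.cast_mul, Finset.mul_sum, Finset.sum_mul]
    rw [Finset.sum_comm]
    exact Finset.sum_congr rfl fun _ _ => Finset.sum_congr rfl fun _ _ => by ring
  rw [this, Finset.sum_congr rfl fun k _ => by rw [hsum k], Fintype.sum_sum_type]
  have h1 : ((∑ p ∈ A, z (Sum.inl p) : ℤ) : ℚ) = ((∑ i, z (Sum.inr i) : ℤ) : ℚ) := by
    rw [hz.1]
  push_cast at h1
  simp only [Sum.elim_inl, Sum.elim_inr, mul_ite, mul_one, mul_zero, ite_mul, zero_mul,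
    Finset.sum_ite_mem, Finset.univ_inter, mul_neg, neg_mul, Finset.sum_neg_distrib]
  rw [← Finset.mul_sum, ← Finset.mul_sum, h1]
  ring

theorem Valid.vanishesOnBoundary (hG : G.Valid A U b Z r) :
    VanishesOnBoundary G.J (incidenceForm G.head G.tail) G.rows G.K
      {z | ∑ p ∈ A, z (Sum.inl p) = ∑ i, z (Sum.inr i) ∧ ∀ i, 0 < z (Sum.inr i)}
      (∏ k ∈ G.W, MvPolynomial.X k) := by
  rintro z hz x hx hJ - ⟨w, hw, hw0⟩
  obtain ⟨k, hk, rfl⟩ := Finset.mem_image.1 hw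
  rw [single_dotProduct, one_mul] at hw0
  rw [map_prod]
  by_cases hkW : k ∈ G.W
  · exact Finset.prod_eq_zero hkW (by simp [hw0])
  · obtain ⟨i, hi⟩ := hG.unweighted k hk hkW
    have h := hJ _ (hG.inr_mem i)
    rw [hi.incidence (hG.tail_inr i), hw0, hx _ (hG.inr_notMem i)] at h
    have := hz.2 i
    omega

end Chambers

section PiecewisePolynomial

variable {M : Type*} [Fintype M] [DecidableEq M] {m n : ℕ}

omit [Fintype M] [DecidableEq M] in
theorem toVec_sumElim (x : Fin m ⊕ Fin n → ℕ) :
    toVec (Sum.elim (fun j => x (Sum.inr j)) fun _ : M => 0) (fun i => x (Sum.inl i)) =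
      copyAlong (Sum.elim (Sum.elim (fun j => some (Sum.inr j)) fun _ => none)
        fun i => some (Sum.inl i)) x := by
  ext ((j | l) | i) <;> simp [toVec, copyAlong]

/-- The degree is the number of weighted edges plus the dimension of the space of internal flows;
this is determined by the Euler characteristic. -/
theorem Valid.isPiecewisePolynomialOn {G : FlowSystem (Fin n ⊕ M) m} {U Z : Finset (Fin n ⊕ M)}
    {r : ℕ} (hG : G.Valid (Finset.univ.image Sum.inl) U id Z r)
    (hAZ : Finset.univ.image Sum.inl ⊆ Z) (hm : 1 ≤ m) (hr : 1 ≤ r) :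
    IsPiecewisePolynomialOn (hurwitzDomain m n)
      (fun x => G.value
        (toVec (Sum.elim (fun j => x (Sum.inr j)) fun _ => 0) fun i => x (Sum.inl i)))
      (2 * r + 1 - (m + n)) := by
  have hb : Set.InjOn (id : Fin n ⊕ M → Fin n ⊕ M)
      (Finset.univ.image Sum.inl : Finset (Fin n ⊕ M)) := Function.injective_id.injOn
  have : Nonempty (Fin m ⊕ Fin n) := ⟨Sum.inl ⟨0, hm⟩⟩
  obtain ⟨𝓑, h𝓑⟩ := exists_polynomial_sumOver_constrained _ _ G.J _ G.rows G.K
    (∏ k ∈ G.W, MvPolynomial.X k) rfl (Valid.unimodular G) (hG.confinesSystem hAZ)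
    (hG.singleDependency hb) hG.vanishesOnBoundary
  refine isPiecewisePolynomialOn_of_walls (fun x hx => hx.1) (Sum.elim
    (Sum.elim (fun j => some (Sum.inr j)) fun _ => none) fun i => some (Sum.inl i)) 𝓑
    fun ζ hζ => ?_
  obtain ⟨Q, hQ, hQe⟩ := h𝓑 ζ hζ
  refine ⟨Q, ?_, fun x hx hw => ?_⟩
  · have hW : (∏ k ∈ G.W, MvPolynomial.X k : MvPolynomial _ ℚ).totalDegree ≤ G.W.card := by
      refine (MvPolynomial.totalDegree_finsetProd _ _).trans ?_
      simp
    have h1 := hG.card_J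
    have h2 := hG.card_edges
    rw [hG.unused_eq_empty hAZ hb hr, Finset.card_image_of_injective _ Sum.inl_injective,
      Finset.card_univ, Fintype.card_fin] at h2
    omega
  · rw [toVec_sumElim, value]
    refine hQe _ ⟨?_, fun i => ?_⟩ hw
    · rw [Finset.sum_image fun _ _ _ _ h => Sum.inl_injective h]
      simp only [copyAlong, Sum.elim_inl, Sum.elim_inr, Option.elim_some]
      exact_mod_cast hx.2.symm
    · simp only [copyAlong, Sum.elim_inr, Option.elim_some]
      exact_mod_cast hx.1 (Sum.inl i)

/-- Divided by the lengths of the initial strands, the completions are combinations of flow counts,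
since with at least one operation every initial strand runs into a proper vertex. -/
theorem isPiecewisePolynomialOn_completions {fr : List ((Fin n ⊕ M) × (Fin n ⊕ M))}
    (hfr : Fresh fr (Finset.univ.image Sum.inl)) (hm : 1 ≤ m) (hr : 1 ≤ fr.length) :
    IsPiecewisePolynomialOn (hurwitzDomain m n)
      (fun x => completions (fun i => x (Sum.inl i)) fr (Finset.univ.image Sum.inl) id
        (Sum.elim (fun j => x (Sum.inr j)) fun _ => 0) / ∏ j, (x (Sum.inr j) : ℚ))
      (2 * fr.length + 1 - (m + n)) := by
  obtain ⟨f, hf, hfe⟩ := completions_mem_countSpan (m := m) fr (b := id)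
    (Finset.Subset.refl (Finset.univ.image (Sum.inl : Fin n → Fin n ⊕ M))) hfr
  have hb : Set.InjOn (id : Fin n ⊕ M → Fin n ⊕ M)
      (Finset.univ.image Sum.inl : Finset (Fin n ⊕ M)) := Function.injective_id.injOn
  have key : IsPiecewisePolynomialOn (hurwitzDomain m n) (fun x => f (toVec (Sum.elim
      (fun j => x (Sum.inr j)) fun _ : M => 0) fun i => x (Sum.inl i)) / ∏ j, (x (Sum.inr j) : ℚ))
      (2 * fr.length + 1 - (m + n)) := by
    clear hfe
    induction hf using Submodule.span_induction with
    | mem f h =>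
      obtain ⟨G, U, hG, rfl⟩ := h
      refine (hG.isPiecewisePolynomialOn (Finset.Subset.refl _) hm hr).congr fun x hx => ?_
      rw [weightedValue, hG.unused_eq_empty (Finset.Subset.refl _) hb hr,
        Finset.prod_image fun _ _ _ _ h => Sum.inl_injective h]
      have hne : ∏ j, (x (Sum.inr j) : ℚ) ≠ 0 := Finset.prod_ne_zero_iff.2 fun j _ => by
        exact_mod_cast (hx.1 (Sum.inr j)).ne'
      simp only [toVec, Sum.elim_inl, Int.cast_natCast]
      exact mul_div_cancel_left₀ _ hne
    | zero => simpa using IsPiecewisePolynomialOn.zero (hurwitzDomain m n) _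
    | add f g _ _ h1 h2 =>
      simpa only [Pi.add_apply, add_div] using h1.add h2
    | smul a f _ h =>
      simpa only [Pi.smul_apply, smul_eq_mul, mul_div_assoc] using h.const_mul a
  refine key.congr fun x hx => ?_
  have := congrFun hfe ⟨(Sum.elim (fun j => x (Sum.inr j)) fun _ => 0, fun i => x (Sum.inl i)),
    fun p hp => by
      obtain ⟨j, -, rfl⟩ := Finset.mem_image.1 hp
      exact hx.1 (Sum.inr j)⟩
  rw [LinearMap.funLeft_apply] at this
  rw [this]

end PiecewisePolynomial

end FlowSystem

/-! ### Monodromy data with marked blocks of sheets -/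

section Monodromy

variable {d m : ℕ} {L : Type*}

/-- Sheets with the same block name `κ`, together with the permutations `τ i`, connect all
sheets. -/
def Connects {r : ℕ} (κ : Fin d → L) (τ : Fin r → Equiv.Perm (Fin d)) : Prop :=
  ∀ S : Set (Fin d), (∀ x y, κ x = κ y → x ∈ S → y ∈ S) → (∀ i x, x ∈ S → τ i x ∈ S) →
    S.Nonempty → S = Set.univ

/-- The sequences of `r` transpositions that lead from `σ` to the class of `α`, and connect the
blocks of sheets named by `κ`. -/
def chains (α : Fin m → ℕ) (r : ℕ) (σ : Equiv.Perm (Fin d)) (κ : Fin d → L) :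
    Set (Fin r → Equiv.Perm (Fin d)) :=
  {τ | (∀ i, (τ i).IsSwap) ∧ InClass α ((List.ofFn τ).reverse.prod * σ) ∧ Connects κ τ}

variable [DecidableEq L]

/-- The block names after the blocks of `x` and `y` are merged. -/
def mergeBlocks (κ : Fin d → L) (x y : Fin d) : Fin d → L :=
  fun a => if κ a = κ y then κ x else κ a

theorem connects_cons {r : ℕ} (κ : Fin d → L) (x y : Fin d) (τ : Fin r → Equiv.Perm (Fin d)) :
    Connects κ (Fin.cons (Equiv.swap x y) τ : Fin (r + 1) → Equiv.Perm (Fin d)) ↔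
      Connects (mergeBlocks κ x y) τ := by
  have hxy : mergeBlocks κ x y x = mergeBlocks κ x y y := by
    simp [mergeBlocks]
  constructor
  · intro h S hS hτ hne
    refine h S (fun a b hab ha => hS a b (by simp [mergeBlocks, hab]) ha) (fun i a ha => ?_) hne
    refine Fin.cases ?_ (fun i => ?_) i
    · rw [Fin.cons_zero]
      by_cases hax : a = x
      · rw [hax, Equiv.swap_apply_left]
        exact hS x y hxy (hax ▸ ha)
      by_cases hay : a = y
      · rw [hay, Equiv.swap_apply_right]
        exact hS y x hxy.symm (hay ▸ ha)
      · rwa [Equiv.swap_apply_of_ne_of_ne hax hay]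
    · rw [Fin.cons_succ]
      exact hτ i a ha
  · intro h S hS hτ hne
    have h0 : ∀ a ∈ S, Equiv.swap x y a ∈ S := fun a ha => by simpa using hτ 0 a ha
    refine h S (fun a b hab ha => ?_) (fun i a ha => by simpa using hτ i.succ a ha) hne
    have h1 : x ∈ S → y ∈ S := fun hx => by simpa using h0 x hx
    have h2 : y ∈ S → x ∈ S := fun hy => by simpa using h0 y hy
    simp only [mergeBlocks] at hab
    split_ifs at hab with ha' hb' hb'
    · exact hS a b (ha'.trans hb'.symm) ha
    · exact hS x b hab (h2 (hS a y ha' ha))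
    · exact hS y b hb'.symm (h1 (hS a x hab ha))
    · exact hS a b hab ha

theorem cons_mem_chains {α : Fin m → ℕ} {r : ℕ} {σ : Equiv.Perm (Fin d)} {κ : Fin d → L}
    {x y : Fin d} (hxy : x ≠ y) {τ : Fin r → Equiv.Perm (Fin d)} :
    (Fin.cons (Equiv.swap x y) τ : Fin (r + 1) → Equiv.Perm (Fin d)) ∈ chains α (r + 1) σ κ ↔
      τ ∈ chains α r (Equiv.swap x y * σ) (mergeBlocks κ x y) := by
  have hs : (Equiv.swap x y).IsSwap := ⟨x, y, hxy, rfl⟩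
  simp only [chains, Set.mem_ofPred_eq, connects_cons, List.ofFn_cons, List.reverse_cons,
    List.prod_append, List.prod_singleton, mul_assoc, Fin.forall_fin_succ, Fin.cons_zero,
    Fin.cons_succ, hs, true_and]

/-- A transposition is the swap of exactly two ordered pairs. -/
theorem card_filter_swap_eq {τ : Equiv.Perm (Fin d)} (hτ : τ.IsSwap) :
    ((Finset.univ : Finset (Fin d)).offDiag.filter fun z => Equiv.swap z.1 z.2 = τ).card = 2 := by
  obtain ⟨x, y, hxy, rfl⟩ := hτ
  have : ((Finset.univ : Finset (Fin d)).offDiag.filter fun z => Equiv.swap z.1 z.2 =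
      Equiv.swap x y) = {(x, y), (y, x)} := by
    ext ⟨a, b⟩
    simp only [Finset.mem_filter, Finset.mem_offDiag, Finset.mem_univ, true_and,
      Finset.mem_insert, Finset.mem_singleton, Prod.mk.injEq]
    constructor
    · rintro ⟨hab, h⟩
      have h1 : Equiv.swap x y a = b := by rw [← h, Equiv.swap_apply_left]
      by_cases hax : a = x
      · left
        rw [hax, Equiv.swap_apply_left] at h1
        exact ⟨hax, h1.symm⟩
      by_cases hay : a = y
      · right
        rw [hay, Equiv.swap_apply_right] at h1
        exact ⟨hay, h1.symm⟩
      · rw [Equiv.swap_apply_of_ne_of_ne hax hay] at h1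
        exact absurd h1 hab
    · rintro (⟨rfl, rfl⟩ | ⟨rfl, rfl⟩)
      · exact ⟨hxy, rfl⟩
      · exact ⟨hxy.symm, Equiv.swap_comm _ _⟩
  rw [this, Finset.card_pair]
  simp [hxy]

theorem ncard_chains_succ (α : Fin m → ℕ) (r : ℕ) (σ : Equiv.Perm (Fin d)) (κ : Fin d → L) :
    2 * (chains α (r + 1) σ κ).ncard = ∑ z ∈ (Finset.univ : Finset (Fin d)).offDiag,
      (chains α r (Equiv.swap z.1 z.2 * σ) (mergeBlocks κ z.1 z.2)).ncard := by
  classical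
  have h1 : ∀ z ∈ (Finset.univ : Finset (Fin d)).offDiag,
      (chains α r (Equiv.swap z.1 z.2 * σ) (mergeBlocks κ z.1 z.2)).ncard =
        ((chains α (r + 1) σ κ).toFinset.filter fun τ => Equiv.swap z.1 z.2 = τ 0).card := by
    intro z hz
    have hz' : z.1 ≠ z.2 := (Finset.mem_offDiag.1 hz).2.2
    rw [← Set.ncard_coe_finset]
    refine Set.ncard_congr (fun τ _ => Fin.cons (Equiv.swap z.1 z.2) τ) (fun τ hτ => ?_)
      (fun τ τ' _ _ h => ?_) fun τ hτ => ?_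
    · simp only [Finset.coe_filter, Set.mem_toFinset, Set.mem_ofPred_eq, Fin.cons_zero, and_true]
      exact (cons_mem_chains hz').2 hτ
    · exact (Fin.cons_injective2 h).2
    · simp only [Finset.coe_filter, Set.mem_toFinset, Set.mem_ofPred_eq] at hτ
      have e : Fin.cons (Equiv.swap z.1 z.2) (Fin.tail τ) = τ := by
        rw [hτ.2, Fin.cons_self_tail]
      exact ⟨Fin.tail τ, (cons_mem_chains hz').1 (e ▸ hτ.1), e⟩
  rw [Finset.sum_congr rfl h1]
  simp only [Finset.card_filter]
  rw [Finset.sum_comm]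
  have h2 : ∀ τ ∈ (chains α (r + 1) σ κ).toFinset,
      ∑ z ∈ (Finset.univ : Finset (Fin d)).offDiag, (if Equiv.swap z.1 z.2 = τ 0 then 1 else 0)
        = 2 := by
    intro τ hτ
    rw [← Finset.card_filter]
    exact card_filter_swap_eq ((Set.mem_toFinset.1 hτ).1 0)
  rw [Finset.sum_congr rfl h2, Finset.sum_const, smul_eq_mul, mul_comm,
    ← Set.ncard_eq_toFinset_card']

end Monodromy

/-! ### Cycles of a permutation after multiplication by a transposition -/

section Marks

variable {d : ℕ} {L : Type*} [DecidableEq L] {σ : Equiv.Perm (Fin d)} {c : Fin d → L}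
  {A : Finset L} {ℓ : L → ℕ} {b : L → L} {x y : Fin d} {s s' : L} {k : ℕ}

/-- `c` labels the cycles of `σ` by the elements of `A`, and the cycle labelled `p` has length
`ℓ p`. -/
structure Marks (σ : Equiv.Perm (Fin d)) (c : Fin d → L) (A : Finset L) (ℓ : L → ℕ) : Prop where
  eq_iff : ∀ x y, c x = c y ↔ σ.SameCycle x y
  image_eq : Finset.univ.image c = A
  length_eq : ∀ p ∈ A, ℓ p = (Finset.univ.filter fun x => c x = p).card

theorem Marks.mem (h : Marks σ c A ℓ) (x : Fin d) : c x ∈ A :=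
  h.image_eq ▸ Finset.mem_image_of_mem c (Finset.mem_univ x)

theorem Marks.pos (h : Marks σ c A ℓ) {p : L} (hp : p ∈ A) : 0 < ℓ p := by
  rw [h.length_eq p hp, Finset.card_pos]
  rw [← h.image_eq, Finset.mem_image] at hp
  obtain ⟨x, -, hx⟩ := hp
  exact ⟨x, by simpa using hx⟩

theorem Marks.label_pow (h : Marks σ c A ℓ) (x : Fin d) (j : ℕ) : c ((σ ^ j) x) = c x :=
  (h.eq_iff _ _).2 (Equiv.Perm.sameCycle_pow_left.2 (Equiv.Perm.SameCycle.refl _ _))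

theorem Marks.isCycleOn (h : Marks σ c A ℓ) (x : Fin d) :
    σ.IsCycleOn (Finset.univ.filter fun a => c a = c x : Finset (Fin d)) := by
  have hσ : ∀ a, c (σ a) = c a := fun a => by simpa using h.label_pow a 1
  refine ⟨⟨fun a ha => ?_, σ.injective.injOn, fun a ha => ⟨σ⁻¹ a, ?_, by simp⟩⟩,
    fun a ha a' ha' => (h.eq_iff _ _).1 ?_⟩
  · simpa [hσ] using ha
  · have := hσ (σ⁻¹ a)
    simp only [Finset.coe_filter, Finset.mem_univ, true_and, Set.mem_ofPred_eq] at ha ⊢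
    rw [← this]
    simpa using ha
  · simp only [Finset.coe_filter, Finset.mem_univ, true_and, Set.mem_ofPred_eq] at ha ha'
    rw [ha, ha']

theorem Marks.exists_pow_eq (h : Marks σ c A ℓ) {a : Fin d} (ha : c a = c x) :
    ∃ j < ℓ (c x), (σ ^ j) x = a := by
  rw [h.length_eq _ (h.mem x)]
  exact (h.isCycleOn x).exists_pow_eq (by simp) (by simpa using ha)

theorem Marks.pow_length (h : Marks σ c A ℓ) (x : Fin d) : (σ ^ ℓ (c x)) x = x := by
  rw [h.length_eq _ (h.mem x)]
  exact (h.isCycleOn x).pow_card_apply (by simp)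

theorem Marks.pow_inj (h : Marks σ c A ℓ) {i j : ℕ} (hi : i < ℓ (c x)) (hj : j < ℓ (c x))
    (hij : (σ ^ i) x = (σ ^ j) x) : i = j := by
  rw [h.length_eq _ (h.mem x)] at hi hj
  have := ((h.isCycleOn x).pow_apply_eq_pow_apply (by simp)).1 hij
  exact Nat.ModEq.eq_of_lt_of_lt this hi hj

/-- As long as a path along `σ` avoids `x` and `y`, it is a path along `swap x y * σ`. -/
theorem sameCycle_swap_mul {z : Fin d} {n : ℕ}
    (h : ∀ j, 1 ≤ j → j < n → (σ ^ j) z ≠ x ∧ (σ ^ j) z ≠ y) :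
    ∀ j, j < n → (Equiv.swap x y * σ).SameCycle z ((σ ^ j) z) := by
  intro j
  induction j with
  | zero => exact fun _ => Equiv.Perm.SameCycle.refl _ _
  | succ j ih =>
    intro hj
    have h1 := h (j + 1) (by omega) hj
    have h2 : (Equiv.swap x y * σ) ((σ ^ j) z) = (σ ^ (j + 1)) z := by
      rw [Equiv.Perm.mul_apply, ← Equiv.Perm.mul_apply σ, ← pow_succ',
        Equiv.swap_apply_of_ne_of_ne h1.1 h1.2]
    rw [← h2, Equiv.Perm.sameCycle_apply_right]
    exact ih (by omega)

omit [DecidableEq L] in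
/-- A function that is invariant under `σ`, and whose fibres lie in single cycles, labels the cycles
of `σ`. -/
theorem label_eq_iff_sameCycle {c : Fin d → L} (h1 : ∀ a, c (σ a) = c a)
    (h2 : ∀ a a', c a = c a' → σ.SameCycle a a') (a a' : Fin d) :
    c a = c a' ↔ σ.SameCycle a a' := by
  refine ⟨h2 a a', fun h => ?_⟩
  obtain ⟨n, rfl⟩ := h.exists_nat_pow_eq
  clear h
  induction n with
  | zero => rfl
  | succ n ih => rw [ih, pow_succ', Equiv.Perm.mul_apply, h1]

/-- The labels after the cycles of `x` and `y` are joined to the cycle `s`. -/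
def joinLabel (c : Fin d → L) (x y : Fin d) (s : L) : Fin d → L :=
  fun a => if c a = c x ∨ c a = c y then s else c a

/-- The labels after the cycle of `x` is cut into the cycles `s`, with the first `k` elements, and
`s'`. -/
def cutLabel (σ : Equiv.Perm (Fin d)) (c : Fin d → L) (x : Fin d) (k : ℕ) (s s' : L) : Fin d → L :=
  fun a => if a ∈ (Finset.range k).image (fun j => (σ ^ j) x) then s else
    if c a = c x then s' else c a

theorem Marks.sameCycle_swap_mul_of_ne (h : Marks σ c A ℓ) {a a' : Fin d} (hx : c a ≠ c x)
    (hy : c a ≠ c y) (ha : c a = c a') : (Equiv.swap x y * σ).SameCycle a a' := by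
  obtain ⟨j, -, rfl⟩ := h.exists_pow_eq ha.symm
  refine sameCycle_swap_mul (n := j + 1) (fun i _ _ => ⟨?_, ?_⟩) j (Nat.lt_succ_self j)
  · rintro rfl
    exact hx (h.label_pow a i).symm
  · rintro rfl
    exact hy (h.label_pow a i).symm

theorem Marks.join (h : Marks σ c A ℓ) (hxy : c x ≠ c y) (hs : s ∉ A) :
    Marks (Equiv.swap x y * σ) (joinLabel c x y s) (insert s ((A.erase (c x)).erase (c y)))
      (Function.update ℓ s (ℓ (c x) + ℓ (c y))) := by
  have hcs : ∀ a, c a ≠ s := fun a e => hs (e ▸ h.mem a)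
  have hswap : ∀ a, joinLabel c x y s (Equiv.swap x y a) = joinLabel c x y s a := by
    intro a
    by_cases hax : a = x
    · simp [hax, joinLabel]
    by_cases hay : a = y
    · simp [hay, joinLabel]
    · rw [Equiv.swap_apply_of_ne_of_ne hax hay]
  have hfrom : ∀ x y : Fin d, c x ≠ c y → ∀ a, c a = c x →
      (Equiv.swap x y * σ).SameCycle x a := by
    intro x y hxy a ha
    obtain ⟨j, hj, rfl⟩ := h.exists_pow_eq ha
    refine sameCycle_swap_mul (fun i hi hi' => ⟨fun e => ?_, fun e => ?_⟩) j hj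
    · have := h.pow_inj (i := i) (j := 0) hi' (h.pos (h.mem x)) (by simpa using e)
      omega
    · exact hxy (by rw [← e, h.label_pow])
  have hjoin : (Equiv.swap x y * σ).SameCycle x y := by
    have h1 := hfrom x y hxy _ (h.label_pow x (ℓ (c x) - 1))
    have h2 : (Equiv.swap x y * σ) ((σ ^ (ℓ (c x) - 1)) x) = y := by
      rw [Equiv.Perm.mul_apply, ← Equiv.Perm.mul_apply σ, ← pow_succ',
        Nat.sub_add_cancel (h.pos (h.mem x)), h.pow_length, Equiv.swap_apply_left]
    have := Equiv.Perm.sameCycle_apply_right.2 h1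
    rwa [h2] at this
  have hall : ∀ a, c a = c x ∨ c a = c y → (Equiv.swap x y * σ).SameCycle x a := by
    rintro a (ha | ha)
    · exact hfrom x y hxy a ha
    · have := hfrom y x hxy.symm a ha
      rw [Equiv.swap_comm] at this
      exact hjoin.trans this
  refine ⟨label_eq_iff_sameCycle (fun a => ?_) fun a a' haa => ?_, ?_, fun p hp => ?_⟩
  · rw [Equiv.Perm.mul_apply, hswap]
    have : c (σ a) = c a := by simpa using h.label_pow a 1
    simp only [joinLabel, this]
  · simp only [joinLabel] at haa
    split_ifs at haa with h1 h2 h2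
    · exact (hall a h1).symm.trans (hall a' h2)
    · exact absurd haa.symm (hcs a')
    · exact absurd haa (hcs a)
    · push Not at h1
      exact h.sameCycle_swap_mul_of_ne h1.1 h1.2 haa
  · ext p
    simp only [Finset.mem_image, Finset.mem_univ, true_and, Finset.mem_insert, Finset.mem_erase,
      joinLabel]
    constructor
    · rintro ⟨a, rfl⟩
      split_ifs with h1
      · exact Or.inl rfl
      · push Not at h1
        exact Or.inr ⟨h1.2, h1.1, h.mem a⟩
    · rintro (rfl | ⟨h1, h2, h3⟩)
      · exact ⟨x, by simp⟩
      · rw [← h.image_eq, Finset.mem_image] at h3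
        obtain ⟨a, -, rfl⟩ := h3
        exact ⟨a, by simp [h1, h2]⟩
  · rcases Finset.mem_insert.1 hp with rfl | hp
    · have : (Finset.univ.filter fun a => joinLabel c x y p a = p) =
          (Finset.univ.filter fun a => c a = c x) ∪ Finset.univ.filter fun a => c a = c y := by
        ext a
        simp only [Finset.mem_filter, Finset.mem_univ, true_and, Finset.mem_union]
        refine ⟨fun e => ?_, fun e => if_pos e⟩
        by_contra h1
        rw [joinLabel, if_neg h1] at e
        exact hcs a e
      rw [Function.update_self, this, Finset.card_union_of_disjoint, h.length_eq _ (h.mem x),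
        h.length_eq _ (h.mem y)]
      rw [Finset.disjoint_filter]
      exact fun a _ h1 h2 => hxy (h1.symm.trans h2)
    · simp only [Finset.mem_erase] at hp
      have hps : p ≠ s := fun e => hs (e ▸ hp.2.2)
      rw [Function.update_of_ne hps, h.length_eq p hp.2.2]
      congr 1
      ext a
      simp only [Finset.mem_filter, Finset.mem_univ, true_and]
      by_cases h1 : c a = c x ∨ c a = c y
      · rw [joinLabel, if_pos h1]
        refine iff_of_false ?_ hps.symm
        rintro rfl
        exact h1.elim hp.2.1 hp.1
      · rw [joinLabel, if_neg h1]

theorem Marks.cut (h : Marks σ c A ℓ) (hk : 1 ≤ k) (hkℓ : k < ℓ (c x)) (hs : s ∉ A) (hs' : s' ∉ A)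
    (hss : s ≠ s') :
    Marks (Equiv.swap x ((σ ^ k) x) * σ) (cutLabel σ c x k s s')
      (insert s (insert s' (A.erase (c x))))
      (Function.update (Function.update ℓ s k) s' (ℓ (c x) - k)) := by
  have hcs : ∀ a, c a ≠ s := fun a e => hs (e ▸ h.mem a)
  have hcs' : ∀ a, c a ≠ s' := fun a e => hs' (e ▸ h.mem a)
  have hpos := h.pos (h.mem x)
  have hfst : ∀ j, j < k → cutLabel σ c x k s s' ((σ ^ j) x) = s := fun j hj =>
    if_pos (Finset.mem_image.2 ⟨j, Finset.mem_range.2 hj, rfl⟩)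
  have hsnd : ∀ j, k ≤ j → j < ℓ (c x) → cutLabel σ c x k s s' ((σ ^ j) x) = s' := by
    intro j hj hjℓ
    rw [cutLabel, if_neg, if_pos (h.label_pow x j)]
    intro hmem
    obtain ⟨i, hi, he⟩ := Finset.mem_image.1 hmem
    have hi := Finset.mem_range.1 hi
    have := h.pow_inj (hi.trans hkℓ) hjℓ he
    omega
  have hother : ∀ a, c a ≠ c x → cutLabel σ c x k s s' a = c a := by
    intro a ha
    rw [cutLabel, if_neg, if_neg ha]
    intro hmem
    obtain ⟨i, -, rfl⟩ := Finset.mem_image.1 hmem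
    exact ha (h.label_pow x i)
  have hxfix : ∀ j, 1 ≤ j → j < ℓ (c x) → (σ ^ j) x ≠ x := by
    intro j hj hjℓ e
    have := h.pow_inj (i := j) (j := 0) hjℓ hpos (by simpa using e)
    omega
  have hstep : ∀ j, (Equiv.swap x ((σ ^ k) x) * σ) ((σ ^ j) x) =
      Equiv.swap x ((σ ^ k) x) ((σ ^ (j + 1)) x) := fun j => by
    rw [Equiv.Perm.mul_apply, ← Equiv.Perm.mul_apply σ, ← pow_succ']
  have hsame₁ : ∀ j, j < k → (Equiv.swap x ((σ ^ k) x) * σ).SameCycle x ((σ ^ j) x) :=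
    sameCycle_swap_mul fun j hj hjk => ⟨hxfix j hj (hjk.trans hkℓ), fun e => by
      have := h.pow_inj (hjk.trans hkℓ) hkℓ e
      omega⟩
  have hsame₂ : ∀ j, k ≤ j → j < ℓ (c x) →
      (Equiv.swap x ((σ ^ k) x) * σ).SameCycle ((σ ^ k) x) ((σ ^ j) x) := by
    intro j hj hjℓ
    have e : ∀ i, (σ ^ i) ((σ ^ k) x) = (σ ^ (i + k)) x := fun i => by
      rw [pow_add, Equiv.Perm.mul_apply]
    have := sameCycle_swap_mul (σ := σ) (x := x) (y := (σ ^ k) x) (z := (σ ^ k) x)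
      (n := ℓ (c x) - k) (fun i hi hi' => by
        rw [e]
        refine ⟨hxfix _ (by omega) (by omega), fun he => ?_⟩
        have := h.pow_inj (by omega) hkℓ he
        omega) (j - k) (by omega)
    rwa [e, Nat.sub_add_cancel hj] at this
  refine ⟨label_eq_iff_sameCycle (fun a => ?_) fun a a' haa => ?_, ?_, fun p hp => ?_⟩
  · by_cases ha : c a = c x
    · obtain ⟨j, hj, rfl⟩ := h.exists_pow_eq ha
      rw [hstep]
      rcases lt_or_ge j k with hjk | hjk
      · rw [hfst j hjk]
        rcases eq_or_lt_of_le (show j + 1 ≤ k from hjk) with e | hlt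
        · rw [e, Equiv.swap_apply_right]
          simpa using hfst 0 (by omega)
        · rw [Equiv.swap_apply_of_ne_of_ne (hxfix _ (by omega) (by omega)), hfst _ hlt]
          intro he
          have := h.pow_inj (by omega) hkℓ he
          omega
      · rw [hsnd j hjk hj]
        rcases eq_or_lt_of_le (show j + 1 ≤ ℓ (c x) from hj) with e | hlt
        · rw [e, h.pow_length, Equiv.swap_apply_left]
          exact hsnd k le_rfl hkℓ
        · rw [Equiv.swap_apply_of_ne_of_ne (hxfix _ (by omega) (by omega)),
            hsnd _ (by omega) hlt]
          intro he
          have := h.pow_inj (by omega) hkℓ he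
          omega
    · have h1 : c (σ a) = c a := by simpa using h.label_pow a 1
      rw [Equiv.Perm.mul_apply, Equiv.swap_apply_of_ne_of_ne, hother _ ha, hother, h1]
      · rwa [h1]
      · rintro e
        exact ha (by rw [← h1, e])
      · rintro e
        exact ha (by rw [← h1, e, h.label_pow])
  · by_cases ha : c a = c x
    · obtain ⟨j, hj, rfl⟩ := h.exists_pow_eq ha
      have ha' : c a' = c x := by
        by_contra hne
        rw [hother a' hne] at haa
        rcases lt_or_ge j k with hjk | hjk
        · exact hcs a' (haa.symm.trans (hfst j hjk))
        · exact hcs' a' (haa.symm.trans (hsnd j hjk hj))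
      obtain ⟨i, hi, rfl⟩ := h.exists_pow_eq ha'
      rcases lt_or_ge j k with hjk | hjk <;> rcases lt_or_ge i k with hik | hik
      · exact (hsame₁ j hjk).symm.trans (hsame₁ i hik)
      · rw [hfst j hjk, hsnd i hik hi] at haa
        exact absurd haa hss
      · rw [hsnd j hjk hj, hfst i hik] at haa
        exact absurd haa.symm hss
      · exact (hsame₂ j hjk hj).symm.trans (hsame₂ i hik hi)
    · have ha' : c a' ≠ c x := by
        intro he
        obtain ⟨i, hi, rfl⟩ := h.exists_pow_eq he
        rw [hother a ha] at haa
        rcases lt_or_ge i k with hik | hik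
        · exact hcs a (haa.trans (hfst i hik))
        · exact hcs' a (haa.trans (hsnd i hik hi))
      rw [hother a ha, hother a' ha'] at haa
      exact h.sameCycle_swap_mul_of_ne ha (by rwa [h.label_pow]) haa
  · ext p
    simp only [Finset.mem_image, Finset.mem_univ, true_and, Finset.mem_insert, Finset.mem_erase]
    constructor
    · rintro ⟨a, rfl⟩
      by_cases ha : c a = c x
      · obtain ⟨j, hj, rfl⟩ := h.exists_pow_eq ha
        rcases lt_or_ge j k with hjk | hjk
        · exact Or.inl (hfst j hjk)
        · exact Or.inr (Or.inl (hsnd j hjk hj))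
      · rw [hother a ha]
        exact Or.inr (Or.inr ⟨ha, h.mem a⟩)
    · rintro (rfl | rfl | ⟨h1, h2⟩)
      · exact ⟨(σ ^ 0) x, hfst 0 (by omega)⟩
      · exact ⟨(σ ^ k) x, hsnd k le_rfl hkℓ⟩
      · rw [← h.image_eq, Finset.mem_image] at h2
        obtain ⟨a, -, rfl⟩ := h2
        exact ⟨a, hother a h1⟩
  · have hpow : ∀ T : Finset ℕ, (∀ j ∈ T, j < ℓ (c x)) →
        (T.image fun j => (σ ^ j) x).card = T.card := fun T hT =>
      Finset.card_image_of_injOn fun i hi j hj e => h.pow_inj (hT i hi) (hT j hj) e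
    by_cases hps' : p = s'
    · subst hps'
      have : (Finset.univ.filter fun a => cutLabel σ c x k s p a = p) =
          (Finset.Ico k (ℓ (c x))).image fun j => (σ ^ j) x := by
        ext a
        simp only [Finset.mem_filter, Finset.mem_univ, true_and, Finset.mem_image, Finset.mem_Ico]
        constructor
        · intro he
          have ha : c a = c x := by
            by_contra hne
            rw [hother a hne] at he
            exact hcs' a he
          obtain ⟨j, hj, rfl⟩ := h.exists_pow_eq ha
          refine ⟨j, ⟨?_, hj⟩, rfl⟩
          by_contra hjk
          rw [hfst j (by omega)] at he
          exact hss he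
        · rintro ⟨j, ⟨h1, h2⟩, rfl⟩
          exact hsnd j h1 h2
      rw [Function.update_self, this, hpow _ fun j hj => (Finset.mem_Ico.1 hj).2, Nat.card_Ico]
    rw [Function.update_of_ne hps']
    by_cases hps : p = s
    · subst hps
      have : (Finset.univ.filter fun a => cutLabel σ c x k p s' a = p) =
          (Finset.range k).image fun j => (σ ^ j) x := by
        ext a
        simp only [Finset.mem_filter, Finset.mem_univ, true_and, Finset.mem_image,
          Finset.mem_range]
        constructor
        · intro he
          have ha : c a = c x := by
            by_contra hne
            rw [hother a hne] at he
            exact hcs a he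
          obtain ⟨j, hj, rfl⟩ := h.exists_pow_eq ha
          refine ⟨j, ?_, rfl⟩
          by_contra hjk
          rw [hsnd j (by omega) hj] at he
          exact hss he.symm
        · rintro ⟨j, h1, rfl⟩
          exact hfst j h1
      rw [Function.update_self, this,
        hpow _ fun j hj => (Finset.mem_range.1 hj).trans hkℓ, Finset.card_range]
    rw [Function.update_of_ne hps]
    simp only [Finset.mem_insert, hps, hps', false_or, Finset.mem_erase] at hp
    rw [h.length_eq p hp.2]
    congr 1
    ext a
    simp only [Finset.mem_filter, Finset.mem_univ, true_and]
    by_cases ha : c a = c x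
    · refine iff_of_false (fun e => hp.1 (e ▸ ha)) ?_
      obtain ⟨j, hj, rfl⟩ := h.exists_pow_eq ha
      rcases lt_or_ge j k with hjk | hjk
      · rw [hfst j hjk]
        exact Ne.symm hps
      · rw [hsnd j hjk hj]
        exact Ne.symm hps'
    · rw [hother a ha]

theorem joinBlocks_joinLabel (b : L → L) (hcs : ∀ a, c a ≠ s) :
    joinBlocks b (c x) (c y) s ∘ joinLabel c x y s = mergeBlocks (b ∘ c) x y := by
  ext a
  rw [Function.comp_apply]
  by_cases h : c a = c x ∨ c a = c y
  · rw [joinLabel, if_pos h]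
    rcases h with h | h <;> simp [joinBlocks, mergeBlocks, h]
  · rw [joinLabel, if_neg h]
    simp [joinBlocks, mergeBlocks, hcs a]

theorem cutBlocks_cutLabel (b : L → L) (hcs : ∀ a, c a ≠ s) (hcs' : ∀ a, c a ≠ s') (hss : s ≠ s')
    (h : ∀ j, c ((σ ^ j) x) = c x) :
    cutBlocks b (c x) s s' ∘ cutLabel σ c x k s s' = mergeBlocks (b ∘ c) x ((σ ^ k) x) := by
  ext a
  simp only [Function.comp_apply, cutBlocks, cutLabel, mergeBlocks, h]
  have hif : (if b (c a) = b (c x) then b (c x) else b (c a)) = b (c a) := by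
    split_ifs with e
    · exact e.symm
    · rfl
  rw [hif]
  split_ifs with h1 h2
  · obtain ⟨j, -, rfl⟩ := Finset.mem_image.1 h1
    rw [Function.update_of_ne hss, Function.update_self, h]
  · rw [Function.update_self, h2]
  · rw [Function.update_of_ne (hcs' a), Function.update_of_ne (hcs a)]

end Marks

/-! ### Chains of transpositions and completions -/

section CountChains

theorem Multiset.eq_filter_two_le_add_replicate {s : Multiset ℕ} (hs : ∀ a ∈ s, 0 < a) :
    s = s.filter (2 ≤ ·) + Multiset.replicate (s.sum - (s.filter (2 ≤ ·)).sum) 1 := by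
  have h : s = s.filter (2 ≤ ·) + Multiset.replicate (s.filter (¬ 2 ≤ ·)).card 1 := by
    conv_lhs => rw [← Multiset.filter_add_not (2 ≤ ·) s]
    congr 1
    refine Multiset.eq_replicate_card.2 fun a ha => ?_
    obtain ⟨h1, h2⟩ := Multiset.mem_filter.1 ha
    have := hs a h1
    omega
  have h1 := congrArg Multiset.sum h
  rw [Multiset.sum_add, Multiset.sum_replicate, smul_eq_mul, mul_one] at h1
  rw [h1, Nat.add_sub_cancel_left]
  exact h

theorem Multiset.eq_of_filter_two_le_eq {s t : Multiset ℕ} (hs : ∀ a ∈ s, 0 < a)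
    (ht : ∀ a ∈ t, 0 < a) (h : s.filter (2 ≤ ·) = t.filter (2 ≤ ·)) (hsum : s.sum = t.sum) :
    s = t := by
  rw [Multiset.eq_filter_two_le_add_replicate hs, Multiset.eq_filter_two_le_add_replicate ht, h,
    hsum]

/-- Functions with the same multiset of values differ by a relabelling. -/
theorem exists_equiv_of_map_eq {ι κ : Type*} [Fintype ι] [Fintype κ] {f : ι → ℕ} {g : κ → ℕ}
    (h : (Finset.univ : Finset ι).val.map f = (Finset.univ : Finset κ).val.map g) :
    ∃ e : ι ≃ κ, ∀ i, g (e i) = f i := by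
  classical
  have hcard : ∀ a, Fintype.card {i // f i = a} = Fintype.card {j // g j = a} := by
    intro a
    have h1 := congrArg (Multiset.count a) h
    rw [Multiset.count_map, Multiset.count_map] at h1
    rw [Fintype.card_subtype, Fintype.card_subtype, Finset.card_def, Finset.card_def,
      Finset.filter_val, Finset.filter_val]
    simpa only [eq_comm] using h1
  exact ⟨Equiv.ofFiberEquiv fun a => Fintype.equivOfCardEq (hcard a),
    fun i => Equiv.ofFiberEquiv_map _ i⟩

variable {d m : ℕ} {L : Type*} [DecidableEq L] {σ : Equiv.Perm (Fin d)} {c : Fin d → L}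
  {A : Finset L} {ℓ : L → ℕ}

theorem Marks.cycleType_eq (h : Marks σ c A ℓ) :
    σ.cycleType = (A.val.map ℓ).filter (2 ≤ ·) := by
  have hne : ∀ f ∈ σ.cycleFactorsFinset.val, ∃ x, x ∈ f.support := fun f hf =>
    (Equiv.Perm.mem_cycleFactorsFinset_iff.1 hf).1.nonempty_support
  choose x hx using hne
  have hf : ∀ f hf, f = σ.cycleOf (x f hf) := fun f hf =>
    Equiv.Perm.cycle_is_cycleOf (hx f hf) hf
  have hmoved : ∀ f hf, σ (x f hf) ≠ x f hf := fun f hf =>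
    Equiv.Perm.mem_support.1 (Equiv.Perm.mem_cycleFactorsFinset_support_le hf (hx f hf))
  have hcard : ∀ y, σ y ≠ y → (σ.cycleOf y).support.card = ℓ (c y) := by
    intro y hy
    rw [h.length_eq _ (h.mem y)]
    congr 1
    ext a
    rw [Equiv.Perm.mem_support_cycleOf_iff' hy]
    simp only [Finset.mem_filter, Finset.mem_univ, true_and]
    rw [← h.eq_iff, eq_comm]
  rw [Equiv.Perm.cycleType_def, Multiset.filter_map]
  refine Multiset.map_eq_map_of_bij_of_nodup _ _ (Finset.nodup _)
    (Multiset.Nodup.filter _ A.nodup) (fun f hf => c (x f hf)) (fun f hf' => ?_)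
    (fun f hf' g hg' hfg => ?_) (fun p hp => ?_) fun f hf' => ?_
  · rw [Multiset.mem_filter]
    refine ⟨h.mem _, ?_⟩
    rw [Function.comp_apply, ← hcard _ (hmoved f hf')]
    exact Equiv.Perm.two_le_card_support_cycleOf_iff.2 (hmoved f hf')
  · rw [hf f hf', hf g hg']
    exact ((h.eq_iff _ _).1 hfg).cycleOf_eq
  · obtain ⟨hpA, hp2⟩ := Multiset.mem_filter.1 hp
    rw [Function.comp_apply, h.length_eq p hpA] at hp2
    obtain ⟨y, hy, z, hz, hyz⟩ := Finset.one_lt_card.1 hp2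
    simp only [Finset.mem_filter, Finset.mem_univ, true_and] at hy hz
    have hyσ : σ y ≠ y := by
      intro hfix
      obtain ⟨n, hn⟩ := ((h.eq_iff y z).1 (hy.trans hz.symm)).exists_nat_pow_eq
      exact hyz (by rw [← hn]; exact (Equiv.Perm.pow_apply_eq_self_of_apply_eq_self hfix n).symm)
    have hmem : σ.cycleOf y ∈ σ.cycleFactorsFinset.val :=
      by
      rw [Finset.mem_val]
      exact Equiv.Perm.cycleOf_mem_cycleFactorsFinset_iff.2 (Equiv.Perm.mem_support.2 hyσ)
    refine ⟨σ.cycleOf y, hmem, ?_⟩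
    have := (Equiv.Perm.mem_support_cycleOf_iff' hyσ).1 (hx _ hmem)
    rw [← hy]
    exact ((h.eq_iff _ _).2 this).symm
  · rw [Function.comp_apply, ← hcard _ (hmoved f hf'), ← hf f hf']

theorem Marks.parts_eq (h : Marks σ c A ℓ) : σ.partition.parts = A.val.map ℓ := by
  refine Multiset.eq_of_filter_two_le_eq (fun a ha => σ.partition.parts_pos ha) (fun a ha => ?_)
    ?_ ?_
  · obtain ⟨p, hp, rfl⟩ := Multiset.mem_map.1 ha
    exact h.pos hp
  · rw [Equiv.Perm.filter_parts_partition_eq_cycleType, h.cycleType_eq]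
  · rw [σ.partition.parts_sum]
    change _ = ∑ p ∈ A, ℓ p
    rw [Finset.sum_congr rfl h.length_eq, ← h.image_eq]
    exact Finset.card_eq_sum_card_image c Finset.univ

/-- The bijections from ends to strands of the right lengths are a torsor under `Aut α`. -/
theorem card_matchings (A : Finset L) (ℓ : L → ℕ) (α : Fin m → ℕ) :
    Nat.card {e : Fin m → L // (Function.Injective e ∧ Finset.univ.image e = A) ∧
      ∀ i, ℓ (e i) = α i} =
      if A.val.map ℓ = (Finset.univ : Finset (Fin m)).val.map α then autCard α else 0 := by
  split_ifs with h
  · have hA : (Finset.univ : Finset (Fin m)).val.map α =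
        (Finset.univ : Finset A).val.map fun p : A => ℓ p := by
      rw [← h, Finset.univ_eq_attach, Finset.attach_val]
      exact (Multiset.attach_map_val' A.val ℓ).symm
    obtain ⟨φ, hφ⟩ := exists_equiv_of_map_eq hA
    refine (Nat.card_congr (Equiv.ofBijective (fun π : {e : Equiv.Perm (Fin m) //
      ∀ i, α (e i) = α i} => (⟨fun i => (φ (π.1 i) : L), ⟨fun i j hij => ?_, ?_⟩,
        fun i => ?_⟩ : {e : Fin m → L // (Function.Injective e ∧ Finset.univ.image e = A) ∧
      ∀ i, ℓ (e i) = α i})) ⟨fun π π' hπ => ?_, fun e => ?_⟩)).symm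
    · exact π.1.injective (φ.injective (Subtype.ext hij))
    · ext p
      simp only [Finset.mem_image, Finset.mem_univ, true_and]
      exact ⟨fun ⟨i, hi⟩ => hi ▸ (φ _).2, fun hp => ⟨π.1.symm (φ.symm ⟨p, hp⟩), by simp⟩⟩
    · rw [hφ, π.2 i]
    · refine Subtype.ext (Equiv.ext fun i => ?_)
      have := congrFun (congrArg Subtype.val hπ) i
      exact φ.injective (Subtype.ext this)
    · obtain ⟨e, ⟨hinj, hA⟩, hℓ⟩ := e
      have hmem : ∀ i, e i ∈ A := fun i => hA ▸ Finset.mem_image_of_mem e (Finset.mem_univ i)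
      have hinj' : Function.Injective fun i => φ.symm ⟨e i, hmem i⟩ := fun i j hij => by
        have := φ.symm.injective hij
        exact hinj (Subtype.ext_iff.1 this)
      refine ⟨⟨Equiv.ofBijective _ (Finite.injective_iff_bijective.1 hinj'), fun i => ?_⟩, ?_⟩
      · rw [← hφ]
        simp [hℓ]
      · refine Subtype.ext (funext fun i => ?_)
        simp
  · rw [Nat.card_eq_zero]
    left
    refine ⟨fun ⟨e, ⟨hinj, hA⟩, hℓ⟩ => h ?_⟩
    rw [← hA, Finset.image_val_of_injOn hinj.injOn, Multiset.map_map]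
    exact Multiset.map_congr rfl fun i _ => hℓ i

omit [DecidableEq L] in
theorem connects_zero_iff {κ : Fin d → L} (τ : Fin 0 → Equiv.Perm (Fin d)) :
    Connects κ τ ↔ ∀ x y, κ x = κ y := by
  constructor
  · intro h x y
    have := h {a | κ x = κ a} (fun a a' haa ha => ha.trans haa) (fun i => i.elim0) ⟨x, rfl⟩
    have hy : y ∈ {a | κ x = κ a} := by
      rw [this]
      exact Set.mem_univ y
    exact hy
  · intro h S hS _ hne
    obtain ⟨x, hx⟩ := hne
    exact Set.eq_univ_of_forall fun y => hS x y (h x y) hx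

theorem Marks.autCard_mul_ncard_chains_zero (h : Marks σ c A ℓ) (α : Fin m → ℕ) (b : L → L) :
    autCard α * (chains α 0 σ (b ∘ c)).ncard =
      Nat.card {e : Fin m → L // IsMatching A b e ∧ ∀ i, ℓ (e i) = α i} := by
  by_cases hb : ∀ x y, (b ∘ c) x = (b ∘ c) y
  · have hbA : ∀ p ∈ A, ∀ q ∈ A, b p = b q := by
      intro p hp q hq
      rw [← h.image_eq, Finset.mem_image] at hp hq
      obtain ⟨x, -, rfl⟩ := hp
      obtain ⟨y, -, rfl⟩ := hq
      exact hb x y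
    have hiff : ∀ e : Fin m → L, (IsMatching A b e ∧ ∀ i, ℓ (e i) = α i) ↔
        (Function.Injective e ∧ Finset.univ.image e = A) ∧ ∀ i, ℓ (e i) = α i := by
      intro e
      refine and_congr_left fun _ => ⟨fun he => ⟨he.1, he.2.1⟩, fun he => ⟨he.1, he.2, ?_⟩⟩
      intro i j
      refine hbA _ ?_ _ ?_ <;> exact he.2 ▸ Finset.mem_image_of_mem e (Finset.mem_univ _)
    simp only [hiff]
    rw [card_matchings, ← h.parts_eq]
    by_cases hα : InClass α σ
    · have : chains α 0 σ (b ∘ c) = {Fin.elim0} := by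
        ext τ
        simp only [chains, Set.mem_ofPred_eq, Set.mem_singleton_iff, connects_zero_iff]
        exact iff_of_true ⟨fun i => i.elim0, by simpa using hα, fun x y => hb x y⟩
          (Subsingleton.elim _ _)
      rw [this, Set.ncard_singleton, mul_one, if_pos]
      exact hα
    · have : chains α 0 σ (b ∘ c) = ∅ := by
        ext τ
        simp [chains, hα]
      rw [this, Set.ncard_empty, mul_zero, if_neg]
      exact hα
  · have : chains α 0 σ (b ∘ c) = ∅ := by
      ext τ
      simp only [chains, Set.mem_ofPred_eq, connects_zero_iff, hb, and_false,
        Set.mem_empty_iff_false]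
    rw [this, Set.ncard_empty, mul_zero, eq_comm, Nat.card_eq_zero]
    left
    refine ⟨fun ⟨e, he, _⟩ => hb fun x y => ?_⟩
    have hx := h.mem x
    have hy := h.mem y
    rw [← he.2.1, Finset.mem_image] at hx hy
    obtain ⟨i, -, hi⟩ := hx
    obtain ⟨j, -, hj⟩ := hy
    rw [Function.comp_apply, Function.comp_apply, ← hi, ← hj]
    exact he.2.2 i j

/-- A sum over the ordered pairs of sheets splits into the pairs in different cycles, which depend
on the two cycles only, and those in one cycle, which depend on the cycle and the distance. -/
theorem Marks.sum_offDiag (h : Marks σ c A ℓ) (T : Fin d → Fin d → ℚ) (C : L → L → ℚ)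
    (C' : L → ℕ → ℚ) (hC : ∀ x y, c x ≠ c y → T x y = C (c x) (c y))
    (hC' : ∀ x k, 1 ≤ k → k < ℓ (c x) → T x ((σ ^ k) x) = C' (c x) k) :
    ∑ z ∈ (Finset.univ : Finset (Fin d)).offDiag, T z.1 z.2 =
      ∑ p ∈ A, ∑ q ∈ A.erase p, (ℓ p : ℚ) * ℓ q * C p q +
        ∑ p ∈ A, ∑ k ∈ Finset.Ico 1 (ℓ p), (ℓ p : ℚ) * C' p k := by
  have hx : ∀ x, ∑ y ∈ Finset.univ.erase x, T x y =
      ∑ q ∈ A.erase (c x), (ℓ q : ℚ) * C (c x) q + ∑ k ∈ Finset.Ico 1 (ℓ (c x)), C' (c x) k := by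
    intro x
    have hpos := h.pos (h.mem x)
    rw [← Finset.sum_filter_add_sum_filter_not _ fun y => c y ≠ c x]
    congr 1
    · rw [Finset.sum_congr rfl fun y hy => hC x y (Finset.mem_filter.1 hy).2.symm,
        Finset.sum_comp (C (c x)) c]
      have : ((Finset.univ.erase x).filter fun y => c y ≠ c x).image c = A.erase (c x) := by
        ext q
        simp only [Finset.mem_image, Finset.mem_filter, Finset.mem_erase, Finset.mem_univ,
          and_true]
        constructor
        · rintro ⟨y, ⟨-, hy⟩, rfl⟩
          exact ⟨hy, h.mem y⟩
        · rintro ⟨hq, hqA⟩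
          rw [← h.image_eq, Finset.mem_image] at hqA
          obtain ⟨y, -, rfl⟩ := hqA
          exact ⟨y, ⟨fun e => hq (e ▸ rfl), hq⟩, rfl⟩
      rw [this]
      refine Finset.sum_congr rfl fun q hq => ?_
      rw [h.length_eq q (Finset.mem_of_mem_erase hq), nsmul_eq_mul]
      congr 3
      ext y
      simp only [Finset.mem_filter, Finset.mem_erase, Finset.mem_univ, and_true, true_and]
      refine ⟨fun e => e.2, fun e => ⟨⟨?_, ?_⟩, e⟩⟩
      · rintro rfl
        exact (Finset.ne_of_mem_erase hq) e.symm
      · rw [e]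
        exact Finset.ne_of_mem_erase hq
    · have : ((Finset.univ.erase x).filter fun y => ¬ c y ≠ c x) =
          (Finset.Ico 1 (ℓ (c x))).image fun k => (σ ^ k) x := by
        ext y
        simp only [Finset.mem_filter, Finset.mem_erase, Finset.mem_univ, and_true, not_not,
          Finset.mem_image, Finset.mem_Ico]
        constructor
        · rintro ⟨hyx, hy⟩
          obtain ⟨j, hj, rfl⟩ := h.exists_pow_eq hy
          refine ⟨j, ⟨?_, hj⟩, rfl⟩
          by_contra h0
          obtain rfl : j = 0 := by omega
          exact hyx (by simp)
        · rintro ⟨k, ⟨hk1, hk2⟩, rfl⟩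
          refine ⟨fun e => ?_, h.label_pow x k⟩
          have := h.pow_inj (i := k) (j := 0) hk2 hpos (by simpa using e)
          omega
      rw [this, Finset.sum_image]
      · refine Finset.sum_congr rfl fun k hk => ?_
        obtain ⟨hk1, hk2⟩ := Finset.mem_Ico.1 hk
        exact hC' x k hk1 hk2
      · intro i hi j hj e
        exact h.pow_inj (Finset.mem_Ico.1 hi).2 (Finset.mem_Ico.1 hj).2 e
  rw [Finset.sum_finset_product (Finset.univ : Finset (Fin d)).offDiag Finset.univ
    (fun x => Finset.univ.erase x) fun z => by
      simp only [Finset.mem_offDiag, Finset.mem_univ, true_and, Finset.mem_erase, and_true]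
      exact ne_comm]
  rw [Finset.sum_congr rfl fun x _ => hx x, Finset.sum_comp
    (fun p => ∑ q ∈ A.erase p, (ℓ q : ℚ) * C p q + ∑ k ∈ Finset.Ico 1 (ℓ p), C' p k) c,
    h.image_eq, ← Finset.sum_add_distrib]
  refine Finset.sum_congr rfl fun p hp => ?_
  rw [← h.length_eq p hp, nsmul_eq_mul, mul_add, Finset.mul_sum, Finset.mul_sum]
  simp only [mul_assoc]

/-- The completions count the chains of transpositions from a permutation with labelled cycles. -/
theorem autCard_mul_ncard_chains (α : Fin m → ℕ) (fr : List (L × L)) :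
    ∀ {σ : Equiv.Perm (Fin d)} {c : Fin d → L} {A Z : Finset L} {ℓ : L → ℕ} (b : L → L),
      Marks σ c A ℓ → A ⊆ Z → Fresh fr Z →
      (autCard α : ℚ) * (chains α fr.length σ (b ∘ c)).ncard = completions α fr A b ℓ := by
  induction fr with
  | nil =>
    intro σ c A Z ℓ b h _ _
    rw [completions, List.length_nil, ← h.autCard_mul_ncard_chains_zero]
    push_cast
    rfl
  | cons a fr ih =>
    obtain ⟨s, s'⟩ := a
    intro σ c A Z ℓ b h hAZ hfr
    obtain ⟨hs, hs', hss, hfr'⟩ := hfr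
    have hsA : s ∉ A := fun hmem => hs (hAZ hmem)
    have hsA' : s' ∉ A := fun hmem => hs' (hAZ hmem)
    have hcs : ∀ a, c a ≠ s := fun a e => hsA (e ▸ h.mem a)
    have hcs' : ∀ a, c a ≠ s' := fun a e => hsA' (e ▸ h.mem a)
    have h2 : (2 : ℚ) * ((autCard α : ℚ) * (chains α (fr.length + 1) σ (b ∘ c)).ncard) =
        ∑ z ∈ (Finset.univ : Finset (Fin d)).offDiag, (autCard α : ℚ) *
          (chains α fr.length (Equiv.swap z.1 z.2 * σ) (mergeBlocks (b ∘ c) z.1 z.2)).ncard := by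
      rw [mul_left_comm, ← Finset.mul_sum]
      congr 1
      exact_mod_cast ncard_chains_succ α fr.length σ (b ∘ c)
    rw [h.sum_offDiag (fun x y => (autCard α : ℚ) *
      (chains α fr.length (Equiv.swap x y * σ) (mergeBlocks (b ∘ c) x y)).ncard)
      (fun p q => completions α fr (insert s ((A.erase p).erase q)) (joinBlocks b p q s)
        (Function.update ℓ s (ℓ p + ℓ q)))
      (fun p k => completions α fr (insert s (insert s' (A.erase p))) (cutBlocks b p s s')
        (Function.update (Function.update ℓ s k) s' (ℓ p - k)))] at h2
    · rw [List.length_cons, completions, ← h2]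
      ring
    · intro x y hxy
      rw [← joinBlocks_joinLabel b hcs]
      refine ih (Z := insert s (insert s' Z)) _ (h.join hxy hsA) (fun a ha => ?_) hfr'
      rcases Finset.mem_insert.1 ha with rfl | ha
      · simp
      · have := hAZ (Finset.mem_of_mem_erase (Finset.mem_of_mem_erase ha))
        simp [this]
    · intro x k hk hkℓ
      rw [← cutBlocks_cutLabel b hcs hcs' hss (h.label_pow x)]
      refine ih (Z := insert s (insert s' Z)) _ (h.cut hk hkℓ hsA hsA' hss) (fun a ha => ?_) hfr'
      rcases Finset.mem_insert.1 ha with rfl | ha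
      · simp
      rcases Finset.mem_insert.1 ha with rfl | ha
      · simp
      · have := hAZ (Finset.mem_of_mem_erase ha)
        simp [this]

end CountChains

/-! ### Double Hurwitz numbers as completions -/

section HurwitzNumbers

variable {d m n : ℕ} {L : Type*}

/-- The group generated by `σ` and the `τ i` is transitive if and only if the `τ i` connect the
cycles of `σ`. -/
theorem isPretransitive_iff_connects {r : ℕ} {σ : Equiv.Perm (Fin d)} {c : Fin d → L}
    (hc : ∀ x y, c x = c y ↔ σ.SameCycle x y) {τ : Fin r → Equiv.Perm (Fin d)}
    (hτ : ∀ i, (τ i).IsSwap) :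
    MulAction.IsPretransitive (Subgroup.closure (insert σ (Set.range τ))) (Fin d) ↔
      Connects c τ := by
  constructor
  · intro h S hS hτS hne
    have hinv : ∀ g ∈ Subgroup.closure (insert σ (Set.range τ)), ∀ a, g a ∈ S ↔ a ∈ S := by
      intro g hg
      induction hg using Subgroup.closure_induction with
      | mem g hg =>
        intro a
        rcases hg with rfl | ⟨i, rfl⟩
        · have : c (g a) = c a :=
            (hc _ _).2 (Equiv.Perm.sameCycle_apply_left.2 (Equiv.Perm.SameCycle.refl _ _))
          exact ⟨hS _ _ this, hS _ _ this.symm⟩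
        · refine ⟨fun h => ?_, hτS i a⟩
          obtain ⟨x, y, -, hxy⟩ := hτ i
          have := hτS i _ h
          rwa [hxy, Equiv.swap_apply_self] at this
      | one => exact fun a => Iff.rfl
      | mul g g' _ _ h1 h2 => exact fun a => (h1 _).trans (h2 a)
      | inv g _ h1 =>
        intro a
        rw [← h1 (g⁻¹ a)]
        simp
    obtain ⟨x, hx⟩ := hne
    refine Set.eq_univ_of_forall fun y => ?_
    obtain ⟨⟨g, hg⟩, hgx⟩ := h.exists_smul_eq x y
    have h1 : g x = y := hgx
    rw [← h1]
    exact (hinv g hg x).2 hx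
  · intro h
    refine ⟨fun x y => ?_⟩
    have hS := h {y | ∃ g : Subgroup.closure (insert σ (Set.range τ)), g • x = y}
      (fun a a' haa ⟨g, hg⟩ => ?_) (fun i a ⟨g, hg⟩ => ?_) ⟨x, 1, one_smul _ _⟩
    · have : y ∈ {y | ∃ g : Subgroup.closure (insert σ (Set.range τ)), g • x = y} := by
        rw [hS]
        exact Set.mem_univ y
      exact this
    · obtain ⟨k, hk⟩ := (hc a a').1 haa
      refine ⟨⟨σ ^ k, Subgroup.zpow_mem _ (Subgroup.subset_closure (Set.mem_insert _ _)) k⟩ * g, ?_⟩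
      rw [mul_smul, hg]
      exact hk
    · refine ⟨⟨τ i, Subgroup.subset_closure (Set.mem_insert_of_mem _ ⟨i, rfl⟩)⟩ * g, ?_⟩
      rw [mul_smul, hg]
      rfl

theorem mem_transitiveFactorizations_iff {r : ℕ} {α : Fin m → ℕ} {β : Fin n → ℕ}
    {σ γ : Equiv.Perm (Fin d)} {τ : Fin r → Equiv.Perm (Fin d)} {c : Fin d → L}
    (hc : ∀ x y, c x = c y ↔ σ.SameCycle x y) :
    (σ, τ, γ) ∈ transitiveFactorizations d r α β ↔
      InClass β σ ∧ τ ∈ chains α r σ c ∧ (List.ofFn τ).reverse.prod * σ = γ := by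
  simp only [transitiveFactorizations, chains, Set.mem_ofPred_eq]
  constructor
  · rintro ⟨h1, h2, h3, h4, h5⟩
    exact ⟨h1, ⟨h3, h4 ▸ h2, (isPretransitive_iff_connects hc h3).1 h5⟩, h4⟩
  · rintro ⟨h1, ⟨h2, h3, h4⟩, h5⟩
    exact ⟨h1, h5 ▸ h3, h2, h5, (isPretransitive_iff_connects hc h2).2 h4⟩

variable [DecidableEq L]

/-- The cycles of a permutation of class `β` can be labelled by the indices of the entries of
`β`. -/
theorem exists_marks {β : Fin n → ℕ} {σ : Equiv.Perm (Fin d)} (h : InClass β σ) (f : Fin n ↪ L)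
    {ℓ : L → ℕ} (hℓ : ∀ j, ℓ (f j) = β j) : ∃ c, Marks σ c (Finset.univ.image f) ℓ := by
  classical
  let c₀ : Fin d → Quotient (Equiv.Perm.SameCycle.setoid σ) := Quotient.mk _
  have hc₀ : Marks σ c₀ Finset.univ fun q => (Finset.univ.filter fun x => c₀ x = q).card :=
    ⟨fun x y => Quotient.eq, Finset.image_univ_of_surjective Quotient.mk_surjective,
      fun _ _ => rfl⟩
  obtain ⟨e, he⟩ := exists_equiv_of_map_eq (hc₀.parts_eq.symm.trans h)
  refine ⟨fun x => f (e (c₀ x)), fun x y => ?_, ?_, fun p hp => ?_⟩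
  · rw [f.injective.eq_iff, e.injective.eq_iff]
    exact hc₀.eq_iff x y
  · ext p
    simp only [Finset.mem_image, Finset.mem_univ, true_and]
    constructor
    · rintro ⟨x, rfl⟩
      exact ⟨_, rfl⟩
    · rintro ⟨j, rfl⟩
      obtain ⟨x, hx⟩ := Quotient.mk_surjective (e.symm j)
      exact ⟨x, by rw [show c₀ x = e.symm j from hx, e.apply_symm_apply]⟩
  · obtain ⟨j, -, rfl⟩ := Finset.mem_image.1 hp
    rw [hℓ, ← e.apply_symm_apply j, he]
    simp only [f.injective.eq_iff, e.injective.eq_iff]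

theorem card_filter_parts_eq {M : Multiset ℕ} (hM : ∀ a ∈ M, 0 < a) (hd : M.sum = d) :
    (Finset.univ.filter fun σ : Equiv.Perm (Fin d) => σ.partition.parts = M).card *
      (M.prod * ∏ a ∈ M.toFinset, (M.count a).factorial) = d.factorial := by
  have hMM := Multiset.eq_filter_two_le_add_replicate hM
  rw [hd] at hMM
  set N := M.filter (2 ≤ ·) with hN
  have hN2 : ∀ a ∈ N, 2 ≤ a := fun a ha => (Multiset.mem_filter.1 ha).2
  have h := Equiv.Perm.card_of_cycleType_mul_eq (Fin d) N
  have hsum : N.sum ≤ d := by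
    have := congrArg Multiset.sum hMM
    rw [Multiset.sum_add, hd] at this
    omega
  rw [if_pos ⟨by simpa using hsum, hN2⟩, Fintype.card_fin] at h
  rw [← h]
  have hprod : M.prod = N.prod := by
    conv_lhs => rw [hMM]
    simp
  have h1N : 1 ∉ N := fun h => by
    have := hN2 1 h
    omega
  have hcount : ∏ a ∈ M.toFinset, (M.count a).factorial =
      (d - N.sum).factorial * ∏ a ∈ N.toFinset, (N.count a).factorial := by
    have hsub : M.toFinset ⊆ insert 1 N.toFinset := by
      intro a ha
      rw [Multiset.mem_toFinset] at ha
      rw [Finset.mem_insert, Multiset.mem_toFinset]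
      by_cases ha2 : 2 ≤ a
      · exact Or.inr (Multiset.mem_filter.2 ⟨ha, ha2⟩)
      · have := hM a ha
        left
        omega
    rw [Finset.prod_subset hsub, Finset.prod_insert (by rwa [Multiset.mem_toFinset])]
    · congr 1
      · conv_lhs => rw [hMM]
        rw [Multiset.count_add, Multiset.count_eq_zero_of_notMem h1N, zero_add,
          Multiset.count_replicate_self]
      · refine Finset.prod_congr rfl fun a ha => ?_
        have := hN2 a (Multiset.mem_toFinset.1 ha)
        conv_lhs => rw [hMM]
        rw [Multiset.count_add, Multiset.count_replicate, if_neg (by omega), add_zero]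
    · intro a _ ha
      rw [Multiset.count_eq_zero_of_notMem fun h => ha (Multiset.mem_toFinset.2 h),
        Nat.factorial_zero]
  have hfilter : (Finset.univ.filter fun σ : Equiv.Perm (Fin d) => σ.partition.parts = M) =
      Finset.univ.filter fun σ : Equiv.Perm (Fin d) => σ.cycleType = N := by
    refine Finset.filter_congr fun σ _ => ⟨fun h => ?_, fun h => ?_⟩
    · rw [← Equiv.Perm.filter_parts_partition_eq_cycleType, h]
    · refine Multiset.eq_of_filter_two_le_eq (fun a ha => σ.partition.parts_pos ha) hM ?_ ?_
      · rw [Equiv.Perm.filter_parts_partition_eq_cycleType, h]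
      · rw [σ.partition.parts_sum, hd, Fintype.card_fin]
  rw [hfilter, hprod, hcount]
  ring

theorem autCard_eq (β : Fin n → ℕ) :
    autCard β = ∏ a ∈ ((Finset.univ : Finset (Fin n)).val.map β).toFinset,
      (((Finset.univ : Finset (Fin n)).val.map β).count a).factorial := by
  have h := DomMulAct.stabilizer_card' β
  have h1 : autCard β = Fintype.card {g : Equiv.Perm (Fin n) // β ∘ g = β} := by
    rw [autCard, ← Nat.card_eq_fintype_card]
    refine Nat.card_congr (Equiv.subtypeEquivRight fun e => ?_)
    rw [funext_iff]
    rfl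
  rw [h1, h]
  refine Finset.prod_congr (by ext; simp) fun a _ => ?_
  rw [Multiset.count_map, Fintype.card_subtype, Finset.card_def, Finset.filter_val]
  simp only [eq_comm]

/-- The size of the class of `β`: the centralizer of a permutation in it has order
`(∏ j, β j) * |Aut β|`. -/
theorem card_class_mul (β : Fin n → ℕ) (hβ : ∀ j, 0 < β j) (hd : ∑ j, β j = d) :
    {σ : Equiv.Perm (Fin d) | InClass β σ}.ncard * ((∏ j, β j) * autCard β) = d.factorial := by
  rw [autCard_eq, ← card_filter_parts_eq (M := (Finset.univ : Finset (Fin n)).val.map β)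
    (by simpa using hβ) hd, ← Set.ncard_coe_finset, Finset.coe_filter]
  simp only [InClass, Finset.mem_univ, true_and]
  rfl

theorem doubleHurwitz_eq_completions (g : ℕ) {α : Fin m → ℕ} {β : Fin n → ℕ}
    (hβ : ∀ j, 0 < β j) (hαβ : ∑ i, α i = ∑ j, β j) (f : Fin n ↪ L) {ℓ : L → ℕ}
    (hℓ : ∀ j, ℓ (f j) = β j) {fr : List (L × L)} (hr : fr.length = 2 * g + m + n - 2)
    (hfr : Fresh fr (Finset.univ.image f)) :
    doubleHurwitz g α β =
      completions α fr (Finset.univ.image f) id ℓ / ∏ j, (β j : ℚ) := by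
  classical
  rw [doubleHurwitz, ← hr]
  generalize hd : ∑ i, α i = d at hαβ
  have hcount : ∀ σ : Equiv.Perm (Fin d), InClass β σ →
      (autCard α : ℚ) * ((transitiveFactorizations d fr.length α β).toFinset.filter
        fun z => z.1 = σ).card = completions α fr (Finset.univ.image f) id ℓ := by
    intro σ hσ
    obtain ⟨c, hc⟩ := exists_marks hσ f hℓ
    rw [← autCard_mul_ncard_chains α fr id hc (Finset.Subset.refl _) hfr, Function.id_comp,
      ← Set.ncard_coe_finset]
    congr 2
    symm
    refine Set.ncard_congr (fun τ _ => (σ, τ, (List.ofFn τ).reverse.prod * σ)) (fun τ hτ => ?_)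
      (fun τ τ' _ _ h => ?_) fun z hz => ?_
    · simp only [Finset.coe_filter, Set.mem_toFinset, Set.mem_ofPred_eq, and_true]
      exact (mem_transitiveFactorizations_iff hc.eq_iff).2 ⟨hσ, hτ, rfl⟩
    · exact congrArg (fun z => z.2.1) h
    · obtain ⟨σ', τ, γ⟩ := z
      simp only [Finset.coe_filter, Set.mem_toFinset, Set.mem_ofPred_eq] at hz
      obtain ⟨hz, rfl⟩ := hz
      obtain ⟨-, h2, h3⟩ := (mem_transitiveFactorizations_iff hc.eq_iff).1 hz
      exact ⟨τ, h2, by rw [h3]⟩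
  have hsum : (autCard α : ℚ) * (transitiveFactorizations d fr.length α β).ncard =
      {σ : Equiv.Perm (Fin d) | InClass β σ}.ncard *
        completions α fr (Finset.univ.image f) id ℓ := by
    rw [Set.ncard_eq_toFinset_card', Set.ncard_eq_toFinset_card',
      Finset.card_eq_sum_card_fiberwise (f := fun z => z.1)
        (t := {σ : Equiv.Perm (Fin d) | InClass β σ}.toFinset) (fun z hz => by
          simp only [Set.coe_toFinset] at hz ⊢
          exact hz.1), Nat.cast_sum, Finset.mul_sum,
      Finset.sum_congr rfl fun σ hσ => hcount σ
        ((Set.mem_toFinset (s := {σ : Equiv.Perm (Fin d) | InClass β σ})).1 hσ), Finset.sum_const,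
      nsmul_eq_mul]
  have hclass : (({σ : Equiv.Perm (Fin d) | InClass β σ}.ncard : ℕ) : ℚ) *
      ((∏ j, (β j : ℚ)) * autCard β) = d.factorial := by
    exact_mod_cast card_class_mul β hβ hαβ.symm
  have h1 : (∏ j, (β j : ℚ)) ≠ 0 := Finset.prod_ne_zero_iff.2 fun j _ => by
    exact_mod_cast (hβ j).ne'
  have h2 : (d.factorial : ℚ) ≠ 0 := by exact_mod_cast d.factorial_ne_zero
  rw [eq_div_iff h1, div_mul_eq_mul_div, div_mul_eq_mul_div, div_eq_iff h2, ← hclass]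
  linear_combination ((autCard β : ℚ) * ∏ j, (β j : ℚ)) * hsum

end HurwitzNumbers

/-! ### A lower bound for completions -/

section LowerBound

variable {L : Type*} [DecidableEq L] {m : ℕ} {α : Fin m → ℕ}

theorem completions_nonneg (α : Fin m → ℕ) (fr : List (L × L)) :
    ∀ (A : Finset L) (b : L → L) (ℓ : L → ℕ), 0 ≤ completions α fr A b ℓ := by
  induction fr with
  | nil =>
    intro A b ℓ
    rw [completions]
    positivity
  | cons a fr ih =>
    obtain ⟨s, s'⟩ := a
    intro A b ℓ
    rw [completions]
    refine mul_nonneg (by norm_num) (add_nonneg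
      (Finset.sum_nonneg fun p _ => Finset.sum_nonneg fun q _ => mul_nonneg (by positivity) (ih ..))
      (Finset.sum_nonneg fun p _ => Finset.sum_nonneg fun k _ => mul_nonneg (by positivity) (ih ..)))

theorem le_completions_of_join {s s' : L} (fr : List (L × L)) {A : Finset L} (b : L → L)
    (ℓ : L → ℕ) {p q : L} (hp : p ∈ A) (hq : q ∈ A.erase p) :
    1 / 2 * ((ℓ p : ℚ) * ℓ q * completions α fr (insert s ((A.erase p).erase q))
      (joinBlocks b p q s) (Function.update ℓ s (ℓ p + ℓ q))) ≤
        completions α ((s, s') :: fr) A b ℓ := by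
  have hnn := completions_nonneg α fr
  rw [completions]
  refine mul_le_mul_of_nonneg_left (le_add_of_le_of_nonneg ?_ (Finset.sum_nonneg fun p _ =>
    Finset.sum_nonneg fun k _ => mul_nonneg (by positivity) (hnn ..))) (by norm_num)
  refine le_trans ?_ (Finset.single_le_sum (fun p _ => Finset.sum_nonneg fun q _ =>
    mul_nonneg (by positivity) (hnn ..)) hp)
  exact Finset.single_le_sum (f := fun q => (ℓ p : ℚ) * ℓ q * completions α fr
    (insert s ((A.erase p).erase q)) (joinBlocks b p q s) (Function.update ℓ s (ℓ p + ℓ q)))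
    (fun q _ => mul_nonneg (by positivity) (hnn ..)) hq

theorem le_completions_of_cut {s s' : L} (fr : List (L × L)) {A : Finset L} (b : L → L)
    (ℓ : L → ℕ) {p : L} (hp : p ∈ A) :
    1 / 2 * (∑ k ∈ Finset.Ico 1 (ℓ p), (ℓ p : ℚ) * completions α fr
      (insert s (insert s' (A.erase p))) (cutBlocks b p s s')
      (Function.update (Function.update ℓ s k) s' (ℓ p - k))) ≤
        completions α ((s, s') :: fr) A b ℓ := by
  have hnn := completions_nonneg α fr
  rw [completions]
  refine mul_le_mul_of_nonneg_left (le_add_of_nonneg_of_le (Finset.sum_nonneg fun p _ =>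
    Finset.sum_nonneg fun k _ => mul_nonneg (by positivity) (hnn ..)) ?_) (by norm_num)
  exact Finset.single_le_sum (f := fun p => ∑ k ∈ Finset.Ico 1 (ℓ p), (ℓ p : ℚ) *
    completions α fr (insert s (insert s' (A.erase p))) (cutBlocks b p s s')
      (Function.update (Function.update ℓ s k) s' (ℓ p - k)))
    (fun p _ => Finset.sum_nonneg fun k _ => mul_nonneg (by positivity) (hnn ..)) hp

/-- The ends can be cut off one at a time from strands that carry them. -/
theorem le_completions_of_assignment {t : ℕ} (ht : 0 < t) (hα : ∀ i, t ≤ α i)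
    (fr : List (L × L)) : ∀ {A Z : Finset L} {b : L → L} {ℓ : L → ℕ} (φ : Fin m → L),
      A ⊆ Z → Fresh fr Z → A.card + fr.length = m → (∀ p ∈ A, ∀ q ∈ A, b p = b q) →
      Finset.univ.image φ = A → (∀ p ∈ A, ℓ p = ∑ i with φ i = p, α i) →
      ((t : ℚ) / 2) ^ fr.length ≤ completions α fr A b ℓ := by
  induction fr with
  | nil =>
    intro A Z b ℓ φ _ _ hcard hb hφ hℓ
    have hinj : Function.Injective φ := by
      rw [← Set.injOn_univ, ← Finset.coe_univ, ← Finset.card_image_iff, hφ, Finset.card_univ,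
        Fintype.card_fin, ← hcard]
      rfl
    have hmem : ∀ i, φ i ∈ A := fun i => hφ ▸ Finset.mem_image_of_mem φ (Finset.mem_univ i)
    have : Nonempty {e : Fin m → L // IsMatching A b e ∧ ∀ i, ℓ (e i) = α i} :=
      ⟨φ, ⟨hinj, hφ, fun i j => hb _ (hmem i) _ (hmem j)⟩, fun i => by
        rw [hℓ _ (hmem i)]
        simp [hinj.eq_iff, Finset.sum_filter]⟩
    have hfin : Finite {e : Fin m → L // IsMatching A b e ∧ ∀ i, ℓ (e i) = α i} :=
      Finite.of_injective (fun e i => (⟨e.1 i,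
        (congrArg (e.1 i ∈ ·) e.2.1.2.1).mp (Finset.mem_image_of_mem e.1 (Finset.mem_univ i))⟩ : A)) fun e e' h =>
          Subtype.ext (funext fun i => Subtype.ext_iff.1 (congrFun h i))
    rw [completions, List.length_nil, pow_zero]
    exact_mod_cast Nat.card_pos
  | cons a fr ih =>
    obtain ⟨s, s'⟩ := a
    intro A Z b ℓ φ hAZ hfr hcard hb hφ hℓ
    obtain ⟨hs, hs', hss, hfr'⟩ := hfr
    have hmem : ∀ i, φ i ∈ A := fun i => hφ ▸ Finset.mem_image_of_mem φ (Finset.mem_univ i)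
    have hsφ : ∀ i, φ i ≠ s := fun i e => hs (e ▸ hAZ (hmem i))
    have hsφ' : ∀ i, φ i ≠ s' := fun i e => hs' (e ▸ hAZ (hmem i))
    obtain ⟨i, -, j, -, hij, hφij⟩ := Finset.exists_ne_map_eq_of_card_lt_of_maps_to
      (s := Finset.univ) (t := A) (f := φ) (by
        rw [Finset.card_univ, Fintype.card_fin]
        simp only [List.length_cons] at hcard
        omega) fun i _ => hmem i
    have hle : α i + α j ≤ ℓ (φ i) := by
      rw [hℓ _ (hmem i), ← Finset.sum_pair hij]
      refine Finset.sum_le_sum_of_subset fun a ha => ?_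
      simp only [Finset.mem_insert, Finset.mem_singleton] at ha
      rcases ha with rfl | rfl <;> simp [hφij]
    have hi := hα i
    have hj := hα j
    have hk : α i ∈ Finset.Ico 1 (ℓ (φ i)) := Finset.mem_Ico.2 (by omega)
    let φ' : Fin m → L := fun a => if a = i then s else if φ a = φ i then s' else φ a
    have key := ih (A := insert s (insert s' (A.erase (φ i)))) (Z := insert s (insert s' Z))
      (b := cutBlocks b (φ i) s s')
      (ℓ := Function.update (Function.update ℓ s (α i)) s' (ℓ (φ i) - α i)) φ'
      (fun a ha => by
        rcases Finset.mem_insert.1 ha with rfl | ha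
        · simp
        rcases Finset.mem_insert.1 ha with rfl | ha
        · simp
        · have := hAZ (Finset.mem_of_mem_erase ha)
          simp [this]) hfr' (by
        have h1 : s' ∉ A.erase (φ i) := fun h => hs' (hAZ (Finset.mem_of_mem_erase h))
        have h2 : s ∉ insert s' (A.erase (φ i)) := by
          rw [Finset.mem_insert, not_or]
          exact ⟨hss, fun h => hs (hAZ (Finset.mem_of_mem_erase h))⟩
        rw [Finset.card_insert_of_notMem h2, Finset.card_insert_of_notMem h1,
          Finset.card_erase_of_mem (hmem i)]
        have := Finset.card_pos.2 ⟨_, hmem i⟩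
        simp only [List.length_cons] at hcard
        omega) (by
        have hone : ∀ a ∈ insert s (insert s' (A.erase (φ i))),
            cutBlocks b (φ i) s s' a = b (φ i) := by
          intro a ha
          rcases Finset.mem_insert.1 ha with rfl | ha
          · simp [cutBlocks, hss]
          rcases Finset.mem_insert.1 ha with rfl | ha
          · simp [cutBlocks]
          · have haA := Finset.mem_of_mem_erase ha
            have h1 : a ≠ s := fun e => hs (e ▸ hAZ haA)
            have h2 : a ≠ s' := fun e => hs' (e ▸ hAZ haA)
            simp [cutBlocks, h1, h2, hb a haA _ (hmem i)]
        intro p hp q hq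
        rw [hone p hp, hone q hq]) (by
        ext p
        simp only [Finset.mem_image, Finset.mem_univ, true_and, Finset.mem_insert,
          Finset.mem_erase, φ']
        constructor
        · rintro ⟨a, rfl⟩
          split_ifs with h1 h2
          · exact Or.inl rfl
          · exact Or.inr (Or.inl rfl)
          · exact Or.inr (Or.inr ⟨h2, hmem a⟩)
        · rintro (rfl | rfl | ⟨h1, h2⟩)
          · exact ⟨i, if_pos rfl⟩
          · exact ⟨j, by rw [if_neg hij.symm, if_pos hφij.symm]⟩
          · rw [← hφ, Finset.mem_image] at h2
            obtain ⟨a, -, rfl⟩ := h2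
            refine ⟨a, ?_⟩
            rw [if_neg fun e => h1 (by rw [e]), if_neg h1]) (by
        intro p hp
        by_cases hps' : p = s'
        · subst hps'
          have : (Finset.univ.filter fun a => φ' a = p) =
              (Finset.univ.filter fun a => φ a = φ i).erase i := by
            ext a
            simp only [Finset.mem_filter, Finset.mem_univ, true_and, Finset.mem_erase, φ']
            split_ifs with h1 h2
            · simp [h1, hss]
            · simp [h1, h2]
            · simp [h1, h2, hsφ']
          rw [Function.update_self, this, hℓ _ (hmem i),
            ← Finset.add_sum_erase (Finset.univ.filter fun a => φ a = φ i) α (a := i) (by simp),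
            Nat.add_sub_cancel_left]
        rw [Function.update_of_ne hps']
        by_cases hps : p = s
        · subst hps
          have : (Finset.univ.filter fun a => φ' a = p) = {i} := by
            ext a
            simp only [Finset.mem_filter, Finset.mem_univ, true_and, Finset.mem_singleton, φ']
            split_ifs with h1 h2
            · simp [h1]
            · simp [h1, Ne.symm hss]
            · simp [h1, hsφ]
          rw [Function.update_self, this, Finset.sum_singleton]
        rw [Function.update_of_ne hps]
        simp only [Finset.mem_insert, hps, hps', false_or, Finset.mem_erase] at hp
        rw [hℓ p hp.2]
        congr 1
        ext a
        simp only [Finset.mem_filter, Finset.mem_univ, true_and, φ']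
        split_ifs with h1 h2
        · rw [h1]
          exact iff_of_false (Ne.symm hp.1) (Ne.symm hps)
        · rw [h2]
          exact iff_of_false (Ne.symm hp.1) (Ne.symm hps')
        · rfl)
    refine le_trans ?_ (le_completions_of_cut fr b ℓ (hmem i))
    have hnn := completions_nonneg α fr
    have h1 := Finset.single_le_sum (f := fun k => (ℓ (φ i) : ℚ) * completions α fr
      (insert s (insert s' (A.erase (φ i)))) (cutBlocks b (φ i) s s')
      (Function.update (Function.update ℓ s k) s' (ℓ (φ i) - k)))
      (fun k _ => mul_nonneg (by positivity) (hnn ..)) hk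
    have h2 : (t : ℚ) ≤ ℓ (φ i) := by exact_mod_cast (by omega : t ≤ ℓ (φ i))
    have h3 : (t : ℚ) * ((t : ℚ) / 2) ^ fr.length ≤ _ :=
      mul_le_mul h2 key (by positivity) (by positivity)
    rw [List.length_cons, pow_succ]
    linarith

theorem sum_mul_sub_ge (d : ℕ) (hd : 2 ≤ d) :
    (d : ℚ) ^ 3 / 8 ≤ ∑ k ∈ Finset.Ico 1 d, (k : ℚ) * ((d - k : ℕ) : ℚ) := by
  have h1 : ∀ n : ℕ, ∑ k ∈ Finset.range n, (k : ℚ) * ((d : ℚ) - k) =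
      d * (n * (n - 1) / 2) - n * (n - 1) * (2 * n - 1) / 6 := by
    intro n
    induction n with
    | zero => simp
    | succ n ih =>
      rw [Finset.sum_range_succ, ih]
      push_cast
      ring
  have h2 : ∑ k ∈ Finset.Ico 1 d, (k : ℚ) * ((d - k : ℕ) : ℚ) =
      ∑ k ∈ Finset.range d, (k : ℚ) * ((d : ℚ) - k) := by
    rw [Finset.range_eq_Ico, Finset.sum_eq_sum_Ico_succ_bot (by omega : 0 < d)]
    simp only [Nat.cast_zero, zero_mul, zero_add]
    refine Finset.sum_congr rfl fun k hk => ?_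
    rw [Nat.cast_sub (Finset.mem_Ico.1 hk).2.le]
  rw [h2, h1]
  have hd' : (2 : ℚ) ≤ d := by exact_mod_cast hd
  nlinarith [mul_nonneg (by linarith : (0 : ℚ) ≤ d) (mul_nonneg (by linarith : (0 : ℚ) ≤ d - 2)
    (by linarith : (0 : ℚ) ≤ (d : ℚ) + 2))]

/-- A single strand can be cut and joined again any number of times before the ends are cut off. -/
theorem le_completions_of_singleton {t : ℕ} (ht : 2 ≤ t) (hα : ∀ i, t ≤ α i) (hm : 1 ≤ m) (g : ℕ) :
    ∀ {fr : List (L × L)} {a : L} {Z : Finset L} {b : L → L} {ℓ : L → ℕ}, a ∈ Z → Fresh fr Z →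
      fr.length = 2 * g + (m - 1) → ℓ a = ∑ i, α i →
      ((t : ℚ) ^ 4 / 32) ^ g * ((t : ℚ) / 2) ^ (m - 1) ≤ completions α fr {a} b ℓ := by
  induction g with
  | zero =>
    intro fr a Z b ℓ ha hfr hlen hℓ
    have := le_completions_of_assignment (α := α) (by omega : 0 < t) hα fr (A := {a}) (b := b)
      (ℓ := ℓ) (fun _ => a) (by simpa using ha) hfr (by rw [Finset.card_singleton]; omega) (by simp)
      (by
        have : Nonempty (Fin m) := ⟨⟨0, hm⟩⟩
        exact Finset.image_const Finset.univ_nonempty a) (by simp [hℓ])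
    rw [hlen] at this
    simpa using this
  | succ g ih =>
    intro fr a Z b ℓ ha hfr hlen hℓ
    obtain ⟨⟨s₁, s₁'⟩, fr, rfl⟩ : ∃ x fr', fr = x :: fr' :=
      List.exists_cons_of_length_pos (by omega)
    simp only [List.length_cons] at hlen
    obtain ⟨⟨s₂, s₂'⟩, fr, rfl⟩ : ∃ x fr', fr = x :: fr' :=
      List.exists_cons_of_length_pos (by omega)
    simp only [List.length_cons] at hlen
    obtain ⟨hs₁, hs₁', hss₁, hs₂, hs₂', hss₂, hfr'⟩ := hfr
    have hta : t ≤ ℓ a := by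
      rw [hℓ]
      exact (hα ⟨0, hm⟩).trans (Finset.single_le_sum (f := α) (fun _ _ => Nat.zero_le _)
        (Finset.mem_univ _))
    refine le_trans ?_ (le_completions_of_cut _ b ℓ (Finset.mem_singleton_self a))
    set C : ℚ := ((t : ℚ) ^ 4 / 32) ^ g * ((t : ℚ) / 2) ^ (m - 1) with hC
    have hC0 : 0 ≤ C := by positivity
    have hterm : ∀ k ∈ Finset.Ico 1 (ℓ a),
        (ℓ a : ℚ) * (1 / 2 * ((k : ℚ) * ((ℓ a - k : ℕ) : ℚ) * C)) ≤ (ℓ a : ℚ) *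
        completions α ((s₂, s₂') :: fr) (insert s₁ (insert s₁' (({a} : Finset L).erase a)))
          (cutBlocks b a s₁ s₁') (Function.update (Function.update ℓ s₁ k) s₁' (ℓ a - k)) := by
      intro k hk
      obtain ⟨hk1, hk2⟩ := Finset.mem_Ico.1 hk
      refine mul_le_mul_of_nonneg_left ?_ (by positivity)
      have hset : insert s₁ (insert s₁' (({a} : Finset L).erase a)) = {s₁, s₁'} := by simp
      rw [hset]
      have hmem' : s₁' ∈ ({s₁, s₁'} : Finset L).erase s₁ := by simp [Ne.symm hss₁]
      refine le_trans ?_ (le_completions_of_join fr _ _ (p := s₁) (q := s₁') (by simp) hmem')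
      have hset' : insert s₂ ((({s₁, s₁'} : Finset L).erase s₁).erase s₁') = {s₂} := by
        rw [Finset.erase_insert (by simpa using hss₁)]
        simp
      rw [hset']
      have h1 : Function.update (Function.update ℓ s₁ k) s₁' (ℓ a - k) s₁ = k := by
        rw [Function.update_of_ne hss₁, Function.update_self]
      have h2 : Function.update (Function.update ℓ s₁ k) s₁' (ℓ a - k) s₁' = ℓ a - k := by
        rw [Function.update_self]
      rw [h1, h2]
      refine mul_le_mul_of_nonneg_left (mul_le_mul_of_nonneg_left ?_ (by positivity)) (by norm_num)
      refine ih (Z := insert s₂ (insert s₂' (insert s₁ (insert s₁' Z)))) (by simp) hfr'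
        (by omega) ?_
      rw [Function.update_self, ← hℓ]
      omega
    refine le_trans ?_ (mul_le_mul_of_nonneg_left (Finset.sum_le_sum hterm) (by norm_num))
    have hsum : ∑ k ∈ Finset.Ico 1 (ℓ a),
        (ℓ a : ℚ) * (1 / 2 * ((k : ℚ) * ((ℓ a - k : ℕ) : ℚ) * C)) =
        (ℓ a : ℚ) / 2 * C * ∑ k ∈ Finset.Ico 1 (ℓ a), (k : ℚ) * ((ℓ a - k : ℕ) : ℚ) := by
      rw [Finset.mul_sum]
      exact Finset.sum_congr rfl fun k _ => by ring
    rw [hsum]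
    have h3 := sum_mul_sub_ge (ℓ a) (ht.trans hta)
    have h4 : (t : ℚ) ^ 4 ≤ (ℓ a : ℚ) ^ 4 := by
      have : (t : ℚ) ≤ ℓ a := by exact_mod_cast hta
      gcongr
    calc ((t : ℚ) ^ 4 / 32) ^ (g + 1) * ((t : ℚ) / 2) ^ (m - 1)
        = (t : ℚ) ^ 4 / 32 * C := by rw [hC]; ring
      _ ≤ (ℓ a : ℚ) ^ 4 / 32 * C := by gcongr
      _ = 1 / 2 * ((ℓ a : ℚ) / 2 * C * ((ℓ a : ℚ) ^ 3 / 8)) := by ring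
      _ ≤ _ := by gcongr

/-- All strands can be joined to a single one. -/
theorem le_completions {t : ℕ} (ht : 2 ≤ t) (hα : ∀ i, t ≤ α i) (hm : 1 ≤ m) (g N : ℕ) :
    ∀ {fr : List (L × L)} {A Z : Finset L} {b : L → L} {ℓ : L → ℕ}, A ⊆ Z → Fresh fr Z →
      A.card = N + 1 → fr.length = N + (2 * g + (m - 1)) → (∀ p ∈ A, t ≤ ℓ p) →
      ∑ p ∈ A, ℓ p = ∑ i, α i →
      ((t : ℚ) ^ 2 / 2) ^ N * (((t : ℚ) ^ 4 / 32) ^ g * ((t : ℚ) / 2) ^ (m - 1)) ≤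
        completions α fr A b ℓ := by
  induction N with
  | zero =>
    intro fr A Z b ℓ hAZ hfr hA hlen hℓ hsum
    obtain ⟨a, rfl⟩ := Finset.card_eq_one.1 hA
    rw [pow_zero, one_mul]
    exact le_completions_of_singleton ht hα hm g (hAZ (Finset.mem_singleton_self a)) hfr
      (by omega) (by simpa using hsum)
  | succ N ih =>
    intro fr A Z b ℓ hAZ hfr hA hlen hℓ hsum
    obtain ⟨⟨s, s'⟩, fr, rfl⟩ : ∃ x fr', fr = x :: fr' :=
      List.exists_cons_of_length_pos (by omega)
    simp only [List.length_cons] at hlen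
    obtain ⟨hs, hs', hss, hfr'⟩ := hfr
    obtain ⟨p, hp, q, hq, hpq⟩ := Finset.one_lt_card.1 (by omega : 1 < A.card)
    have hq' : q ∈ A.erase p := Finset.mem_erase.2 ⟨hpq.symm, hq⟩
    refine le_trans ?_ (le_completions_of_join fr b ℓ hp hq')
    have hsA : s ∉ (A.erase p).erase q := fun h =>
      hs (hAZ (Finset.mem_of_mem_erase (Finset.mem_of_mem_erase h)))
    have hne : ∀ a ∈ (A.erase p).erase q, a ≠ s := fun a ha e => hsA (e ▸ ha)
    have key := ih (A := insert s ((A.erase p).erase q)) (Z := insert s (insert s' Z))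
      (b := joinBlocks b p q s) (ℓ := Function.update ℓ s (ℓ p + ℓ q)) (fun a ha => by
        rcases Finset.mem_insert.1 ha with rfl | ha
        · simp
        · have := hAZ (Finset.mem_of_mem_erase (Finset.mem_of_mem_erase ha))
          simp [this]) hfr' (by
        rw [Finset.card_insert_of_notMem hsA, Finset.card_erase_of_mem hq',
          Finset.card_erase_of_mem hp]
        omega) (by omega) (fun a ha => by
        rcases Finset.mem_insert.1 ha with rfl | ha
        · rw [Function.update_self]
          have := hℓ p hp
          omega
        · rw [Function.update_of_ne (hne a ha)]
          exact hℓ a (Finset.mem_of_mem_erase (Finset.mem_of_mem_erase ha))) (by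
        rw [Finset.sum_insert hsA, Function.update_self, ← hsum, ← Finset.add_sum_erase A ℓ hp,
          ← Finset.add_sum_erase (A.erase p) ℓ hq', add_assoc]
        congr 2
        exact Finset.sum_congr rfl fun a ha => Function.update_of_ne (hne a ha) _ _)
    have h1 : (t : ℚ) ≤ ℓ p := by exact_mod_cast hℓ p hp
    have h2 : (t : ℚ) ≤ ℓ q := by exact_mod_cast hℓ q hq
    calc ((t : ℚ) ^ 2 / 2) ^ (N + 1) * (((t : ℚ) ^ 4 / 32) ^ g * ((t : ℚ) / 2) ^ (m - 1))
        = 1 / 2 * ((t : ℚ) * t * (((t : ℚ) ^ 2 / 2) ^ N *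
            (((t : ℚ) ^ 4 / 32) ^ g * ((t : ℚ) / 2) ^ (m - 1)))) := by ring
      _ ≤ _ := by gcongr

end LowerBound

/-! ### The double Hurwitz numbers as a function of the parts -/

section Hurwitz

variable {m n : ℕ}

/-- Labels for the points over `∞`, and two new labels for each of `r` transpositions. -/
abbrev Strand (n r : ℕ) : Type := Fin n ⊕ (Fin r × Bool)

/-- The pairs of new labels. -/
def freshStrands (n r : ℕ) : List (Strand n r × Strand n r) :=
  (List.finRange r).map fun i => (Sum.inr (i, false), Sum.inr (i, true))

theorem fresh_freshStrands (n r : ℕ) :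
    Fresh (freshStrands n r) (Finset.univ.image (Sum.inl : Fin n → Strand n r)) := by
  have h : ∀ (l : List (Fin r)) (Z : Finset (Strand n r)), l.Nodup →
      (∀ i ∈ l, ∀ e, Sum.inr (i, e) ∉ Z) →
      Fresh (l.map fun i => ((Sum.inr (i, false), Sum.inr (i, true)) : Strand n r × Strand n r))
        Z := by
    intro l
    induction l with
    | nil => exact fun _ _ _ => trivial
    | cons i l ih =>
      intro Z hl hZ
      obtain ⟨hi, hl⟩ := List.nodup_cons.1 hl
      refine ⟨hZ i (by simp) false, hZ i (by simp) true, by simp, ih _ hl fun j hj e => ?_⟩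
      have hij : j ≠ i := fun e => hi (e ▸ hj)
      simp [hij, hZ j (List.mem_cons_of_mem _ hj) e]
  exact h _ _ (List.nodup_finRange r) fun i _ e => by simp

theorem hurwitzFunction_eq_completions (g : ℕ) {x : Fin m ⊕ Fin n → ℕ}
    (hx : x ∈ hurwitzDomain m n) :
    hurwitzFunction g m n x = completions (fun i => x (Sum.inl i))
      (freshStrands n (2 * g + m + n - 2)) (Finset.univ.image Sum.inl) id
      (Sum.elim (fun j => x (Sum.inr j)) fun _ => 0) / ∏ j, (x (Sum.inr j) : ℚ) :=
  doubleHurwitz_eq_completions g (fun j => hx.1 (Sum.inr j)) hx.2 ⟨Sum.inl, Sum.inl_injective⟩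
    (fun _ => rfl) (by simp [freshStrands]) (fresh_freshStrands n _)

theorem scale_mem_hurwitzDomain {x : Fin m ⊕ Fin n → ℕ} (hx : x ∈ hurwitzDomain m n) {t : ℕ}
    (ht : 1 ≤ t) : (fun i => t * x i) ∈ hurwitzDomain m n :=
  ⟨fun i => Nat.mul_pos ht (hx.1 i), by rw [← Finset.mul_sum, ← Finset.mul_sum, hx.2]⟩

theorem exists_pos_le_hurwitzFunction {g : ℕ} (hm : 1 ≤ m) (hn : 1 ≤ n) (h : (g, m, n) ≠ (0, 1, 1))
    {x : Fin m ⊕ Fin n → ℕ} (hx : x ∈ hurwitzDomain m n) :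
    ∃ C : ℚ, 0 < C ∧ ∀ t : ℕ, 2 ≤ t →
      C * (t : ℚ) ^ (4 * g + m + n - 3) ≤ hurwitzFunction g m n (fun i => t * x i) := by
  have hβ : (0 : ℚ) < ∏ j, (x (Sum.inr j) : ℚ) := Finset.prod_pos fun j _ => by
    exact_mod_cast hx.1 (Sum.inr j)
  refine ⟨(1 / 2) ^ (n - 1) * ((1 / 32) ^ g * (1 / 2) ^ (m - 1)) / ∏ j, (x (Sum.inr j) : ℚ),
    by positivity, fun t ht => ?_⟩
  have ht0 : (0 : ℚ) < t := by exact_mod_cast (by omega : 0 < t)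
  have hle : ∀ i, t ≤ t * x i := fun i => Nat.le_mul_of_pos_right t (hx.1 i)
  have key := le_completions (α := fun i => t * x (Sum.inl i)) ht (fun i => hle _) hm g (n - 1)
    (b := id) (ℓ := Sum.elim (fun j => t * x (Sum.inr j)) fun _ => 0)
    (Finset.Subset.refl _) (fresh_freshStrands n (2 * g + m + n - 2))
    (by
      rw [Finset.card_image_of_injective _ Sum.inl_injective, Finset.card_univ, Fintype.card_fin]
      omega)
    (by
      simp only [freshStrands, List.length_map, List.length_finRange]
      omega)
    (fun p hp => by
      obtain ⟨j, -, rfl⟩ := Finset.mem_image.1 hp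
      exact hle _)
    (by
      rw [Finset.sum_image fun _ _ _ _ h => Sum.inl_injective h]
      exact (scale_mem_hurwitzDomain hx (by omega : 1 ≤ t)).2.symm)
  rw [hurwitzFunction_eq_completions g (scale_mem_hurwitzDomain hx (by omega : 1 ≤ t)),
    le_div_iff₀ (Finset.prod_pos fun j _ => by
      exact_mod_cast Nat.mul_pos (by omega : 0 < t) (hx.1 (Sum.inr j)))]
  refine le_trans (le_of_eq ?_) key
  have hprod : ∏ j : Fin n, ((t * x (Sum.inr j) : ℕ) : ℚ) =
      (t : ℚ) ^ n * ∏ j, (x (Sum.inr j) : ℚ) := by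
    simp only [Nat.cast_mul, Finset.prod_mul_distrib, Finset.prod_const, Finset.card_univ,
      Fintype.card_fin]
  rw [hprod]
  -- without truncation `4 * g + m + n - 3 + n = 2 * (n - 1) + 4 * g + (m - 1)`
  have h3 : 3 ≤ 4 * g + m + n := by
    by_contra h0
    exact h (by rw [Prod.mk.injEq, Prod.mk.injEq]; omega)
  have hexp : (t : ℚ) ^ (4 * g + m + n - 3) * (t : ℚ) ^ n =
      ((t : ℚ) ^ 2) ^ (n - 1) * (((t : ℚ) ^ 4) ^ g * (t : ℚ) ^ (m - 1)) := by
    rw [← pow_mul, ← pow_mul, ← pow_add, ← pow_add, ← pow_add]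
    congr 1
    omega
  rw [div_mul_eq_mul_div, div_mul_eq_mul_div, div_eq_iff hβ.ne']
  simp only [div_pow, one_pow]
  linear_combination (1 / 2 ^ (n - 1) * (1 / 32 ^ g * (1 / 2 ^ (m - 1))) *
    ∏ j, (x (Sum.inr j) : ℚ)) * hexp

/-- A polynomial function bounded from below by a multiple of `t ^ D` has degree at least `D`. -/
theorem Polynomial.le_natDegree_of_le_eval {q : Polynomial ℚ} {D : ℕ} {C : ℚ} (hC : 0 < C)
    (h : ∀ t : ℕ, 2 ≤ t → C * (t : ℚ) ^ D ≤ q.eval (t : ℚ)) : (D : WithBot ℕ) ≤ q.degree := by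
  by_contra hlt
  push Not at hlt
  have h1 := Polynomial.div_tendsto_atTop_zero_of_degree_lt q (Polynomial.X ^ D)
    (by rwa [Polynomial.degree_X_pow])
  have h2 := h1.comp (tendsto_natCast_atTop_atTop (R := ℚ))
  have h3 : ∀ᶠ t : ℕ in Filter.atTop, C ≤
      ((fun x : ℚ => q.eval x / (Polynomial.X ^ D : Polynomial ℚ).eval x) ∘ Nat.cast) t := by
    filter_upwards [Filter.eventually_ge_atTop 2] with t ht
    have ht0 : (0 : ℚ) < t := by exact_mod_cast (by omega : 0 < t)
    simp only [Function.comp_apply, Polynomial.eval_pow, Polynomial.eval_X]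
    rw [le_div_iff₀ (by positivity)]
    exact h t ht
  exact absurd (ge_of_tendsto h2 h3) (not_le.2 hC)

theorem isPiecewisePolynomialOn_hurwitzFunction {g : ℕ} (hm : 1 ≤ m) (hn : 1 ≤ n)
    (h : (g, m, n) ≠ (0, 1, 1)) :
    IsPiecewisePolynomialOn (hurwitzDomain m n) (hurwitzFunction g m n) (4 * g + m + n - 3) := by
  have hr : 1 ≤ 2 * g + m + n - 2 := by
    by_contra h0
    exact h (by rw [Prod.mk.injEq, Prod.mk.injEq]; omega)
  have hlen : (freshStrands n (2 * g + m + n - 2)).length = 2 * g + m + n - 2 := by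
    simp [freshStrands]
  have key := FlowSystem.isPiecewisePolynomialOn_completions
    (fresh_freshStrands n (2 * g + m + n - 2)) hm (by rwa [hlen])
  rw [hlen, show 2 * (2 * g + m + n - 2) + 1 - (m + n) = 4 * g + m + n - 3 by omega] at key
  exact key.congr fun x hx => hurwitzFunction_eq_completions g hx

theorem hurwitzFunction_zero_one_one {x : Fin 1 ⊕ Fin 1 → ℕ} (hx : x ∈ hurwitzDomain 1 1) :
    hurwitzFunction 0 1 1 x = 1 / ((∑ i, x (Sum.inl i) : ℕ) : ℚ) := by
  have hsum := hx.2
  simp only [Finset.univ_unique, Fin.default_eq_zero, Finset.sum_singleton] at hsum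
  rw [hurwitzFunction_eq_completions 0 hx]
  have hfr : freshStrands 1 (2 * 0 + 1 + 1 - 2) = [] := rfl
  rw [hfr, completions]
  have : Nat.card {e : Fin 1 → Strand 1 (2 * 0 + 1 + 1 - 2) //
      IsMatching (Finset.univ.image Sum.inl) id e ∧ ∀ i,
        (Sum.elim (fun j => x (Sum.inr j)) fun _ => 0 : Strand 1 (2 * 0 + 1 + 1 - 2) → ℕ) (e i) =
          x (Sum.inl i)} = 1 := by
    rw [Nat.card_eq_one_iff_unique]
    refine ⟨⟨fun ⟨e, he⟩ ⟨e', he'⟩ => ?_⟩, ⟨fun _ => Sum.inl 0, ⟨?_, ?_, ?_⟩, ?_⟩⟩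
    · have h1 : ∀ e : Fin 1 → Strand 1 (2 * 0 + 1 + 1 - 2),
          Finset.univ.image e = Finset.univ.image Sum.inl → e = fun _ => Sum.inl 0 := by
        intro e he
        ext i
        have := Finset.mem_image_of_mem e (Finset.mem_univ i)
        rw [he] at this
        simpa using this
      rw [Subtype.mk.injEq, h1 e he.1.2.1, h1 e' he'.1.2.1]
    · exact Function.injective_of_subsingleton _
    · simp
    · intro i j
      rfl
    · intro i
      rw [Subsingleton.elim i 0]
      exact hsum.symm
  rw [this]
  simp [hsum]

end Hurwitz

theorem theorem2p1 (g m n : ℕ) (hm : 1 ≤ m) (hn : 1 ≤ n) :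
    ((g, m, n) ≠ (0, 1, 1) →
      IsPiecewisePolynomialOn (hurwitzDomain m n) (hurwitzFunction g m n) (4 * g + m + n - 3) ∧
      ∀ x ∈ hurwitzDomain m n, ∃ q : Polynomial ℚ,
        q.degree = ((4 * g + m + n - 3 : ℕ) : WithBot ℕ) ∧
        ∀ t : ℕ, 1 ≤ t → hurwitzFunction g m n (fun i => t * x i) = q.eval (t : ℚ)) ∧
    ((g, m, n) = (0, 1, 1) →
      ∀ x ∈ hurwitzDomain m n,
        hurwitzFunction g m n x = 1 / ((∑ i, x (Sum.inl i) : ℕ) : ℚ)) := by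
  refine ⟨fun h => ?_, fun h x hx => ?_⟩
  · have hpp := isPiecewisePolynomialOn_hurwitzFunction hm hn h
    refine ⟨hpp, fun x hx => ?_⟩
    obtain ⟨q, hq, hqe⟩ := hpp.exists_polynomial_on_ray hx fun t ht =>
      scale_mem_hurwitzDomain hx ht
    obtain ⟨C, hC, hle⟩ := exists_pos_le_hurwitzFunction hm hn h hx
    refine ⟨q, le_antisymm (Polynomial.degree_le_of_natDegree_le hq)
      (Polynomial.le_natDegree_of_le_eval hC fun t ht => ?_), hqe⟩
    rw [← hqe t (by omega)]
    exact hle t ht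
  · simp only [Prod.mk.injEq] at h
    obtain ⟨rfl, rfl, rfl⟩ := h
    exact hurwitzFunction_zero_one_one hx
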